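/- Let $d\ge 2$ and let $\Omega\subset\mathbb{R}^d$ be a bounded convex domain (a nonempty, bounded, open, convex set) with diameter $D$ and volume $|\Omega|$. A real $\sigma\ge 0$ is a Steklov eigenvalue of $\Omega$ if there is a nonzero $u\in H^1(\Omega)$ such that $$\int_\Omega \nabla u\cdot\nabla v\,dx=\sigma\int_{\partial\Omega}uv\,ds\qquad\text{for all } v\in H^1(\Omega),$$ where the boundary values are taken in the sense of traces and $ds$ is the $(d-1)$-dimensional Hausdorff measure on $\partial\Omega$. Let $0=\sigma_0(\Omega)\le\sigma_1(\Omega)\le\sigma_2(\Omega)\le\dots$ be these eigenvalues, repeated according to multiplicity. Then for every integer $k\ge 0$, $$\sigma_k(\Omega)\le C(d,k)\,\frac{|\Omega|^{\frac1{d-1}}}{D^{\frac{2d-1}{d-1}}},$$ with the explicit constant, depending only on $d$ and $k$, $$C(d,k)=\frac{[2(k+1)]^{d+1}}{4\,C_d},\qquad C_d=\frac{\omega_{d-2}}{(d-1)\,\omega_{d-1}^{(d-2)/(d-1)}},$$ where $\omega_n$ is the volume of the unit ball of $\mathbb{R}^n$ ($\omega_0=1$). -/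

import Mathlib

open MeasureTheory
open scoped ENNReal NNReal ContDiff

noncomputable section

namespace Steklov

/-- Euclidean space of dimension `d`. -/
abbrev Space (d : ℕ) : Type := EuclideanSpace ℝ (Fin d)

/-- The Lebesgue measure on `Ω`. -/
abbrev bulk {d : ℕ} (Ω : Set (Space d)) : Measure (Space d) :=
  volume.restrict Ω

/-- The surface measure `ds` on `∂Ω`: the `(d-1)`-dimensional Hausdorff measure, with the usual
Euclidean normalization, restricted to the boundary. -/
abbrev surface {d : ℕ} (Ω : Set (Space d)) : Measure (Space d) :=
  (Measure.euclideanHausdorffMeasure (d - 1)).restrict (frontier Ω)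

/-- `L²(Ω)`. -/
abbrev L2Bulk {d : ℕ} (Ω : Set (Space d)) : Type := Lp ℝ 2 (bulk Ω)

/-- `L²(Ω; ℝᵈ)`. -/
abbrev L2Field {d : ℕ} (Ω : Set (Space d)) : Type := Lp (Space d) 2 (bulk Ω)

/-- `L²(∂Ω)`. -/
abbrev L2Bdry {d : ℕ} (Ω : Set (Space d)) : Type := Lp ℝ 2 (surface Ω)

/-- `G` is the weak gradient of `u` on `Ω`: `∫_Ω u ∂ᵢφ = - ∫_Ω Gᵢ φ` for every test function
`φ ∈ C_c^∞(Ω)` and every coordinate `i`. -/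
def IsWeakGradient {d : ℕ} (Ω : Set (Space d)) (u : L2Bulk Ω) (G : L2Field Ω) : Prop :=
  ∀ φ : Space d → ℝ, ContDiff ℝ ∞ φ → HasCompactSupport φ → tsupport φ ⊆ Ω →
    ∀ i : Fin d,
      ∫ x in Ω, u x * fderiv ℝ φ x (EuclideanSpace.single i 1) = - ∫ x in Ω, G x i * φ x

theorem integrable_mul_test {d : ℕ} {Ω : Set (Space d)} (u : L2Bulk Ω) {φ : Space d → ℝ}
    (hφ : Continuous φ) (hc : HasCompactSupport φ) :
    Integrable (fun x => u x * φ x) (bulk Ω) :=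
  MemLp.integrable_mul (p := 2) (q := 2) (Lp.memLp u) (hφ.memLp_of_hasCompactSupport hc)

theorem integrable_coord_mul_test {d : ℕ} {Ω : Set (Space d)} (G : L2Field Ω) (i : Fin d)
    {φ : Space d → ℝ} (hφ : Continuous φ) (hc : HasCompactSupport φ) :
    Integrable (fun x => G x i * φ x) (bulk Ω) := by
  have h : MemLp (fun x => G x i) 2 (bulk Ω) :=
    (EuclideanSpace.proj i : Space d →L[ℝ] ℝ).comp_memLp' (Lp.memLp G)
  exact MemLp.integrable_mul (p := 2) (q := 2) h (hφ.memLp_of_hasCompactSupport hc)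

theorem continuous_test_deriv {d : ℕ} {φ : Space d → ℝ} (hφ : ContDiff ℝ ∞ φ) (v : Space d) :
    Continuous (fun x => fderiv ℝ φ x v) :=
  (hφ.continuous_fderiv (by simp)).clm_apply continuous_const

theorem IsWeakGradient.add {d : ℕ} {Ω : Set (Space d)} {u v : L2Bulk Ω} {G H : L2Field Ω}
    (hu : IsWeakGradient Ω u G) (hv : IsWeakGradient Ω v H) :
    IsWeakGradient Ω (u + v) (G + H) := by
  intro φ hφ hc hs i
  have hd := continuous_test_deriv hφ (EuclideanSpace.single i 1)
  have hdc : HasCompactSupport (fun x => fderiv ℝ φ x (EuclideanSpace.single i 1)) :=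
    hc.fderiv_apply ℝ _
  have e1 : ∫ x in Ω, (u + v : L2Bulk Ω) x * fderiv ℝ φ x (EuclideanSpace.single i 1)
      = (∫ x in Ω, u x * fderiv ℝ φ x (EuclideanSpace.single i 1))
        + ∫ x in Ω, v x * fderiv ℝ φ x (EuclideanSpace.single i 1) := by
    rw [← integral_add (integrable_mul_test u hd hdc) (integrable_mul_test v hd hdc)]
    apply integral_congr_ae
    filter_upwards [Lp.coeFn_add u v] with x hx
    rw [hx, Pi.add_apply, add_mul]
  have e2 : ∫ x in Ω, (G + H : L2Field Ω) x i * φ x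
      = (∫ x in Ω, G x i * φ x) + ∫ x in Ω, H x i * φ x := by
    rw [← integral_add (integrable_coord_mul_test G i hφ.continuous hc)
      (integrable_coord_mul_test H i hφ.continuous hc)]
    apply integral_congr_ae
    filter_upwards [Lp.coeFn_add G H] with x hx
    rw [hx, Pi.add_apply, PiLp.add_apply, add_mul]
  rw [e1, e2, hu φ hφ hc hs i, hv φ hφ hc hs i]
  ring

theorem IsWeakGradient.smul {d : ℕ} {Ω : Set (Space d)} {u : L2Bulk Ω} {G : L2Field Ω} (c : ℝ)
    (hu : IsWeakGradient Ω u G) : IsWeakGradient Ω (c • u) (c • G) := by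
  intro φ hφ hc hs i
  have e1 : ∫ x in Ω, (c • u : L2Bulk Ω) x * fderiv ℝ φ x (EuclideanSpace.single i 1)
      = c * ∫ x in Ω, u x * fderiv ℝ φ x (EuclideanSpace.single i 1) := by
    rw [← integral_const_mul]
    apply integral_congr_ae
    filter_upwards [Lp.coeFn_smul c u] with x hx
    rw [hx, Pi.smul_apply, smul_eq_mul, mul_assoc]
  have e2 : ∫ x in Ω, (c • G : L2Field Ω) x i * φ x = c * ∫ x in Ω, G x i * φ x := by
    rw [← integral_const_mul]
    apply integral_congr_ae
    filter_upwards [Lp.coeFn_smul c G] with x hx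
    rw [hx, Pi.smul_apply, PiLp.smul_apply, smul_eq_mul, mul_assoc]
  rw [e1, e2, hu φ hφ hc hs i]
  ring

theorem IsWeakGradient.zero {d : ℕ} (Ω : Set (Space d)) :
    IsWeakGradient Ω (0 : L2Bulk Ω) (0 : L2Field Ω) := by
  intro φ _ _ _ i
  have e1 : ∫ x in Ω, (0 : L2Bulk Ω) x * fderiv ℝ φ x (EuclideanSpace.single i 1) = 0 := by
    rw [← integral_zero (Space d) ℝ (μ := bulk Ω)]
    apply integral_congr_ae
    filter_upwards [Lp.coeFn_zero ℝ 2 (bulk Ω)] with x hx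
    rw [hx, Pi.zero_apply, zero_mul]
  have e2 : ∫ x in Ω, (0 : L2Field Ω) x i * φ x = 0 := by
    rw [← integral_zero (Space d) ℝ (μ := bulk Ω)]
    apply integral_congr_ae
    filter_upwards [Lp.coeFn_zero (Space d) 2 (bulk Ω)] with x hx
    rw [hx, Pi.zero_apply, PiLp.zero_apply, zero_mul]
  rw [e1, e2, neg_zero]

/-- The triples `(φ, ∇φ, φ|∂Ω)` in `L²(Ω) × L²(Ω; ℝᵈ) × L²(∂Ω)`, for `φ ∈ C_c^∞(ℝᵈ)`. -/
def smoothTriples {d : ℕ} (Ω : Set (Space d)) :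
    Submodule ℝ (L2Bulk Ω × L2Field Ω × L2Bdry Ω) where
  carrier := {p | ∃ φ : Space d → ℝ, ContDiff ℝ ∞ φ ∧ HasCompactSupport φ ∧
    p.1 =ᵐ[bulk Ω] φ ∧ p.2.1 =ᵐ[bulk Ω] gradient φ ∧ p.2.2 =ᵐ[surface Ω] φ}
  add_mem' := by
    rintro ⟨u, G, g⟩ ⟨v, H, h⟩ ⟨φ, hφ, hφc, h1, h2, h3⟩ ⟨ψ, hψ, hψc, k1, k2, k3⟩
    refine ⟨φ + ψ, hφ.add hψ, hφc.add hψc, (Lp.coeFn_add u v).trans (h1.add k1),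
      ?_, (Lp.coeFn_add g h).trans (h3.add k3)⟩
    refine ((Lp.coeFn_add G H).trans (h2.add k2)).trans (Filter.Eventually.of_forall fun x => ?_)
    have a := (hφ.differentiable (by simp)) x
    have b := (hψ.differentiable (by simp)) x
    simp [gradient, fderiv_add a b]
  zero_mem' := by
    refine ⟨0, contDiff_const, HasCompactSupport.zero, Lp.coeFn_zero _ _ _, ?_,
      Lp.coeFn_zero _ _ _⟩
    refine (Lp.coeFn_zero _ _ _).trans (Filter.Eventually.of_forall fun x => ?_)
    simp [gradient]
  smul_mem' := by
    rintro c ⟨u, G, g⟩ ⟨φ, hφ, hφc, h1, h2, h3⟩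
    refine ⟨c • φ, contDiff_const.smul hφ, hφc.smul_left (f := fun _ => c),
      (Lp.coeFn_smul c u).trans (h1.const_smul c),
      ?_, (Lp.coeFn_smul c g).trans (h3.const_smul c)⟩
    refine ((Lp.coeFn_smul c G).trans (h2.const_smul c)).trans
      (Filter.Eventually.of_forall fun x => ?_)
    have a := (hφ.differentiable (by simp)) x
    simp [gradient, fderiv_const_smul a c]

/-- `IsTrace Ω u G g`: the function `u`, with gradient `G`, has trace `g` on `∂Ω`. That is, there are
`φₙ ∈ C_c^∞(ℝᵈ)` with `φₙ → u` in `H¹(Ω)` and `φₙ|∂Ω → g` in `L²(∂Ω)`. On a bounded Lipschitz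
domain this is the graph of the trace operator `H¹(Ω) → L²(∂Ω)`. -/
def IsTrace {d : ℕ} (Ω : Set (Space d)) (u : L2Bulk Ω) (G : L2Field Ω) (g : L2Bdry Ω) : Prop :=
  (u, G, g) ∈ (smoothTriples Ω).topologicalClosure

/-- The space of weak solutions `u ∈ H¹(Ω)` of the Steklov problem
`Δu = 0` in `Ω`, `∂u/∂n = σ u` on `∂Ω`, that is
`∫_Ω ∇u · ∇v dx = σ ∫_∂Ω u v ds` for all `v ∈ H¹(Ω)`.
Here `inner ℝ G H = ∫_Ω ∇u · ∇v dx` and `inner ℝ g h = ∫_∂Ω u v ds`. -/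
def eigenspace {d : ℕ} (Ω : Set (Space d)) (σ : ℝ≥0) : Submodule ℝ (L2Bulk Ω) where
  carrier := {u | ∃ (G : L2Field Ω) (g : L2Bdry Ω), IsWeakGradient Ω u G ∧ IsTrace Ω u G g ∧
    ∀ (v : L2Bulk Ω) (H : L2Field Ω) (h : L2Bdry Ω), IsWeakGradient Ω v H → IsTrace Ω v H h →
      inner ℝ G H = (σ : ℝ) * inner ℝ g h}
  add_mem' := by
    rintro u₁ u₂ ⟨G₁, g₁, hw₁, ht₁, he₁⟩ ⟨G₂, g₂, hw₂, ht₂, he₂⟩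
    refine ⟨G₁ + G₂, g₁ + g₂, hw₁.add hw₂, Submodule.add_mem _ ht₁ ht₂, ?_⟩
    intro v H h hw ht
    rw [inner_add_left, inner_add_left, he₁ v H h hw ht, he₂ v H h hw ht]
    ring
  zero_mem' := by
    refine ⟨0, 0, IsWeakGradient.zero Ω, Submodule.zero_mem _, ?_⟩
    intro v H h _ _
    simp
  smul_mem' := by
    rintro c u ⟨G, g, hw₁, ht₁, he₁⟩
    refine ⟨c • G, c • g, hw₁.smul c, Submodule.smul_mem _ c ht₁, ?_⟩
    intro v H h hw ht
    rw [real_inner_smul_left, real_inner_smul_left, he₁ v H h hw ht]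
    ring

/-- The span of all Steklov eigenfunctions with eigenvalue at most `s`; its dimension is the number
of eigenvalues in `[0, s]`, counted with multiplicity. -/
def eigenspaceUpTo {d : ℕ} (Ω : Set (Space d)) (s : ℝ≥0) : Submodule ℝ (L2Bulk Ω) :=
  ⨆ (σ : ℝ≥0) (_ : σ ≤ s), eigenspace Ω σ

/-- The Steklov eigenvalue `σ_k(Ω)`, in the enumeration `0 = σ_0 ≤ σ_1 ≤ σ_2 ≤ …` of the eigenvalues
with multiplicity: the least `s` such that at least `k + 1` eigenvalues, counted with multiplicity,
are at most `s` (and `∞` if there are not so many eigenvalues). -/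
def eigenvalue {d : ℕ} (Ω : Set (Space d)) (k : ℕ) : ℝ≥0∞ :=
  ⨅ (s : ℝ≥0) (_ : ((k + 1 : ℕ) : Cardinal) ≤ Module.rank ℝ (eigenspaceUpTo Ω s)), (s : ℝ≥0∞)

/-- `ω_n`, the volume of the unit ball of `ℝⁿ`. -/
def ballVolume (n : ℕ) : ℝ := volume.real (Metric.ball (0 : Space n) 1)

/-- `C_d = ω_{d-2} / ((d-1) ω_{d-1}^{(d-2)/(d-1)})`. -/
def dimConst (d : ℕ) : ℝ :=
  ballVolume (d - 2) / (((d : ℝ) - 1) * ballVolume (d - 1) ^ (((d : ℝ) - 2) / ((d : ℝ) - 1)))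

/-- `C(d,k) = [2(k+1)]^{d+1} / (4 C_d)`. -/
def estimateConst (d k : ℕ) : ℝ := (2 * ((k : ℝ) + 1)) ^ (d + 1) / (4 * dimConst d)

end Steklov

end

/-! Write d = m + 2. By the variational principle, `eigenvalue Ω k ≤ s` as soon as k + 1 functions,
pairwise orthogonal both for ∫_Ω ∇u·∇v and for ∫_∂Ω uv and with nonzero traces, have Rayleigh
quotients at most s (`eigenvalue_le_of_orthogonal_family`). Take a diameter of Ω, of length D, as
the first coordinate axis, and let the test functions be tents of slope one and half-width ℓ in that
coordinate alone, centred at 0, 2ℓ, ..., 2ℓk. Their supports are disjoint, so orthogonality is free,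
and the only constraint is 2ℓk ≤ D. The Rayleigh quotient is the volume of a strip divided by the
boundary integral of the squared tent.

That boundary integral is bounded below section by section. Let V(t) be the volume of the section at
height t. Along each of the m + 1 other coordinate directions, ∂Ω covers the projection of Ω at
least twice (`two_mul_lintegral_dropCoord_image_le`). Summing over the directions and applying
Loomis–Whitney with AM–GM to each section gives ∫_∂Ω f ≥ 2 ∫ f W for functions f ≥ 0 of the height,
where W = V^{m/(m+1)} (`two_mul_lintegral_slice_le_frontier`). Conversely, sections of a convex set
shrink at most conically. This yields V ≤ (m+2)|Ω|/D (`sliceVolume_mul_le`), hence V ≤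
2(|Ω|/D)^{1/(m+1)} W, and a one-dimensional inequality bounding ∫ W over the strip by the integral
of W against the squared tent (`integral_le_of_pow_mul_le`). Together these give the Rayleigh bound
(|Ω|/D)^{1/(d-1)} d(d+1)/(2ℓ²) of `volume_strip_le`. A choice of ℓ of order D/(2k+1) produces the
powers of |Ω| and D; the constant C_d enters only through C_d ≤ 1 (`dimConst_le_one`) and the
dependence on k through `mul_sq_le_two_mul_succ_pow`.

The variational principle itself needs proof, since `eigenvalue` counts dimensions of spans of weak
eigenfunctions. On the closure of the smooth triples the form ∫∇u·∇v + ∫_∂Ω uv defines an equivalent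
norm (`exists_friedrichs_bound`), and the trace map B is compact for it: the trace inequality has an
arbitrarily small constant in front of the gradient, and finitely many cell averages control the
remaining L² term. So T = B*B is a compact symmetric operator, its eigenvalues μ correspond to σ =
1/μ - 1, and the spectral theorem gives the count (`le_rank_of_generalized_rayleigh_le`). -/

noncomputable section

/-! ### Spectral theory: counting eigenvalues of a pair of quadratic forms. -/

section Spectral

variable {H F : Type*} [NormedAddCommGroup H] [InnerProductSpace ℝ H]
  [NormedAddCommGroup F] [InnerProductSpace ℝ F] [CompleteSpace F]

/-- `B` is a norm limit of finite-rank operators `B ∘ P`, with P the projection onto the span of W: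
the error is `B` on the orthogonal complement, where it is small. -/
theorem isCompactOperator_of_small_on_finite_codim (B : H →L[ℝ] F)
    (hB : ∀ ε : ℝ, 0 < ε → ∃ W : Set H, W.Finite ∧
      ∀ x, (∀ y ∈ W, inner ℝ y x = 0) → ‖B x‖ ≤ ε * ‖x‖) : IsCompactOperator B := by
  have key : ∀ n : ℕ, ∃ T : H →L[ℝ] F, IsCompactOperator T ∧ ‖B - T‖ ≤ 1 / ((n : ℝ) + 1) := by
    intro n
    obtain ⟨W, hW, hw⟩ := hB (1 / ((n : ℝ) + 1)) (by positivity)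
    set K : Submodule ℝ H := Submodule.span ℝ W
    have : FiniteDimensional ℝ K := FiniteDimensional.span_of_finite ℝ hW
    refine ⟨B ∘L K.starProjection, ?_, ?_⟩
    · have : ProperSpace K := FiniteDimensional.proper ℝ K
      have h1 : IsCompactOperator K.orthogonalProjectionOnto :=
        isCompactOperator_of_locallyCompactSpace_dom K.orthogonalProjectionOnto
      have h2 : IsCompactOperator K.starProjection := h1.clm_comp K.subtypeL
      exact h2.clm_comp B
    · refine ContinuousLinearMap.opNorm_le_bound _ (by positivity) fun x => ?_
      have hx : x - K.starProjection x ∈ Kᗮ := Submodule.sub_starProjection_mem_orthogonal x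
      have h1 : ‖B (x - K.starProjection x)‖ ≤ 1 / ((n : ℝ) + 1) * ‖x - K.starProjection x‖ := by
        apply hw
        intro y hy
        exact hx y (Submodule.subset_span hy)
      have h2 : ‖x - K.starProjection x‖ ≤ ‖x‖ := by
        have := Kᗮ.norm_starProjection_apply_le x
        rwa [Submodule.starProjection_orthogonal_val] at this
      calc ‖(B - B ∘L K.starProjection) x‖ = ‖B (x - K.starProjection x)‖ := by simp
        _ ≤ _ := h1
        _ ≤ _ := by gcongr
  choose T hT hTB using key
  refine isCompactOperator_of_tendsto (l := Filter.atTop) (F := T) ?_ (Filter.Eventually.of_forall hT)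
  rw [tendsto_iff_norm_sub_tendsto_zero]
  refine squeeze_zero (fun _ => norm_nonneg _) (fun n => ?_) tendsto_one_div_add_atTop_nhds_zero_nat
  rw [norm_sub_rev]
  exact hTB n

/-- Eigenspaces of a symmetric operator are orthogonal, so both sides split over the eigencomponents
of x. -/
theorem inner_apply_le_of_mem_iSup_eigenspace {T : H →ₗ[ℝ] H} (hT : T.IsSymmetric) {c : ℝ}
    {x : H} (hx : x ∈ ⨆ μ : {μ : ℝ // μ < c}, Module.End.eigenspace T μ) :
    inner ℝ (T x) x ≤ c * ‖x‖ ^ 2 := by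
  classical
  obtain ⟨f, hf, rfl⟩ := (Submodule.mem_iSup_iff_exists_finsupp _ _).1 hx
  have horth : ∀ i j : {μ : ℝ // μ < c}, i ≠ j → inner ℝ (f i) (f j) = 0 := by
    intro i j hij
    have := hT.orthogonalFamily_eigenspaces (i := (i : ℝ)) (j := j) (by simpa [Subtype.ext_iff] using hij)
    exact this ⟨f i, hf i⟩ ⟨f j, hf j⟩
  have hTf : ∀ i, T (f i) = (i : ℝ) • f i := fun i => Module.End.mem_eigenspace_iff.1 (hf i)
  simp only [Finsupp.sum]
  rw [map_sum, sum_inner, ← real_inner_self_eq_norm_sq, sum_inner, Finset.mul_sum]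
  refine Finset.sum_le_sum fun i hi => ?_
  rw [inner_sum, inner_sum, Finset.sum_eq_single i, Finset.sum_eq_single i, hTf,
    real_inner_smul_left]
  · exact mul_le_mul_of_nonneg_right i.2.le real_inner_self_nonneg
  · intro j _ hj; exact horth _ _ hj.symm
  · intro h; exact absurd hi h
  · intro j _ hj; rw [hTf, real_inner_smul_left, horth _ _ hj.symm, mul_zero]
  · intro h; exact absurd hi h

/-- If too few eigenvectors lay above c', a dimension count would give a nonzero x in the span of v
orthogonal to all of them. By the spectral theorem x is then a limit of combinations of eigenvectors
below c', so its Rayleigh quotient is at most c', against the lower bound c. The gap c' < c is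
needed because strict inequality is lost in the limit. -/
theorem le_rank_iSup_eigenspace [CompleteSpace H] {T : H →L[ℝ] H} (hT : IsCompactOperator T) (hs : T.IsSymmetric)
    {c c' : ℝ} (hc : c' < c) {m : ℕ} (v : Fin m → H) (hv : LinearIndependent ℝ v)
    (hray : ∀ x ∈ Submodule.span ℝ (Set.range v), c * ‖x‖ ^ 2 ≤ inner ℝ (T x) x) :
    (m : Cardinal) ≤ Module.rank ℝ
      (⨆ μ : {μ : ℝ // c' ≤ μ}, Module.End.eigenspace (T : H →ₗ[ℝ] H) μ : Submodule ℝ H) := by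
  set K : Submodule ℝ H := ⨆ μ : {μ : ℝ // c' ≤ μ}, Module.End.eigenspace (T : H →ₗ[ℝ] H) μ
  set L : Submodule ℝ H := ⨆ μ : {μ : ℝ // μ < c'}, Module.End.eigenspace (T : H →ₗ[ℝ] H) μ
  by_contra! hlt
  have hfin : Module.Finite ℝ K := by
    rw [← Module.rank_lt_aleph0_iff]
    exact hlt.trans (Cardinal.natCast_lt_aleph0)
  have hfr : Module.finrank ℝ K < m := by
    rw [← Module.finrank_eq_rank] at hlt
    exact_mod_cast hlt
  set E : Submodule ℝ H := Submodule.span ℝ (Set.range v)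
  have hE : Module.finrank ℝ E = m := by
    rw [finrank_span_eq_card hv, Fintype.card_fin]
  have hEfin : Module.Finite ℝ E := FiniteDimensional.span_of_finite ℝ (Set.finite_range v)
  -- A nonzero vector of `E` orthogonal to `K`
  obtain ⟨x, hxE, hx0, hxK⟩ : ∃ x ∈ E, x ≠ 0 ∧ x ∈ Kᗮ := by
    let P : E →ₗ[ℝ] K := K.orthogonalProjectionOnto.toLinearMap ∘ₗ E.subtype
    have : LinearMap.ker P ≠ ⊥ := LinearMap.ker_ne_bot_of_finrank_lt (by omega)
    obtain ⟨y, hy, hy0⟩ := Submodule.exists_mem_ne_zero_of_ne_bot this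
    refine ⟨y, y.2, by simpa using hy0, ?_⟩
    exact (Submodule.orthogonalProjectionOnto_eq_zero_iff).1 (by simpa [P] using hy)
  have hxcl : x ∈ L.topologicalClosure := by
    set M := L.topologicalClosure
    have hz : x - M.starProjection x ∈ Mᗮ := Submodule.sub_starProjection_mem_orthogonal x
    have hKL : L ≤ Kᗮ := by
      refine iSup_le fun μ => ?_
      rw [Submodule.le_orthogonal_iff_le_orthogonal]
      refine iSup_le fun ν => ?_
      intro a ha b hb
      have hne : (μ : ℝ) ≠ ν := (μ.2.trans_le ν.2).ne
      exact hs.orthogonalFamily_eigenspaces hne ⟨b, hb⟩ ⟨a, ha⟩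
    have hM : M ≤ Kᗮ := Submodule.topologicalClosure_minimal _ hKL (Submodule.isClosed_orthogonal K)
    have hzK : x - M.starProjection x ∈ Kᗮ :=
      Submodule.sub_mem _ hxK (hM (Submodule.starProjection_apply_mem _ _))
    -- The component of x orthogonal to M is orthogonal to every eigenspace: below c' by
    -- construction, above c' because x and M are both orthogonal to K. The spectral theorem makes
    -- it vanish.
    have hzall : x - M.starProjection x ∈ (⨆ μ, Module.End.eigenspace (T : H →ₗ[ℝ] H) μ)ᗮ := by
      rw [← Submodule.iInf_orthogonal, Submodule.mem_iInf]
      intro μ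
      rcases lt_or_ge μ c' with h | h
      · exact Submodule.orthogonal_le ((le_iSup (fun μ : {μ : ℝ // μ < c'} =>
          Module.End.eigenspace (T : H →ₗ[ℝ] H) μ) ⟨μ, h⟩).trans L.le_topologicalClosure) hz
      · exact Submodule.orthogonal_le (le_iSup (fun μ : {μ : ℝ // c' ≤ μ} =>
          Module.End.eigenspace (T : H →ₗ[ℝ] H) μ) ⟨μ, h⟩) hzK
    rw [ContinuousLinearMap.orthogonalComplement_iSup_eigenspaces_eq_bot hT hs,
      Submodule.mem_bot, sub_eq_zero] at hzall
    rw [hzall]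
    exact Submodule.starProjection_apply_mem _ _
  have hle : inner ℝ (T x) x ≤ c' * ‖x‖ ^ 2 := by
    have hclosed : IsClosed {y : H | inner ℝ (T y) y ≤ c' * ‖y‖ ^ 2} :=
      isClosed_le (by fun_prop) (by fun_prop)
    exact closure_minimal (s := (L : Set H)) (fun y hy =>
      inner_apply_le_of_mem_iSup_eigenspace (T := (T : H →ₗ[ℝ] H)) hs hy) hclosed hxcl
  have hpos : 0 < ‖x‖ ^ 2 := by positivity
  nlinarith [hray x hxE]

/-- Variational lower bound for the number of eigenvalues, with multiplicity, of the problem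
`⟪G x, G y⟫ = σ ⟪B x, B y⟫` in a Hilbert space with inner product `⟪G x, G y⟫ + ⟪B x, B y⟫`. -/
theorem le_rank_of_rayleigh_le_of_inner_eq {F₀ F₁ : Type*} [CompleteSpace H]
    [NormedAddCommGroup F₀] [InnerProductSpace ℝ F₀]
    [NormedAddCommGroup F₁] [InnerProductSpace ℝ F₁]
    (U : H →L[ℝ] F₀) (G : H →L[ℝ] F₁) (B : H →L[ℝ] F) (hU : Function.Injective U)
    (hinner : ∀ x y, inner ℝ x y = inner ℝ (G x) (G y) + inner ℝ (B x) (B y))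
    (hB : IsCompactOperator B)
    {m : ℕ} {s s' : ℝ≥0} (hss : s < s') (p : Fin m → H)
    (hpG : ∀ i j, i ≠ j → inner ℝ (G (p i)) (G (p j)) = 0)
    (hpB : ∀ i j, i ≠ j → inner ℝ (B (p i)) (B (p j)) = 0)
    (hps : ∀ j, ‖G (p j)‖ ^ 2 ≤ s * ‖B (p j)‖ ^ 2) (hp0 : ∀ j, B (p j) ≠ 0)
    (S : Submodule ℝ F₀)
    (hS : ∀ σ : ℝ≥0, σ ≤ s' → ∀ x,
      (∀ y, inner ℝ (G x) (G y) = (σ : ℝ) * inner ℝ (B x) (B y)) → U x ∈ S) :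
    (m : Cardinal) ≤ Module.rank ℝ S := by
  -- T represents the form ⟪Bx, By⟫ in the inner product of H, so Tx = μx with μ > 0 says exactly
  -- ⟪Gx, Gy⟫ = (1/μ - 1)⟪Bx, By⟫ for all y.
  let T : H →L[ℝ] H := ContinuousLinearMap.adjoint B ∘L B
  have hTi : ∀ x y, inner ℝ (T x) y = inner ℝ (B x) (B y) := fun x y => by
    show inner ℝ (ContinuousLinearMap.adjoint B (B x)) y = _
    rw [ContinuousLinearMap.adjoint_inner_left]
  have hTcomp : IsCompactOperator T := hB.clm_comp (ContinuousLinearMap.adjoint B)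
  have hTsymm : T.IsSymmetric := by
    intro x y
    show inner ℝ (T x) y = inner ℝ x (T y)
    rw [hTi, real_inner_comm, ← hTi, real_inner_comm]
  have hvi : ∀ i j, inner ℝ (p i) (p j)
      = inner ℝ (G (p i)) (G (p j)) + inner ℝ (B (p i)) (B (p j)) := fun i j => by
    rw [hinner]
  have hvorth : ∀ i j, i ≠ j → inner ℝ (p i) (p j) = 0 := fun i j hij => by
    rw [hvi, hpG i j hij, hpB i j hij, add_zero]
  have hvne : ∀ j, p j ≠ 0 := fun j h0 => hp0 j (by rw [h0, map_zero])
  have hvlin : LinearIndependent ℝ p :=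
    linearIndependent_of_ne_zero_of_inner_eq_zero hvne fun i j hij => hvorth i j hij
  have hray : ∀ x ∈ Submodule.span ℝ (Set.range p),
      (1 / (1 + (s : ℝ))) * ‖x‖ ^ 2 ≤ inner ℝ (T x) x := by
    intro x hx
    obtain ⟨c, rfl⟩ := (Submodule.mem_span_range_iff_exists_fun ℝ).1 hx
    have e1 : ‖∑ i, c i • p i‖ ^ 2 = ∑ i, c i ^ 2 * (‖G (p i)‖ ^ 2 + ‖B (p i)‖ ^ 2) := by
      rw [← real_inner_self_eq_norm_sq, sum_inner]
      refine Finset.sum_congr rfl fun i _ => ?_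
      rw [inner_sum, Finset.sum_eq_single i]
      · rw [real_inner_smul_left, real_inner_smul_right, hvi, real_inner_self_eq_norm_sq,
          real_inner_self_eq_norm_sq]
        ring
      · intro j _ hj
        rw [real_inner_smul_left, real_inner_smul_right, hvorth i j hj.symm]; simp
      · simp
    have e2 : inner ℝ (T (∑ i, c i • p i)) (∑ i, c i • p i) = ∑ i, c i ^ 2 * ‖B (p i)‖ ^ 2 := by
      rw [hTi, map_sum, sum_inner]
      refine Finset.sum_congr rfl fun i _ => ?_
      rw [inner_sum, Finset.sum_eq_single i]
      · rw [map_smul, real_inner_smul_left, real_inner_smul_right,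
          real_inner_self_eq_norm_sq]
        ring
      · intro j _ hj
        rw [map_smul, map_smul, real_inner_smul_left, real_inner_smul_right,
          hpB i j hj.symm]
        simp
      · simp
    rw [e1, e2, Finset.mul_sum]
    refine Finset.sum_le_sum fun i _ => ?_
    have h1 : ‖G (p i)‖ ^ 2 + ‖B (p i)‖ ^ 2 ≤ (1 + s) * ‖B (p i)‖ ^ 2 := by
      linarith [hps i]
    calc 1 / (1 + (s : ℝ)) * (c i ^ 2 * (‖G (p i)‖ ^ 2 + ‖B (p i)‖ ^ 2))
        ≤ 1 / (1 + (s : ℝ)) * (c i ^ 2 * ((1 + s) * ‖B (p i)‖ ^ 2)) := by gcongr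
      _ = _ := by field_simp
  -- Under σ = 1/μ - 1 the condition σ ≤ s' becomes μ ≥ 1/(1 + s').
  have hlt : 1 / (1 + (s' : ℝ)) < 1 / (1 + (s : ℝ)) := by
    have : (s : ℝ) < s' := hss
    exact one_div_lt_one_div_of_lt (by positivity) (by linarith)
  set c' : ℝ := 1 / (1 + (s' : ℝ))
  have hc'0 : 0 < c' := by positivity
  have hrank := le_rank_iSup_eigenspace hTcomp hTsymm hlt p hvlin hray
  set F : Submodule ℝ H :=
    ⨆ μ : {μ : ℝ // c' ≤ μ}, Module.End.eigenspace (T : H →ₗ[ℝ] H) μ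
  have hFS : F ≤ S.comap U.toLinearMap := by
    refine iSup_le fun μ x hx => ?_
    have hTx : T x = (μ : ℝ) • x := Module.End.mem_eigenspace_iff.1 hx
    rcases eq_or_ne x 0 with rfl | hx0
    · exact Submodule.zero_mem _
    have hμ0 : 0 < (μ : ℝ) := hc'0.trans_le μ.2
    have hμ1 : (μ : ℝ) ≤ 1 := by
      have h1 := hTi x x
      have h2 := hinner x x
      rw [hTx, real_inner_smul_left] at h1
      have h3 : 0 ≤ inner ℝ (G x) (G x) := real_inner_self_nonneg
      have h4 : 0 < inner ℝ x x := real_inner_self_pos.2 hx0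
      by_contra! h
      nlinarith
    have hσ0 : 0 ≤ 1 / (μ : ℝ) - 1 := by
      rw [sub_nonneg, le_div_iff₀ hμ0]; linarith
    have hσs : (1 / (μ : ℝ) - 1).toNNReal ≤ s' := by
      rw [← NNReal.coe_le_coe, Real.coe_toNNReal _ hσ0]
      have : 1 / (μ : ℝ) ≤ 1 / c' := one_div_le_one_div_of_le hc'0 μ.2
      simp only [c', one_div_one_div] at this
      linarith
    refine hS _ hσs x fun y => ?_
    have h1 := hTi x y
    rw [hTx, real_inner_smul_left, hinner] at h1
    rw [Real.coe_toNNReal _ hσ0]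
    field_simp
    linarith
  have hle := LinearMap.lift_rank_le_of_injective
    ((U.toLinearMap ∘ₗ F.subtype).codRestrict S fun x => hFS x.2)
    (by
      rw [← LinearMap.ker_eq_bot, LinearMap.ker_codRestrict, LinearMap.ker_eq_bot]
      exact hU.comp Subtype.val_injective)
  have h1 := Cardinal.lift_le.2 hrank
  rw [Cardinal.lift_natCast] at h1
  exact Cardinal.nat_le_lift_iff.1 (h1.trans hle)

/-- Variational lower bound for the number of eigenvalues, with multiplicity, of the problem
`⟪G x, G y⟫ = σ ⟪B x, B y⟫`, where the form `⟪B x, B y⟫` is compact relative to `⟪G x, G y⟫`. -/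
theorem le_rank_of_generalized_rayleigh_le {X F₀ F₁ F₂ : Type*}
    [NormedAddCommGroup X] [NormedSpace ℝ X] [CompleteSpace X]
    [NormedAddCommGroup F₀] [InnerProductSpace ℝ F₀] [CompleteSpace F₀]
    [NormedAddCommGroup F₁] [InnerProductSpace ℝ F₁] [CompleteSpace F₁]
    [NormedAddCommGroup F₂] [InnerProductSpace ℝ F₂] [CompleteSpace F₂]
    (U : X →L[ℝ] F₀) (G : X →L[ℝ] F₁) (B : X →L[ℝ] F₂) (hU : Function.Injective U)
    {C : ℝ} (hC : 0 ≤ C) (hcoer : ∀ x, ‖x‖ ≤ C * (‖G x‖ + ‖B x‖))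
    (hsmall : ∀ ε : ℝ, 0 < ε → ∃ W : Set F₀, W.Finite ∧
      ∀ x, (∀ w ∈ W, inner ℝ w (U x) = 0) → ‖B x‖ ≤ ε * ‖G x‖)
    {m : ℕ} {s s' : ℝ≥0} (hss : s < s') (p : Fin m → X)
    (hpG : ∀ i j, i ≠ j → inner ℝ (G (p i)) (G (p j)) = 0)
    (hpB : ∀ i j, i ≠ j → inner ℝ (B (p i)) (B (p j)) = 0)
    (hps : ∀ j, ‖G (p j)‖ ^ 2 ≤ s * ‖B (p j)‖ ^ 2) (hp0 : ∀ j, B (p j) ≠ 0)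
    (S : Submodule ℝ F₀)
    (hS : ∀ σ : ℝ≥0, σ ≤ s' → ∀ x,
      (∀ y, inner ℝ (G x) (G y) = (σ : ℝ) * inner ℝ (B x) (B y)) → U x ∈ S) :
    (m : Cardinal) ≤ Module.rank ℝ S := by
  -- The norm of X need not come from an inner product. Coercivity makes E = (G, B) an isomorphism
  -- onto a closed subspace of a Hilbert space, whose inner product is the sum of the two forms.
  let E : X →L[ℝ] WithLp 2 (F₁ × F₂) :=
    ((WithLp.prodContinuousLinearEquiv 2 ℝ F₁ F₂).symm :
      (F₁ × F₂) →L[ℝ] WithLp 2 (F₁ × F₂)) ∘L (G.prod B)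
  have hE1 : ∀ x, (E x).fst = G x := fun x => rfl
  have hE2 : ∀ x, (E x).snd = B x := fun x => rfl
  have hEn : ∀ x, ‖E x‖ ^ 2 = ‖G x‖ ^ 2 + ‖B x‖ ^ 2 := fun x => by
    rw [WithLp.prod_norm_sq_eq_of_L2, hE1, hE2]
  have hGE : ∀ x, ‖G x‖ ≤ ‖E x‖ := fun x =>
    le_of_sq_le_sq (by rw [hEn]; linarith [sq_nonneg ‖B x‖]) (norm_nonneg _)
  have hBE : ∀ x, ‖B x‖ ≤ ‖E x‖ := fun x =>
    le_of_sq_le_sq (by rw [hEn]; linarith [sq_nonneg ‖G x‖]) (norm_nonneg _)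
  have hanti : AntilipschitzWith (2 * C).toNNReal E := by
    refine E.antilipschitz_of_bound fun x => ?_
    rw [Real.coe_toNNReal _ (by positivity)]
    calc ‖x‖ ≤ C * (‖G x‖ + ‖B x‖) := hcoer x
      _ ≤ C * (‖E x‖ + ‖E x‖) := by gcongr; exacts [hGE x, hBE x]
      _ = _ := by ring
  have hclosed : IsClosed (Set.range E) := by
    exact hanti.isClosed_range E.uniformContinuous
  let e := E.equivRange hanti.injective hclosed
  have hHc : CompleteSpace E.range := hclosed.completeSpace_coe
  have he2 : ∀ y : E.range, E (e.symm y) = y := fun y => by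
    have h : ((e (e.symm y) : E.range) : WithLp 2 (F₁ × F₂)) = y := by rw [e.apply_symm_apply]
    have h' : ((e (e.symm y) : E.range) : WithLp 2 (F₁ × F₂)) = E (e.symm y) := rfl
    rw [← h', h]
  let V : E.range →L[ℝ] F₀ := U ∘L (e.symm : E.range →L[ℝ] X)
  let A : E.range →L[ℝ] F₂ := B ∘L (e.symm : E.range →L[ℝ] X)
  have hA : ∀ y, A y = B (e.symm y) := fun y => rfl
  have hinner : ∀ x y : E.range, inner ℝ x y
      = inner ℝ (G (e.symm x)) (G (e.symm y)) + inner ℝ (A x) (A y) := by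
    intro x y
    rw [Submodule.coe_inner, ← he2 x, ← he2 y, WithLp.prod_inner_apply]
    rfl
  have hVinj : Function.Injective V := hU.comp e.symm.injective
  have hAcomp : IsCompactOperator A := by
    refine isCompactOperator_of_small_on_finite_codim A fun ε hε => ?_
    obtain ⟨W, hW, hWX⟩ := hsmall ε hε
    -- The finitely many conditions live in F₀; the adjoint of V turns them into orthogonality
    -- conditions in the range of E.
    refine ⟨(fun w => ContinuousLinearMap.adjoint V w) '' W, hW.image _, fun y hy => ?_⟩
    have h1 := hWX (e.symm y) (fun w hw => by
      have := hy _ ⟨w, hw, rfl⟩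
      rwa [ContinuousLinearMap.adjoint_inner_left] at this)
    refine h1.trans ?_
    gcongr
    have h2 := hGE (e.symm y)
    rwa [he2] at h2
  refine le_rank_of_rayleigh_le_of_inner_eq V (G ∘L (e.symm : E.range →L[ℝ] X)) A hVinj hinner
    hAcomp hss (fun j => e (p j)) ?_ ?_ ?_ ?_ S ?_
  · intro i j hij
    simpa using hpG i j hij
  · intro i j hij
    simpa [hA] using hpB i j hij
  · intro j
    simpa [hA] using hps j
  · intro j
    simpa [hA] using hp0 j
  · intro σ hσ x hx
    refine hS σ hσ (e.symm x) fun y => ?_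
    simpa [hA] using hx (e y)

end Spectral

namespace Steklov

/-! ### Hausdorff measure under Lipschitz maps. -/

theorem euclideanHausdorffMeasure_image_le {X Y : Type*} [EMetricSpace X] [MeasurableSpace X]
    [BorelSpace X] [EMetricSpace Y] [MeasurableSpace Y] [BorelSpace Y] {n : ℕ} {K : ℝ≥0}
    {f : X → Y} {s : Set X} (hf : LipschitzOnWith K f s) :
    (Measure.euclideanHausdorffMeasure n : Measure Y) (f '' s)
      ≤ (K : ℝ≥0∞) ^ n * (Measure.euclideanHausdorffMeasure n : Measure X) s := by
  have h := hf.hausdorffMeasure_image_le (d := (n : ℝ)) (by positivity)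
  rw [Measure.euclideanHausdorffMeasure_def, Measure.euclideanHausdorffMeasure_def,
    Measure.smul_apply, Measure.smul_apply, ENNReal.smul_def, ENNReal.smul_def, smul_eq_mul,
    smul_eq_mul, mul_left_comm]
  gcongr
  simpa using h

theorem volume_image_le_euclideanHausdorffMeasure {X : Type*} [EMetricSpace X] [MeasurableSpace X]
    [BorelSpace X] {n : ℕ} {P : X → Space n} (hP : LipschitzWith 1 P) (s : Set X) :
    volume (P '' s) ≤ (Measure.euclideanHausdorffMeasure n : Measure X) s := by
  rw [← EuclideanSpace.euclideanHausdorffMeasure_eq_volume]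
  simpa using euclideanHausdorffMeasure_image_le (n := n) (hP.lipschitzOnWith (s := s))

/-- On A the map P is injective with a K-Lipschitz inverse, which multiplies n-dimensional measure
by at most `K ^ n`. -/
theorem map_restrict_euclideanHausdorffMeasure_le {X : Type*} [MetricSpace X] [MeasurableSpace X]
    [BorelSpace X] {n : ℕ} {P : X → Space n} (hP : Measurable P) {A : Set X} {K : ℝ≥0}
    (hA : ∀ x ∈ A, ∀ y ∈ A, dist x y ≤ K * dist (P x) (P y)) :
    (((Measure.euclideanHausdorffMeasure n : Measure X).restrict A).map P)
      ≤ (K : ℝ≥0∞) ^ n • (volume : Measure (Space n)) := by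
  refine Measure.le_iff.2 fun T hT => ?_
  rw [Measure.map_apply hP hT, Measure.restrict_apply (hP hT), Measure.smul_apply, smul_eq_mul]
  rcases A.eq_empty_or_nonempty with rfl | ⟨a, ha⟩
  · simp
  have : Nonempty X := ⟨a⟩
  set S := P ⁻¹' T ∩ A
  have hinj : Set.InjOn P A := by
    intro x hx y hy hxy
    have := hA x hx y hy
    rw [hxy, dist_self, mul_zero] at this
    exact dist_le_zero.1 this
  set g := Function.invFunOn P A
  have hg : ∀ x ∈ A, g (P x) = x := fun x hx => hinj.leftInvOn_invFunOn hx
  have hlip : LipschitzOnWith K g (P '' S) := by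
    refine LipschitzOnWith.of_dist_le_mul ?_
    rintro _ ⟨x, hx, rfl⟩ _ ⟨y, hy, rfl⟩
    rw [hg x hx.2, hg y hy.2]
    exact hA x hx.2 y hy.2
  have hS : g '' (P '' S) = S := by
    rw [Set.image_image]
    conv_rhs => rw [← Set.image_id S]
    exact Set.image_congr fun x hx => hg x hx.2
  calc (Measure.euclideanHausdorffMeasure n : Measure X) S
      = (Measure.euclideanHausdorffMeasure n : Measure X) (g '' (P '' S)) := by rw [hS]
    _ ≤ _ := euclideanHausdorffMeasure_image_le hlip
    _ = (K : ℝ≥0∞) ^ n * volume (P '' S) := by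
      rw [EuclideanSpace.euclideanHausdorffMeasure_eq_volume]
    _ ≤ _ := by
      gcongr
      rintro _ ⟨x, hx, rfl⟩
      exact hx.1

/-! ### Splitting off one coordinate: isometry and Fubini. -/

/-- Inserting the `i`-th coordinate. -/
def insertCoord {n : ℕ} (i : Fin (n + 1)) (h : ℝ) (z : Space n) : Space (n + 1) :=
  WithLp.toLp 2 (i.insertNth h z)

/-- Dropping the `i`-th coordinate. -/
def dropCoord {n : ℕ} (i : Fin (n + 1)) (x : Space (n + 1)) : Space n :=
  WithLp.toLp 2 (i.removeNth x)

@[simp] theorem dropCoord_apply {n : ℕ} (i : Fin (n + 1)) (x : Space (n + 1)) (j : Fin n) :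
    dropCoord i x j = x (i.succAbove j) := rfl

@[simp] theorem dropCoord_insertCoord {n : ℕ} (i : Fin (n + 1)) (h : ℝ) (z : Space n) :
    dropCoord i (insertCoord i h z) = z := by
  ext j; simp [dropCoord, insertCoord]

@[simp] theorem insertCoord_apply_same {n : ℕ} (i : Fin (n + 1)) (h : ℝ) (z : Space n) :
    insertCoord i h z i = h := by
  simp [insertCoord]

theorem insertCoord_dropCoord {n : ℕ} (i : Fin (n + 1)) (x : Space (n + 1)) :
    insertCoord i (x i) (dropCoord i x) = x := by
  ext j; simp [dropCoord, insertCoord]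

theorem dropCoord_sub {n : ℕ} (i : Fin (n + 1)) (x y : Space (n + 1)) :
    dropCoord i (x - y) = dropCoord i x - dropCoord i y := by
  ext j; simp [dropCoord, Fin.removeNth]

theorem norm_sq_eq_dropCoord {n : ℕ} (i : Fin (n + 1)) (x : Space (n + 1)) :
    ‖x‖ ^ 2 = x i ^ 2 + ‖dropCoord i x‖ ^ 2 := by
  rw [EuclideanSpace.norm_sq_eq, EuclideanSpace.norm_sq_eq, Fin.sum_univ_succAbove _ i]
  simp [dropCoord, Fin.removeNth]

theorem lipschitzWith_dropCoord {n : ℕ} (i : Fin (n + 1)) :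
    LipschitzWith 1 (dropCoord (n := n) i) := by
  refine LipschitzWith.of_dist_le_mul fun x y => ?_
  rw [dist_eq_norm, dist_eq_norm, ← dropCoord_sub, NNReal.coe_one, one_mul]
  refine le_of_sq_le_sq ?_ (norm_nonneg _)
  rw [norm_sq_eq_dropCoord i (x - y)]
  nlinarith [sq_nonneg ((x - y) i)]

@[fun_prop]
theorem continuous_dropCoord {n : ℕ} (i : Fin (n + 1)) : Continuous (dropCoord (n := n) i) :=
  (lipschitzWith_dropCoord i).continuous

@[fun_prop]
theorem continuous_insertCoord {n : ℕ} (i : Fin (n + 1)) :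
    Continuous (fun p : ℝ × Space n => insertCoord i p.1 p.2) := by
  unfold insertCoord
  refine (PiLp.continuous_toLp 2 _).comp ?_
  refine Continuous.finInsertNth i ?_ ?_ <;> fun_prop

theorem measurePreserving_insertCoord {n : ℕ} (i : Fin (n + 1)) :
    MeasurePreserving (fun p : ℝ × Space n => insertCoord i p.1 p.2)
      ((volume : Measure ℝ).prod (volume : Measure (Space n))) volume := by
  have h1 := volume_preserving_piFinSuccAbove (fun _ : Fin (n + 1) => ℝ) i
  have h2 := (PiLp.volume_preserving_ofLp (Fin n))
  have h3 := (PiLp.volume_preserving_toLp (Fin (n + 1)))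
  have h4 : MeasurePreserving (Prod.map (id : ℝ → ℝ) (WithLp.ofLp : Space n → (Fin n → ℝ)))
      ((volume : Measure ℝ).prod (volume : Measure (Space n))) (volume.prod volume) :=
    (MeasurePreserving.id volume).prod h2
  exact h3.comp ((h1.symm).comp h4)

theorem lintegral_eq_lintegral_insertCoord {n : ℕ} (i : Fin (n + 1)) {f : Space (n + 1) → ℝ≥0∞}
    (hf : Measurable f) :
    ∫⁻ x, f x = ∫⁻ z : Space n, ∫⁻ h : ℝ, f (insertCoord i h z) := by
  rw [← (measurePreserving_insertCoord i).lintegral_comp hf]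
  exact lintegral_prod_symm _ (hf.comp (continuous_insertCoord i).measurable).aemeasurable

theorem lintegral_eq_lintegral_insertCoord' {n : ℕ} (i : Fin (n + 1)) {f : Space (n + 1) → ℝ≥0∞}
    (hf : Measurable f) :
    ∫⁻ x, f x = ∫⁻ h : ℝ, ∫⁻ z : Space n, f (insertCoord i h z) := by
  rw [← (measurePreserving_insertCoord i).lintegral_comp hf]
  exact lintegral_prod _ (hf.comp (continuous_insertCoord i).measurable).aemeasurable

theorem exists_linearIsometryEquiv_map_eq_single {n : ℕ} {w : Space (n + 1)} (hw : w ≠ 0) :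
    ∃ R : Space (n + 1) ≃ₗᵢ[ℝ] Space (n + 1), R w = EuclideanSpace.single 0 ‖w‖ := by
  have hcard : Module.finrank ℝ (Space (n + 1)) = Fintype.card (Fin (n + 1)) := by simp
  let v : Fin (n + 1) → Space (n + 1) := fun _ => (‖w‖⁻¹) • w
  have hv : Orthonormal ℝ (({0} : Set (Fin (n + 1))).domRestrict v) := by
    refine ⟨fun i => ?_, fun i j hij => absurd (Subsingleton.elim i j) hij⟩
    have : ‖w‖ ≠ 0 := norm_ne_zero_iff.2 hw
    show ‖(‖w‖⁻¹) • w‖ = 1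
    simp [norm_smul, this]
  obtain ⟨b, hb⟩ := hv.exists_orthonormalBasis_extension_of_card_eq hcard
  refine ⟨b.repr, ?_⟩
  have h0 : b 0 = (‖w‖⁻¹) • w := hb 0 rfl
  have : w = ‖w‖ • b 0 := by
    rw [h0, smul_smul, mul_inv_cancel₀ (norm_ne_zero_iff.2 hw), one_smul]
  conv_lhs => rw [this, map_smul, b.repr_self]
  ext j
  rcases eq_or_ne j 0 with rfl | hj
  · simp
  · simp [hj]

/-! ### The trace inequality on a bounded convex domain. -/

theorem lintegral_comp_add_mul_left {g : ℝ → ℝ≥0∞} (hg : Measurable g) (a : ℝ) {c : ℝ}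
    (hc : c ≠ 0) : ∫⁻ s, g (a + c * s) = ENNReal.ofReal |c⁻¹| * ∫⁻ t, g t := by
  have h1 : ∫⁻ s, g (a + c * s) = ∫⁻ t, g (a + t) ∂(Measure.map (c * ·) volume) := by
    rw [lintegral_map (by fun_prop) (by fun_prop)]
  rw [h1, Real.map_volume_mul_left hc, lintegral_smul_measure, smul_eq_mul,
    lintegral_add_left_eq_self]

/-- Near y₀ the boundary is a Lipschitz graph over the hyperplane orthogonal to w = x₀ - y₀, where
x₀ is an interior point. Surface measure is therefore dominated by Lebesgue measure on that
hyperplane, and Fubini along the lines parallel to w gives the estimate. -/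
theorem exists_trace_chart {n : ℕ} {Ω : Set (Space (n + 1))} (ho : IsOpen Ω) (hc : Convex ℝ Ω)
    (hne : Ω.Nonempty) {y₀ : Space (n + 1)} (hy₀ : y₀ ∈ frontier Ω) :
    ∃ U ∈ nhds y₀, IsClosed U ∧ ∃ (M : ℝ≥0) (w : Space (n + 1)),
      (∀ y ∈ frontier Ω ∩ U, ∀ s ∈ Set.Ioc (0 : ℝ) 1, y + s • w ∈ Ω) ∧
      ∀ f : Space (n + 1) → ℝ≥0∞, Measurable f →
        ∫⁻ y in frontier Ω ∩ U, (∫⁻ s in Set.Ioo (0 : ℝ) 1, f (y + s • w))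
          ∂(Measure.euclideanHausdorffMeasure n) ≤ M * ∫⁻ x in Ω, f x := by
  obtain ⟨x₀, hx₀⟩ := hne
  obtain ⟨r, hr, hball⟩ := Metric.isOpen_iff.1 ho x₀ hx₀
  have hfr : ∀ y ∈ frontier Ω, y ∉ Ω := fun y hy h => by
    rw [ho.frontier_eq] at hy; exact hy.2 h
  have hcl : ∀ y ∈ frontier Ω, y ∈ closure Ω := fun y hy => frontier_subset_closure hy
  set w := x₀ - y₀ with hw
  have hwr : r ≤ ‖w‖ := by
    by_contra! h
    refine hfr y₀ hy₀ (hball ?_)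
    rwa [Metric.mem_ball, dist_comm, dist_eq_norm]
  have hwpos : 0 < ‖w‖ := hr.trans_le hwr
  have hw0 : w ≠ 0 := norm_pos_iff.1 hwpos
  have hcombo : ∀ y ∈ closure Ω, ∀ z ∈ Ω, ∀ s ∈ Set.Ioc (0 : ℝ) 1, y + s • (z - y) ∈ Ω := by
    intro y hy z hz s hs
    have := hc.combo_closure_interior_mem_interior hy (ho.interior_eq.symm ▸ hz)
      (a := 1 - s) (b := s) (by linarith [hs.2]) hs.1 (by ring)
    rw [ho.interior_eq] at this
    convert this using 1
    module
  obtain ⟨R, hR⟩ := exists_linearIsometryEquiv_map_eq_single hw0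
  set P : Space (n + 1) → Space n := fun x => dropCoord 0 (R x) with hP
  have hPc : Continuous P := by fun_prop
  set A := frontier Ω ∩ Metric.closedBall y₀ (r / 4) with hA
  -- K₁ bounds the slope of the graph: if y' rose above y more steeply, it would lie in the open
  -- cone from y to the ball of radius r about x₀, hence in Ω.
  set K₁ : ℝ := 2 * ‖w‖ / r with hK₁
  have hK₁0 : 0 ≤ K₁ := by positivity
  have hheight : ∀ y ∈ A, ∀ y' ∈ A, R (y' - y) 0 ≤ K₁ * ‖dropCoord 0 (R (y' - y))‖ := by
    intro y hy y' hy'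
    by_contra! hlt
    set h := R (y' - y) 0
    set δ := dropCoord 0 (R (y' - y))
    have hh : 0 < h := lt_of_le_of_lt (by positivity) hlt
    -- With ξ the part of y' - y orthogonal to w, y' = y + s(w + s⁻¹ξ). The endpoint y + w + s⁻¹ξ is
    -- within r/4 + r/2 of x₀, so it lies in Ω and y' would too.
    set s := h / ‖w‖ with hs
    have hs0 : 0 < s := by positivity
    set ξ := y' - y - s • w with hξ
    have hnξ : ‖ξ‖ = ‖δ‖ := by
      have h1 : R ξ = R (y' - y) - s • EuclideanSpace.single 0 ‖w‖ := by
        rw [hξ, map_sub, map_smul, hR]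
      have h2 : (R ξ) 0 = 0 := by
        rw [h1]; simp [hs]; field_simp; simp [h]
      have h3 : dropCoord 0 (R ξ) = δ := by
        rw [h1]; ext j; simp [δ]
      have h4 := norm_sq_eq_dropCoord 0 (R ξ)
      rw [h2, h3, R.norm_map] at h4
      have h5 : ‖ξ‖ ^ 2 = ‖δ‖ ^ 2 := by simpa using h4
      exact (sq_eq_sq₀ (norm_nonneg _) (norm_nonneg _)).1 h5
    have hδs : ‖δ‖ < s * r / 2 := by
      have : K₁ * ‖δ‖ * (r / (2 * ‖w‖)) < h * (r / (2 * ‖w‖)) :=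
        mul_lt_mul_of_pos_right hlt (by positivity)
      calc ‖δ‖ = K₁ * ‖δ‖ * (r / (2 * ‖w‖)) := by rw [hK₁]; field_simp
        _ < _ := this
        _ = s * r / 2 := by rw [hs]; field_simp
    have hyy : ‖y' - y‖ ≤ r / 2 := by
      rw [← dist_eq_norm]
      have h1 := hy.2; have h2 := hy'.2
      rw [Metric.mem_closedBall] at h1 h2
      linarith [dist_triangle_right y' y y₀]
    have hs1 : s ≤ 1 := by
      have h1 : h ≤ ‖y' - y‖ := by
        rw [← R.norm_map]
        exact (le_abs_self _).trans (PiLp.norm_apply_le (R (y' - y)) 0)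
      rw [hs, div_le_one hwpos]
      linarith
    have hz : y + w + s⁻¹ • ξ ∈ Ω := by
      apply hball
      rw [Metric.mem_ball, dist_eq_norm]
      have h1 : y + w + s⁻¹ • ξ - x₀ = (y - y₀) + s⁻¹ • ξ := by rw [hw]; module
      have h2 : ‖s⁻¹ • ξ‖ < r / 2 := by
        rw [norm_smul, hnξ, norm_inv, Real.norm_of_nonneg hs0.le, inv_mul_lt_iff₀ hs0]
        linarith
      have h3 := hy.2
      rw [Metric.mem_closedBall, dist_eq_norm] at h3
      rw [h1]
      linarith [norm_add_le (y - y₀) (s⁻¹ • ξ)]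
    refine hfr y' hy'.1 ?_
    have := hcombo y (hcl y hy.1) _ hz s ⟨hs0, hs1⟩
    convert this using 1
    have : s • (s⁻¹ • ξ) = ξ := by rw [smul_smul, mul_inv_cancel₀ hs0.ne', one_smul]
    rw [add_sub_right_comm, add_sub_cancel_left, smul_add, this, hξ]
    simp
  have hbilip : ∀ x ∈ A, ∀ y ∈ A, dist x y ≤ (K₁.toNNReal + 1 : ℝ≥0) * dist (P x) (P y) := by
    intro x hx y hy
    have h1 := hheight y hy x hx
    have h2 := hheight x hx y hy
    have h3 : P x - P y = dropCoord 0 (R (x - y)) := by rw [map_sub, dropCoord_sub]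
    have h4 : R (y - x) = - R (x - y) := by rw [← map_neg, neg_sub]
    have h5 : ‖dropCoord 0 (R (y - x))‖ = ‖dropCoord 0 (R (x - y))‖ := by
      rw [map_sub, map_sub, dropCoord_sub, dropCoord_sub, norm_sub_rev]
    rw [h5, h4, PiLp.neg_apply] at h2
    rw [dist_eq_norm, dist_eq_norm, h3, NNReal.coe_add, Real.coe_toNNReal _ hK₁0, NNReal.coe_one]
    refine le_of_sq_le_sq ?_ (by positivity)
    rw [← R.norm_map, norm_sq_eq_dropCoord 0]
    have h6 : (R (x - y)) 0 ^ 2 ≤ (K₁ * ‖dropCoord 0 (R (x - y))‖) ^ 2 :=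
      sq_le_sq' (by linarith) h1
    nlinarith [mul_nonneg hK₁0 (sq_nonneg ‖dropCoord 0 (R (x - y))‖)]
  refine ⟨Metric.closedBall y₀ (r / 4), Metric.closedBall_mem_nhds _ (by positivity),
    Metric.isClosed_closedBall,
    (‖w‖⁻¹).toNNReal * (K₁.toNNReal + 1) ^ n, w, ?_, ?_⟩
  · intro y hy s hs
    have hz : y + w ∈ Ω := by
      apply hball
      have h3 := hy.2
      rw [Metric.mem_closedBall, dist_eq_norm] at h3
      rw [Metric.mem_ball, dist_eq_norm, hw]
      have : y + (x₀ - y₀) - x₀ = y - y₀ := by abel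
      rw [this]; linarith
    simpa using hcombo y (hcl y hy.1) _ hz s hs
  · intro f hf
    have hmΩ := ho.measurableSet
    set F := Ω.indicator f with hF
    have hFm : Measurable F := hf.indicator hmΩ
    set Φ : Space n → ℝ≥0∞ := fun z => ∫⁻ h : ℝ, F (R.symm (insertCoord 0 h z)) with hΦ
    have hF2 : Measurable fun p : ℝ × Space n => F (R.symm (insertCoord 0 p.1 p.2)) :=
      hFm.comp (R.symm.continuous.comp (continuous_insertCoord 0)).measurable
    have hΦm : Measurable Φ := hF2.lintegral_prod_left'
    have hpt : ∀ y ∈ A, ∫⁻ s in Set.Ioo (0 : ℝ) 1, f (y + s • w)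
        ≤ ENNReal.ofReal ‖w‖⁻¹ * Φ (P y) := by
      intro y hy
      have h1 : ∀ s : ℝ, R.symm (insertCoord 0 (R y 0 + ‖w‖ * s) (P y)) = y + s • w := by
        intro s
        rw [LinearIsometryEquiv.symm_apply_eq, map_add, map_smul, hR]
        ext j
        refine Fin.cases ?_ (fun j => ?_) j
        · simp [insertCoord, mul_comm]
        · simp [insertCoord, P]
      have h2 : Measurable fun h : ℝ => F (R.symm (insertCoord 0 h (P y))) :=
        hF2.comp (measurable_id.prodMk measurable_const)
      have h3 := lintegral_comp_add_mul_left h2 (R y 0) hwpos.ne'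
      rw [abs_of_pos (inv_pos.2 hwpos)] at h3
      rw [hΦ, ← h3]
      refine le_trans ?_ (setLIntegral_le_lintegral (Set.Ioo (0 : ℝ) 1) _)
      refine setLIntegral_mono' measurableSet_Ioo fun s hs => ?_
      rw [h1 s, hF, Set.indicator_of_mem]
      have hz : y + w ∈ Ω := by
        apply hball
        have h3 := hy.2
        rw [Metric.mem_closedBall, dist_eq_norm] at h3
        rw [Metric.mem_ball, dist_eq_norm, hw]
        have : y + (x₀ - y₀) - x₀ = y - y₀ := by abel
        rw [this]; linarith
      simpa using hcombo y (hcl y hy.1) _ hz s ⟨hs.1, hs.2.le⟩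
    have hmA : MeasurableSet A := isClosed_frontier.measurableSet.inter
      Metric.isClosed_closedBall.measurableSet
    calc ∫⁻ y in A, (∫⁻ s in Set.Ioo (0 : ℝ) 1, f (y + s • w))
          ∂(Measure.euclideanHausdorffMeasure n)
        ≤ ∫⁻ y in A, ENNReal.ofReal ‖w‖⁻¹ * Φ (P y) ∂(Measure.euclideanHausdorffMeasure n) :=
          setLIntegral_mono' hmA hpt
      _ = ENNReal.ofReal ‖w‖⁻¹ * ∫⁻ z, Φ z
            ∂(((Measure.euclideanHausdorffMeasure n).restrict A).map P) := by
          rw [lintegral_map hΦm hPc.measurable]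
          exact lintegral_const_mul _ (hΦm.comp hPc.measurable)
      _ ≤ ENNReal.ofReal ‖w‖⁻¹ * ∫⁻ z, Φ z
            ∂(((K₁.toNNReal + 1 : ℝ≥0) : ℝ≥0∞) ^ n • (volume : Measure (Space n))) := by
          gcongr
          exact map_restrict_euclideanHausdorffMeasure_le hPc.measurable hbilip
      _ = _ := by
          have h1 : ∫⁻ z, Φ z = ∫⁻ x in Ω, f x := by
            rw [← lintegral_indicator hmΩ, ← R.symm.measurePreserving.lintegral_comp hFm]
            exact (lintegral_eq_lintegral_insertCoord 0
              (hFm.comp R.symm.continuous.measurable)).symm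
          rw [lintegral_smul_measure, h1, smul_eq_mul, ENNReal.coe_mul, ENNReal.coe_pow,
            ENNReal.ofReal, mul_assoc]

/-- Cauchy–Schwarz for ∫ψ', read off by expanding ∫((b - a)ψ' - I)² ≥ 0. -/
theorem sq_sub_le_mul_integral_deriv_sq {ψ : ℝ → ℝ} (hψ : ContDiff ℝ 1 ψ) {a b : ℝ} (hab : a ≤ b) :
    (ψ b - ψ a) ^ 2 ≤ (b - a) * ∫ t in a..b, deriv ψ t ^ 2 := by
  rcases hab.eq_or_lt with rfl | hlt
  · simp
  have hd : Continuous (deriv ψ) := hψ.continuous_deriv le_rfl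
  have hI : ∫ t in a..b, deriv ψ t = ψ b - ψ a :=
    intervalIntegral.integral_deriv_eq_sub (fun t _ => (hψ.differentiable one_ne_zero) t)
      (hd.intervalIntegrable _ _)
  set I := ψ b - ψ a
  set J := ∫ t in a..b, deriv ψ t ^ 2
  have h0 : 0 ≤ ∫ t in a..b, ((b - a) * deriv ψ t - I) ^ 2 :=
    intervalIntegral.integral_nonneg hab fun t _ => sq_nonneg _
  have h1 : ∫ t in a..b, ((b - a) * deriv ψ t - I) ^ 2
      = (b - a) ^ 2 * J - 2 * (b - a) * I * I + I ^ 2 * (b - a) := by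
    have : ∀ t, ((b - a) * deriv ψ t - I) ^ 2
        = (b - a) ^ 2 * deriv ψ t ^ 2 - 2 * (b - a) * I * deriv ψ t + I ^ 2 := fun t => by ring
    simp_rw [this]
    rw [intervalIntegral.integral_add, intervalIntegral.integral_sub,
      intervalIntegral.integral_const_mul, intervalIntegral.integral_const_mul, hI,
      intervalIntegral.integral_const, smul_eq_mul]
    · ring
    all_goals exact Continuous.intervalIntegrable (by fun_prop) _ _
  rw [h1] at h0
  have hpos : 0 < b - a := by linarith
  have : 0 ≤ (b - a) * ((b - a) * J - I ^ 2) := by nlinarith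
  have := nonneg_of_mul_nonneg_right this hpos
  linarith

/-- Average ψ(0)² ≤ 2ψ(t)² + 2(ψ(t) - ψ(0))² over t in [0, τ]. The free length τ is what later makes
the gradient term small and the trace map compact. -/
theorem sq_le_average_add_integral_deriv_sq {ψ : ℝ → ℝ} (hψ : ContDiff ℝ 1 ψ) {τ : ℝ}
    (hτ : 0 < τ) :
    ψ 0 ^ 2 ≤ 2 * τ⁻¹ * (∫ t in (0 : ℝ)..τ, ψ t ^ 2)
      + 2 * τ * ∫ t in (0 : ℝ)..τ, deriv ψ t ^ 2 := by
  have hd : Continuous (deriv ψ) := hψ.continuous_deriv le_rfl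
  set J := ∫ t in (0 : ℝ)..τ, deriv ψ t ^ 2
  have hpt : ∀ t ∈ Set.Icc (0 : ℝ) τ, ψ 0 ^ 2 ≤ 2 * ψ t ^ 2 + 2 * τ * J := by
    intro t ht
    have h1 := sq_sub_le_mul_integral_deriv_sq hψ ht.1
    have h2 : ∫ s in (0 : ℝ)..t, deriv ψ s ^ 2 ≤ J :=
      intervalIntegral.integral_mono_interval le_rfl ht.1 ht.2
        (Filter.Eventually.of_forall fun s => sq_nonneg _)
        (Continuous.intervalIntegrable (by fun_prop) _ _)
    have h3 : 0 ≤ ∫ s in (0 : ℝ)..t, deriv ψ s ^ 2 :=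
      intervalIntegral.integral_nonneg ht.1 fun s _ => sq_nonneg _
    have h4 : (t - 0) * ∫ s in (0 : ℝ)..t, deriv ψ s ^ 2 ≤ τ * J := by
      rw [sub_zero]; exact mul_le_mul ht.2 h2 h3 hτ.le
    nlinarith [sq_nonneg (2 * ψ t - ψ 0)]
  have hint := intervalIntegral.integral_mono_on (μ := volume) hτ.le
    (f := fun _ => ψ 0 ^ 2) (g := fun t => 2 * ψ t ^ 2 + 2 * τ * J)
    (Continuous.intervalIntegrable (by fun_prop) _ _)
    (Continuous.intervalIntegrable (by have := hψ.continuous; fun_prop) _ _) hpt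
  have hc := hψ.continuous
  rw [intervalIntegral.integral_const, smul_eq_mul, intervalIntegral.integral_add,
    intervalIntegral.integral_const_mul, intervalIntegral.integral_const, smul_eq_mul,
    sub_zero] at hint
  · have := mul_le_mul_of_nonneg_left hint (inv_nonneg.2 hτ.le)
    have e1 : τ⁻¹ * (τ * ψ 0 ^ 2) = ψ 0 ^ 2 := by field_simp
    have e2 : τ⁻¹ * (2 * (∫ t in (0 : ℝ)..τ, ψ t ^ 2) + τ * (2 * τ * J))
        = 2 * τ⁻¹ * (∫ t in (0 : ℝ)..τ, ψ t ^ 2) + 2 * τ * J := by field_simp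
    rw [e1, e2] at this
    exact this
  all_goals exact Continuous.intervalIntegrable (by fun_prop) _ _

theorem ofReal_intervalIntegral_sq {g : ℝ → ℝ} (hg : Continuous g) {a b : ℝ} (hab : a ≤ b) :
    ENNReal.ofReal (∫ t in a..b, g t ^ 2) = ∫⁻ t in Set.Ioo a b, ‖g t‖ₑ ^ 2 := by
  rw [intervalIntegral.integral_of_le hab, integral_Ioc_eq_integral_Ioo,
    ofReal_integral_eq_lintegral_ofReal]
  · refine lintegral_congr fun t => ?_
    rw [← sq_abs, ENNReal.ofReal_pow (abs_nonneg _), ← Real.norm_eq_abs, ofReal_norm]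
  · exact ((hg.pow 2).integrableOn_Icc (μ := volume) (a := a) (b := b)).mono_set Set.Ioo_subset_Icc_self
  · exact Filter.Eventually.of_forall fun t => sq_nonneg _

theorem enorm_deriv_comp_line_le {n : ℕ} {φ : Space n → ℝ} (hφ : ContDiff ℝ 1 φ) (y w : Space n)
    (s : ℝ) : ‖deriv (fun t : ℝ => φ (y + t • w)) s‖ₑ ≤ ‖fderiv ℝ φ (y + s • w)‖ₑ * ‖w‖ₑ := by
  have h1 : HasDerivAt (fun t : ℝ => y + t • w) w s := by
    simpa using ((hasDerivAt_id s).smul_const w).const_add y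
  have h2 := (((hφ.differentiable one_ne_zero) (y + s • w)).hasFDerivAt).comp_hasDerivAt s h1
  have h3 : deriv (fun t : ℝ => φ (y + t • w)) s = fderiv ℝ φ (y + s • w) w := h2.deriv
  rw [h3]
  exact ContinuousLinearMap.le_opENorm _ _

theorem enorm_sq_le_lintegral_line {n : ℕ} {φ : Space n → ℝ} (hφ : ContDiff ℝ 1 φ)
    (y w : Space n) {τ : ℝ} (hτ : τ ∈ Set.Ioc (0 : ℝ) 1) :
    ‖φ y‖ₑ ^ 2 ≤ ENNReal.ofReal (2 * τ⁻¹) * (∫⁻ s in Set.Ioo (0 : ℝ) 1, ‖φ (y + s • w)‖ₑ ^ 2)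
      + ENNReal.ofReal (2 * τ) * (‖w‖ₑ ^ 2 *
          ∫⁻ s in Set.Ioo (0 : ℝ) 1, ‖fderiv ℝ φ (y + s • w)‖ₑ ^ 2) := by
  set ψ : ℝ → ℝ := fun t => φ (y + t • w) with hψdef
  have hψ : ContDiff ℝ 1 ψ := hφ.comp (by fun_prop)
  have hd : Continuous (deriv ψ) := hψ.continuous_deriv le_rfl
  have h := sq_le_average_add_integral_deriv_sq hψ hτ.1
  have h0 : ψ 0 = φ y := by simp [ψ]
  rw [h0] at h
  have h1 := ENNReal.ofReal_le_ofReal h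
  rw [ENNReal.ofReal_add, ENNReal.ofReal_mul, ENNReal.ofReal_mul (p := 2 * τ),
    ofReal_intervalIntegral_sq hψ.continuous hτ.1.le, ofReal_intervalIntegral_sq hd hτ.1.le] at h1
  · rw [← sq_abs, ENNReal.ofReal_pow (abs_nonneg _), ← Real.norm_eq_abs, ofReal_norm] at h1
    refine h1.trans ?_
    have hsub : Set.Ioo (0 : ℝ) τ ⊆ Set.Ioo 0 1 := Set.Ioo_subset_Ioo_right hτ.2
    gcongr
    rw [← lintegral_const_mul' _ _ (by simp)]
    refine (lintegral_mono_set hsub).trans (lintegral_mono fun s => ?_)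
    rw [← mul_pow, mul_comm]
    gcongr
    exact enorm_deriv_comp_line_le hφ y w s
  · have := hτ.1; positivity
  · have := hτ.1; positivity
  · refine mul_nonneg (by have := hτ.1; positivity) (intervalIntegral.integral_nonneg hτ.1.le fun t _ => sq_nonneg _)
  · refine mul_nonneg (by have := hτ.1; positivity) (intervalIntegral.integral_nonneg hτ.1.le fun t _ => sq_nonneg _)

theorem measurable_enorm_sq {X E : Type*} [TopologicalSpace X] [MeasurableSpace X]
    [OpensMeasurableSpace X] [NormedAddCommGroup E] {f : X → E} (hf : Continuous f) :
    Measurable fun x => ‖f x‖ₑ ^ 2 :=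
  ((continuous_enorm.comp hf).measurable).pow_const 2

/-- The trace inequality, with a small constant in front of the gradient. -/
theorem exists_trace_inequality {n : ℕ} {Ω : Set (Space (n + 1))} (ho : IsOpen Ω)
    (hc : Convex ℝ Ω) (hne : Ω.Nonempty) (hb : Bornology.IsBounded Ω) :
    ∃ M : ℝ≥0, ∀ τ ∈ Set.Ioc (0 : ℝ) 1, ∀ φ : Space (n + 1) → ℝ, ContDiff ℝ 1 φ →
      ∫⁻ y in frontier Ω, ‖φ y‖ₑ ^ 2 ∂(Measure.euclideanHausdorffMeasure n)
        ≤ M * (ENNReal.ofReal τ⁻¹ * (∫⁻ x in Ω, ‖φ x‖ₑ ^ 2)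
          + ENNReal.ofReal τ * ∫⁻ x in Ω, ‖fderiv ℝ φ x‖ₑ ^ 2) := by
  have hcomp : IsCompact (frontier Ω) :=
    (Metric.isCompact_of_isClosed_isBounded isClosed_closure hb.closure).of_isClosed_subset
      isClosed_frontier frontier_subset_closure
  suffices H : ∃ M : ℝ≥0, ∀ τ ∈ Set.Ioc (0 : ℝ) 1, ∀ φ : Space (n + 1) → ℝ, ContDiff ℝ 1 φ →
      ∫⁻ y in frontier Ω ∩ frontier Ω, ‖φ y‖ₑ ^ 2 ∂(Measure.euclideanHausdorffMeasure n)
        ≤ M * (ENNReal.ofReal τ⁻¹ * (∫⁻ x in Ω, ‖φ x‖ₑ ^ 2)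
          + ENNReal.ofReal τ * ∫⁻ x in Ω, ‖fderiv ℝ φ x‖ₑ ^ 2) by
    rwa [Set.inter_self] at H
  -- The bound passes to subsets and, adding constants, to unions, so compactness of the boundary
  -- reduces it to the charts.
  refine hcomp.induction_on (p := fun S => ∃ M : ℝ≥0, ∀ τ ∈ Set.Ioc (0 : ℝ) 1,
    ∀ φ : Space (n + 1) → ℝ, ContDiff ℝ 1 φ →
      ∫⁻ y in frontier Ω ∩ S, ‖φ y‖ₑ ^ 2 ∂(Measure.euclideanHausdorffMeasure n)
        ≤ M * (ENNReal.ofReal τ⁻¹ * (∫⁻ x in Ω, ‖φ x‖ₑ ^ 2)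
          + ENNReal.ofReal τ * ∫⁻ x in Ω, ‖fderiv ℝ φ x‖ₑ ^ 2)) ?_ ?_ ?_ ?_
  · exact ⟨0, fun τ _ φ _ => by simp⟩
  · rintro S T hST ⟨M, hM⟩
    exact ⟨M, fun τ hτ φ hφ => (lintegral_mono_set (Set.inter_subset_inter_right _ hST)).trans
      (hM τ hτ φ hφ)⟩
  · rintro S T ⟨M, hM⟩ ⟨M', hM'⟩
    refine ⟨M + M', fun τ hτ φ hφ => ?_⟩
    rw [Set.inter_union_distrib_left, ENNReal.coe_add, add_mul]
    exact (lintegral_union_le _ _ _).trans (add_le_add (hM τ hτ φ hφ) (hM' τ hτ φ hφ))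
  · intro y₀ hy₀
    obtain ⟨U, hU, hUc, M, w, hw, hM⟩ := exists_trace_chart ho hc hne hy₀
    refine ⟨U, mem_nhdsWithin_of_mem_nhds hU, M * (2 + 2 * ‖w‖₊ ^ 2), fun τ hτ φ hφ => ?_⟩
    have hτ0 := hτ.1
    have hm1 := measurable_enorm_sq hφ.continuous
    have hm2 := measurable_enorm_sq (hφ.continuous_fderiv one_ne_zero)
    have hline : Continuous fun p : Space (n + 1) × ℝ => p.1 + p.2 • w := by fun_prop
    have hi1 : Measurable fun y => ∫⁻ s in Set.Ioo (0 : ℝ) 1, ‖φ (y + s • w)‖ₑ ^ 2 :=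
      (hm1.comp hline.measurable).lintegral_prod_right'
    have hi2 : Measurable fun y => ∫⁻ s in Set.Ioo (0 : ℝ) 1, ‖fderiv ℝ φ (y + s • w)‖ₑ ^ 2 :=
      (hm2.comp hline.measurable).lintegral_prod_right'
    have e1 : ENNReal.ofReal (2 * τ⁻¹) = 2 * ENNReal.ofReal τ⁻¹ := by
      rw [ENNReal.ofReal_mul zero_le_two]; simp
    have e2 : ENNReal.ofReal (2 * τ) = 2 * ENNReal.ofReal τ := by
      rw [ENNReal.ofReal_mul zero_le_two]; simp
    calc ∫⁻ y in frontier Ω ∩ U, ‖φ y‖ₑ ^ 2 ∂(Measure.euclideanHausdorffMeasure n)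
        ≤ ∫⁻ y in frontier Ω ∩ U, (ENNReal.ofReal (2 * τ⁻¹) *
            (∫⁻ s in Set.Ioo (0 : ℝ) 1, ‖φ (y + s • w)‖ₑ ^ 2)
            + ENNReal.ofReal (2 * τ) * (‖w‖ₑ ^ 2 *
              ∫⁻ s in Set.Ioo (0 : ℝ) 1, ‖fderiv ℝ φ (y + s • w)‖ₑ ^ 2))
            ∂(Measure.euclideanHausdorffMeasure n) :=
          lintegral_mono fun y => enorm_sq_le_lintegral_line hφ y w hτ
      _ = ENNReal.ofReal (2 * τ⁻¹) * (∫⁻ y in frontier Ω ∩ U,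
            (∫⁻ s in Set.Ioo (0 : ℝ) 1, ‖φ (y + s • w)‖ₑ ^ 2)
              ∂(Measure.euclideanHausdorffMeasure n))
            + ENNReal.ofReal (2 * τ) * (‖w‖ₑ ^ 2 * ∫⁻ y in frontier Ω ∩ U,
              (∫⁻ s in Set.Ioo (0 : ℝ) 1, ‖fderiv ℝ φ (y + s • w)‖ₑ ^ 2)
              ∂(Measure.euclideanHausdorffMeasure n)) := by
          rw [lintegral_add_left (hi1.const_mul _), lintegral_const_mul _ hi1,
            lintegral_const_mul _ (hi2.const_mul _), lintegral_const_mul _ hi2]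
      _ ≤ ENNReal.ofReal (2 * τ⁻¹) * (M * ∫⁻ x in Ω, ‖φ x‖ₑ ^ 2)
            + ENNReal.ofReal (2 * τ) * (‖w‖ₑ ^ 2 * (M * ∫⁻ x in Ω, ‖fderiv ℝ φ x‖ₑ ^ 2)) := by
          gcongr
          · exact hM _ hm1
          · exact hM _ hm2
      _ = M * (2 * (ENNReal.ofReal τ⁻¹ * (∫⁻ x in Ω, ‖φ x‖ₑ ^ 2))
            + 2 * ‖w‖ₑ ^ 2 * (ENNReal.ofReal τ * ∫⁻ x in Ω, ‖fderiv ℝ φ x‖ₑ ^ 2)) := by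
          rw [e1, e2]; ring
      _ ≤ M * ((2 + 2 * ‖w‖ₑ ^ 2) * (ENNReal.ofReal τ⁻¹ * (∫⁻ x in Ω, ‖φ x‖ₑ ^ 2))
            + (2 + 2 * ‖w‖ₑ ^ 2) * (ENNReal.ofReal τ * ∫⁻ x in Ω, ‖fderiv ℝ φ x‖ₑ ^ 2)) := by
          gcongr
          · exact le_self_add
          · exact le_add_self
      _ = _ := by
          rw [← mul_add, ← mul_assoc]
          norm_cast

/-- The trace inequality for the constant function 1. -/
theorem euclideanHausdorffMeasure_frontier_lt_top {n : ℕ} {Ω : Set (Space (n + 1))}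
    (ho : IsOpen Ω) (hc : Convex ℝ Ω) (hne : Ω.Nonempty) (hb : Bornology.IsBounded Ω) :
    (Measure.euclideanHausdorffMeasure n : Measure (Space (n + 1))) (frontier Ω) < ⊤ := by
  obtain ⟨M, hM⟩ := exists_trace_inequality ho hc hne hb
  have h := hM 1 (by simp) (fun _ => 1) contDiff_const
  simp only [enorm_one, one_pow, lintegral_const, Measure.restrict_apply_univ, one_mul] at h
  refine h.trans_lt ?_
  have := hb.measure_lt_top (μ := volume)
  have h0 : (‖(0 : Space (n + 1) →L[ℝ] ℝ)‖ₑ ^ 2 : ℝ≥0∞) = 0 := by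
    rw [enorm_eq_nnnorm, nnnorm_zero]; simp
  simpa [h0] using ENNReal.mul_lt_top (a := M) ENNReal.coe_lt_top this

/-! ### Poincaré inequality and control by finitely many averages. -/

theorem enorm_sub_sq_le_lintegral_segment {n : ℕ} {φ : Space n → ℝ} (hφ : ContDiff ℝ 1 φ)
    (x y : Space n) :
    ‖φ x - φ y‖ₑ ^ 2 ≤ ‖y - x‖ₑ ^ 2 *
      ∫⁻ t in Set.Ioo (0 : ℝ) 1, ‖fderiv ℝ φ (x + t • (y - x))‖ₑ ^ 2 := by
  set ψ : ℝ → ℝ := fun t => φ (x + t • (y - x)) with hψdef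
  have hψ : ContDiff ℝ 1 ψ := hφ.comp (by fun_prop)
  have hd : Continuous (deriv ψ) := hψ.continuous_deriv le_rfl
  have h := sq_sub_le_mul_integral_deriv_sq hψ zero_le_one
  have h0 : ψ 0 = φ x := by simp [ψ]
  have h1 : ψ 1 = φ y := by simp [ψ]
  rw [h0, h1, sub_zero, one_mul] at h
  have h2 := ENNReal.ofReal_le_ofReal h
  rw [ofReal_intervalIntegral_sq hd zero_le_one, ← sq_abs, ENNReal.ofReal_pow (abs_nonneg _),
    ← Real.norm_eq_abs, ofReal_norm, ← enorm_neg, neg_sub] at h2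
  refine h2.trans ?_
  rw [← lintegral_const_mul' _ _ (by simp)]
  refine lintegral_mono fun s => ?_
  rw [← mul_pow, mul_comm]
  gcongr
  exact enorm_deriv_comp_line_le hφ x (y - x) s

theorem lintegral_comp_add_smul {n : ℕ} {g : Space n → ℝ≥0∞} (hg : Measurable g) (a : Space n)
    {t : ℝ} (ht : t ≠ 0) :
    ∫⁻ y, g (a + t • y) = ENNReal.ofReal |(t ^ n)⁻¹| * ∫⁻ y, g y := by
  have h1 : ∫⁻ y, g (a + t • y) = ∫⁻ y, g (a + y) ∂(Measure.map (t • ·) volume) := by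
    rw [lintegral_map (by fun_prop) (by fun_prop)]
  rw [h1, Measure.map_addHaar_smul _ ht, lintegral_smul_measure, smul_eq_mul,
    lintegral_add_left_eq_self]
  simp

/-- For t ≥ 1/2 change variables in y, with Jacobian factor t⁻ⁿ ≤ 2ⁿ; for t < 1/2 exchange the roles
of x and y. This avoids the singularity of either substitution. -/
theorem lintegral_segment_le {n : ℕ} {g : Space n → ℝ≥0∞} (hg : Measurable g) (Q : Set (Space n))
    (t : ℝ) :
    ∫⁻ x in Q, ∫⁻ y in Q, g (x + t • (y - x)) ≤ 2 ^ n * volume Q * ∫⁻ x, g x := by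
  have key : ∀ s : ℝ, 1 / 2 ≤ s →
      ∫⁻ x in Q, ∫⁻ y in Q, g ((1 - s) • x + s • y) ≤ 2 ^ n * volume Q * ∫⁻ x, g x := by
    intro s hs
    have hs0 : 0 < s := by linarith
    have h1 : ∀ x : Space n, ∫⁻ y in Q, g ((1 - s) • x + s • y) ≤ 2 ^ n * ∫⁻ x, g x := by
      intro x
      refine (setLIntegral_le_lintegral _ _).trans ?_
      rw [lintegral_comp_add_smul hg _ hs0.ne']
      gcongr
      rw [abs_of_pos (by positivity), ← inv_pow, ENNReal.ofReal_pow (by positivity)]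
      gcongr
      have : s⁻¹ ≤ 2 := by rw [inv_le_comm₀ hs0 two_pos]; linarith
      simpa using ENNReal.ofReal_le_ofReal this
    calc _ ≤ ∫⁻ x in Q, 2 ^ n * ∫⁻ x, g x := lintegral_mono fun x => h1 x
      _ = _ := by rw [setLIntegral_const]; ring
  rcases le_or_gt (1 / 2) t with h | h
  · convert key t h using 6
    module
  · have h2 := key (1 - t) (by linarith)
    have hm : Measurable fun p : Space n × Space n => g (p.1 + t • (p.2 - p.1)) :=
      hg.comp (Continuous.measurable (by fun_prop))
    rw [lintegral_lintegral_swap hm.aemeasurable]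
    convert h2 using 6
    module

/-- Segments joining points of Q stay in Q, so φ(x) - φ(y) is controlled by the gradient inside Q;
after exchanging integrals, `lintegral_segment_le` applies at each fixed t. -/
theorem lintegral_lintegral_enorm_sub_sq_le {n : ℕ} {φ : Space n → ℝ} (hφ : ContDiff ℝ 1 φ)
    {Q : Set (Space n)} (hQ : MeasurableSet Q) (hQc : Convex ℝ Q) {δ : ℝ≥0}
    (hδ : ∀ x ∈ Q, ∀ y ∈ Q, ‖y - x‖₊ ≤ δ) :
    ∫⁻ x in Q, ∫⁻ y in Q, ‖φ x - φ y‖ₑ ^ 2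
      ≤ δ ^ 2 * (2 ^ n * volume Q * ∫⁻ x in Q, ‖fderiv ℝ φ x‖ₑ ^ 2) := by
  set g : Space n → ℝ≥0∞ := Q.indicator fun x => ‖fderiv ℝ φ x‖ₑ ^ 2 with hg
  have hgm : Measurable g :=
    (measurable_enorm_sq (hφ.continuous_fderiv one_ne_zero)).indicator hQ
  have hm3 : Measurable fun p : (Space n × Space n) × ℝ =>
      g (p.1.1 + p.2 • (p.1.2 - p.1.1)) :=
    hgm.comp (Continuous.measurable (by fun_prop))
  have hpt : ∀ x ∈ Q, ∀ y ∈ Q, ‖φ x - φ y‖ₑ ^ 2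
      ≤ δ ^ 2 * ∫⁻ t in Set.Ioo (0 : ℝ) 1, g (x + t • (y - x)) := by
    intro x hx y hy
    refine (enorm_sub_sq_le_lintegral_segment hφ x y).trans ?_
    refine mul_le_mul' ?_ (setLIntegral_mono' measurableSet_Ioo fun t ht => ?_)
    · gcongr
      exact_mod_cast hδ x hx y hy
    · rw [hg, Set.indicator_of_mem]
      have := hQc hx hy (a := 1 - t) (b := t) (by linarith [ht.2]) ht.1.le (by ring)
      convert this using 1
      module
  have hi1 : Measurable fun p : Space n × Space n =>
      ∫⁻ t in Set.Ioo (0 : ℝ) 1, g (p.1 + t • (p.2 - p.1)) := hm3.lintegral_prod_right'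
  calc ∫⁻ x in Q, ∫⁻ y in Q, ‖φ x - φ y‖ₑ ^ 2
      ≤ ∫⁻ x in Q, ∫⁻ y in Q, (δ : ℝ≥0∞) ^ 2 * ∫⁻ t in Set.Ioo (0 : ℝ) 1, g (x + t • (y - x)) :=
        setLIntegral_mono' hQ fun x hx => setLIntegral_mono' hQ fun y hy => hpt x hx y hy
    _ = (δ : ℝ≥0∞) ^ 2 * ∫⁻ x in Q, ∫⁻ y in Q, ∫⁻ t in Set.Ioo (0 : ℝ) 1, g (x + t • (y - x)) := by
        rw [← lintegral_const_mul' _ _ (by simp)]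
        refine lintegral_congr fun x => ?_
        rw [← lintegral_const_mul' _ _ (by simp)]
    _ = (δ : ℝ≥0∞) ^ 2 * ∫⁻ x in Q, ∫⁻ t in Set.Ioo (0 : ℝ) 1, ∫⁻ y in Q, g (x + t • (y - x)) := by
        congr 1
        refine lintegral_congr fun x => ?_
        refine lintegral_lintegral_swap ?_
        exact (hm3.comp (f := fun q : Space n × ℝ => ((x, q.1), q.2)) (by fun_prop)).aemeasurable
    _ = (δ : ℝ≥0∞) ^ 2 * ∫⁻ t in Set.Ioo (0 : ℝ) 1, ∫⁻ x in Q, ∫⁻ y in Q, g (x + t • (y - x)) := by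
        congr 1
        refine lintegral_lintegral_swap ?_
        have : Measurable fun p : (Space n × ℝ) × Space n => g (p.1.1 + p.1.2 • (p.2 - p.1.1)) :=
          hgm.comp (Continuous.measurable (by fun_prop))
        exact this.lintegral_prod_right'.aemeasurable
    _ ≤ (δ : ℝ≥0∞) ^ 2 * ∫⁻ t in Set.Ioo (0 : ℝ) 1, 2 ^ n * volume Q * ∫⁻ x, g x := by
        exact mul_le_mul' le_rfl
          (setLIntegral_mono' measurableSet_Ioo fun t _ => lintegral_segment_le hgm Q t)
    _ = _ := by
        rw [setLIntegral_const, Real.volume_Ioo, sub_zero, ENNReal.ofReal_one, mul_one, hg,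
          lintegral_indicator hQ]

theorem integrableOn_of_isBounded {n : ℕ} {f : Space n → ℝ} (hf : Continuous f)
    {Q : Set (Space n)} (hb : Bornology.IsBounded Q) : IntegrableOn f Q :=
  (hf.continuousOn.integrableOn_compact
    (Metric.isCompact_of_isClosed_isBounded isClosed_closure hb.closure)).mono_set subset_closure

theorem lintegral_enorm_sq_eq_ofReal {n : ℕ} {E : Type*} [NormedAddCommGroup E] {f : Space n → E}
    (hf : Continuous f) {Q : Set (Space n)} (hb : Bornology.IsBounded Q) :
    ∫⁻ x in Q, ‖f x‖ₑ ^ 2 = ENNReal.ofReal (∫ x in Q, ‖f x‖ ^ 2) := by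
  rw [ofReal_integral_eq_lintegral_ofReal]
  · refine lintegral_congr fun t => ?_
    rw [ENNReal.ofReal_pow (norm_nonneg _), ofReal_norm]
  · exact integrableOn_of_isBounded (by fun_prop) hb
  · exact Filter.Eventually.of_forall fun t => sq_nonneg _

/-- The Poincaré inequality on a convex set. -/
theorem integral_sq_le_poincare {n : ℕ} {φ : Space n → ℝ} (hφ : ContDiff ℝ 1 φ)
    {Q : Set (Space n)} (hQ : MeasurableSet Q) (hQc : Convex ℝ Q) (hb : Bornology.IsBounded Q)
    {δ : ℝ≥0} (hδ : ∀ x ∈ Q, ∀ y ∈ Q, ‖y - x‖₊ ≤ δ) :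
    ∫ x in Q, φ x ^ 2 ≤ (volume.real Q)⁻¹ * (∫ x in Q, φ x) ^ 2
      + δ ^ 2 * 2 ^ n * ∫ x in Q, ‖fderiv ℝ φ x‖ ^ 2 := by
  have hfin : volume Q ≠ ⊤ := hb.measure_lt_top.ne
  have hd := hφ.continuous_fderiv one_ne_zero
  have hc := hφ.continuous
  set v := volume.real Q with hv
  set A := ∫ x in Q, φ x
  set B := ∫ x in Q, φ x ^ 2
  set G := ∫ x in Q, ‖fderiv ℝ φ x‖ ^ 2
  have hG : 0 ≤ G := integral_nonneg fun x => sq_nonneg _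
  have hi1 : IntegrableOn φ Q := integrableOn_of_isBounded hc hb
  have hi2 : IntegrableOn (fun x => φ x ^ 2) Q := integrableOn_of_isBounded (by fun_prop) hb
  have : IsFiniteMeasure (volume.restrict Q) := ⟨by simpa using hb.measure_lt_top⟩
  have hin : ∀ x, ∫ y in Q, (φ x - φ y) ^ 2 = v * φ x ^ 2 - 2 * A * φ x + B := by
    intro x
    have : ∀ y, (φ x - φ y) ^ 2 = φ x ^ 2 - 2 * φ x * φ y + φ y ^ 2 := fun y => by ring
    simp_rw [this]
    rw [integral_add, integral_sub, integral_const, integral_const_mul, smul_eq_mul,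
      measureReal_restrict_apply_univ]
    · ring
    · exact integrable_const _
    · exact hi1.const_mul _
    · exact (integrable_const _).sub (hi1.const_mul _)
    · exact hi2
  -- The double integral of squared differences is twice v∫φ² - (∫φ)², which turns the segment
  -- estimate into Poincaré.
  have hdouble : ∫ x in Q, ∫ y in Q, (φ x - φ y) ^ 2 = 2 * v * B - 2 * A ^ 2 := by
    simp_rw [hin]
    rw [integral_add, integral_sub, integral_const, integral_const_mul, integral_const_mul,
      smul_eq_mul, measureReal_restrict_apply_univ]
    · ring
    · exact hi2.const_mul _
    · exact hi1.const_mul _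
    · exact (hi2.const_mul _).sub (hi1.const_mul _)
    · exact integrable_const _
  have hL : ENNReal.ofReal (2 * v * B - 2 * A ^ 2)
      = ∫⁻ x in Q, ∫⁻ y in Q, ‖φ x - φ y‖ₑ ^ 2 := by
    rw [← hdouble, ofReal_integral_eq_lintegral_ofReal]
    · refine lintegral_congr fun x => ?_
      rw [lintegral_enorm_sq_eq_ofReal (by fun_prop) hb]
      simp
    · simp_rw [hin]
      exact ((hi2.const_mul _).sub (hi1.const_mul _)).add (integrable_const _)
    · exact Filter.Eventually.of_forall fun x => integral_nonneg fun y => sq_nonneg _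
  have hmain := lintegral_lintegral_enorm_sub_sq_le hφ hQ hQc hδ
  have hR : (δ : ℝ≥0∞) ^ 2 * (2 ^ n * volume Q * ∫⁻ x in Q, ‖fderiv ℝ φ x‖ₑ ^ 2)
      = ENNReal.ofReal ((δ : ℝ) ^ 2 * (2 ^ n * v * G)) := by
    rw [lintegral_enorm_sq_eq_ofReal hd hb, ENNReal.ofReal_mul (by positivity),
      ENNReal.ofReal_mul (by positivity), ENNReal.ofReal_mul (by positivity),
      ENNReal.ofReal_pow (by positivity), ENNReal.ofReal_pow (by positivity), hv,
      ofReal_measureReal hfin]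
    simp [G]
  rw [← hL, hR] at hmain
  have hreal : 2 * v * B - 2 * A ^ 2 ≤ (δ : ℝ) ^ 2 * (2 ^ n * v * G) :=
    (ENNReal.ofReal_le_ofReal_iff (by positivity)).1 hmain
  -- On a null set v⁻¹ takes the default value 0, but the left side vanishes as well.
  rcases (measureReal_nonneg (μ := volume) (s := Q)).eq_or_lt with h0 | hpos
  · have hB : B = 0 := by
      have : volume.restrict Q = 0 := by
        rw [Measure.restrict_eq_zero]
        exact ((measureReal_eq_zero_iff hfin).1 h0.symm)
      simp [B, this]
    rw [hB]; positivity
  · rw [← hv] at hpos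
    have h1 : v * B ≤ v * (v⁻¹ * A ^ 2 + δ ^ 2 * 2 ^ n * G) := by
      have e : v * (v⁻¹ * A ^ 2 + δ ^ 2 * 2 ^ n * G) = A ^ 2 + δ ^ 2 * (2 ^ n * v * G) := by
        field_simp
      rw [e]
      have : 0 ≤ (δ : ℝ) ^ 2 * (2 ^ n * v * G) := by positivity
      linarith
    exact le_of_mul_le_mul_left h1 hpos

/-- The half-open cube of side `η` with corner `η a`. -/
def gridCell {n : ℕ} (η : ℝ) (a : Fin n → ℤ) : Set (Space n) :=
  {x | ∀ i, η * a i ≤ x i ∧ x i < η * (a i + 1)}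

theorem gridCell_eq_iInter {n : ℕ} (η : ℝ) (a : Fin n → ℤ) :
    gridCell η a = ⋂ i, ((fun x : Space n => x i) ⁻¹' Set.Ico (η * a i) (η * (a i + 1))) := by
  ext x; simp [gridCell]

theorem measurableSet_gridCell {n : ℕ} (η : ℝ) (a : Fin n → ℤ) :
    MeasurableSet (gridCell η a) := by
  rw [gridCell_eq_iInter]
  refine MeasurableSet.iInter fun i => ?_
  have : Continuous fun x : Space n => x i := by fun_prop
  exact this.measurable measurableSet_Ico

theorem convex_gridCell {n : ℕ} (η : ℝ) (a : Fin n → ℤ) : Convex ℝ (gridCell η a) := by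
  rw [gridCell_eq_iInter]
  refine convex_iInter fun i => ?_
  exact (convex_Ico _ _).is_linear_preimage
    (EuclideanSpace.proj i : Space n →L[ℝ] ℝ).toLinearMap.isLinear

theorem norm_sub_le_of_mem_gridCell {n : ℕ} {η : ℝ} (hη : 0 < η) {a : Fin n → ℤ} {x y : Space n}
    (hx : x ∈ gridCell η a) (hy : y ∈ gridCell η a) : ‖y - x‖ ≤ (n + 1) * η := by
  refine le_of_sq_le_sq ?_ (by positivity)
  rw [EuclideanSpace.norm_sq_eq]
  calc ∑ i, ‖(y - x) i‖ ^ 2 ≤ ∑ _i : Fin n, η ^ 2 := by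
        refine Finset.sum_le_sum fun i _ => ?_
        rw [Real.norm_eq_abs, sq_abs]
        have h1 := hx i; have h2 := hy i
        refine sq_le_sq' ?_ ?_ <;> rw [PiLp.sub_apply] <;> linarith
    _ = n * η ^ 2 := by simp
    _ ≤ _ := by
        have : (0 : ℝ) ≤ n := by positivity
        nlinarith [mul_nonneg this (sq_nonneg η), sq_nonneg ((n : ℝ) * η), sq_nonneg η]

theorem disjoint_gridCell {n : ℕ} {η : ℝ} (hη : 0 < η) {a b : Fin n → ℤ} (hab : a ≠ b) :
    Disjoint (gridCell η a) (gridCell η b) := by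
  rw [Set.disjoint_left]
  intro x hx hy
  refine hab (funext fun i => ?_)
  have key : ∀ c : Fin n → ℤ, x ∈ gridCell η c → ⌊x i / η⌋ = c i := fun c hc => by
    rw [Int.floor_eq_iff, le_div_iff₀ hη, div_lt_iff₀ hη]
    have := hc i
    constructor <;> nlinarith [this.1, this.2]
  rw [← key a hx, key b hy]

theorem exists_finset_subset_iUnion_gridCell {n : ℕ} {η : ℝ} (hη : 0 < η) {Ω : Set (Space n)}
    (hb : Bornology.IsBounded Ω) :
    ∃ S : Finset (Fin n → ℤ), Ω ⊆ ⋃ a ∈ S, gridCell η a := by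
  obtain ⟨R, hR⟩ := hb.exists_norm_le
  obtain ⟨N, hN⟩ := exists_nat_gt (R / η)
  refine ⟨Fintype.piFinset fun _ => Finset.Icc (-(N : ℤ) - 1) N, fun x hx => ?_⟩
  rw [Set.mem_iUnion₂]
  refine ⟨fun i => ⌊x i / η⌋, ?_, fun i => ?_⟩
  · rw [Fintype.mem_piFinset]
    intro i
    have h1 : |x i| ≤ R := (PiLp.norm_apply_le x i).trans (hR x hx)
    have h2 : |x i / η| < N := by
      rw [abs_div, abs_of_pos hη]
      exact (div_le_div_of_nonneg_right h1 hη.le).trans_lt hN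
    rw [abs_lt] at h2
    rw [Finset.mem_Icc]
    constructor
    · rw [Int.le_floor]; push_cast; linarith
    · have : ⌊x i / η⌋ < (N : ℤ) := by rw [Int.floor_lt]; exact_mod_cast h2.2
      exact this.le
  · have h1 := Int.floor_le (x i / η)
    have h2 := Int.lt_floor_add_one (x i / η)
    rw [le_div_iff₀ hη] at h1
    rw [div_lt_iff₀ hη] at h2
    constructor <;> linarith

/-- On a bounded convex set the `L²` norm is controlled by finitely many averages, up to a small
multiple of the norm of the gradient. -/
theorem exists_finite_averages {n : ℕ} {Ω : Set (Space n)} (ho : MeasurableSet Ω)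
    (hc : Convex ℝ Ω) (hb : Bornology.IsBounded Ω) {ε : ℝ} (hε : 0 < ε) :
    ∃ (S : Finset (Fin n → ℤ)) (Q : (Fin n → ℤ) → Set (Space n)) (C : ℝ), 0 ≤ C ∧
      (∀ a, MeasurableSet (Q a)) ∧ (∀ a, Q a ⊆ Ω) ∧
      ∀ φ : Space n → ℝ, ContDiff ℝ 1 φ →
        ∫ x in Ω, φ x ^ 2 ≤ C * (∑ a ∈ S, (∫ x in Q a, φ x) ^ 2)
          + ε * ∫ x in Ω, ‖fderiv ℝ φ x‖ ^ 2 := by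
  -- (n + 1)η bounds the diameter of a cell of side η, so this mesh makes the Poincaré constant of
  -- every cell at most ε.
  obtain ⟨η, hη, hηε⟩ : ∃ η : ℝ, 0 < η ∧ ((n + 1) * η) ^ 2 * 2 ^ n ≤ ε := by
    refine ⟨Real.sqrt (ε / 2 ^ n) / (n + 1), by positivity, ?_⟩
    rw [mul_div_cancel₀ _ (by positivity), Real.sq_sqrt (by positivity)]
    rw [div_mul_cancel₀ _ (by positivity)]
  obtain ⟨S, hS⟩ := exists_finset_subset_iUnion_gridCell hη hb
  set Q : (Fin n → ℤ) → Set (Space n) := fun a => Ω ∩ gridCell η a with hQ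
  have hQm : ∀ a, MeasurableSet (Q a) := fun a => ho.inter (measurableSet_gridCell η a)
  have hQs : ∀ a, Q a ⊆ Ω := fun a => Set.inter_subset_left
  have hQb : ∀ a, Bornology.IsBounded (Q a) := fun a => hb.subset (hQs a)
  have hΩ : Ω = ⋃ a ∈ S, Q a := by
    rw [hQ, ← Set.inter_iUnion₂, Set.inter_eq_left.2 hS]
  have hdisj : (S : Set (Fin n → ℤ)).Pairwise (Function.onFun Disjoint Q) := by
    intro a _ b _ hab
    exact (disjoint_gridCell hη hab).mono Set.inter_subset_right Set.inter_subset_right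
  have hsum : ∀ f : Space n → ℝ, Continuous f → ∫ x in Ω, f x = ∑ a ∈ S, ∫ x in Q a, f x := by
    intro f hf
    conv_lhs => rw [hΩ]
    exact integral_biUnion_finset S (fun a _ => hQm a) hdisj
      (fun a _ => integrableOn_of_isBounded hf (hQb a))
  refine ⟨S, Q, ∑ a ∈ S, (volume.real (Q a))⁻¹,
    Finset.sum_nonneg fun a _ => inv_nonneg.2 measureReal_nonneg, hQm, hQs, fun φ hφ => ?_⟩
  have hd := hφ.continuous_fderiv one_ne_zero
  have hcφ := hφ.continuous
  rw [hsum _ (by fun_prop), hsum (fun x => ‖fderiv ℝ φ x‖ ^ 2) (by fun_prop), Finset.mul_sum,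
    Finset.mul_sum, ← Finset.sum_add_distrib]
  refine Finset.sum_le_sum fun a ha => ?_
  have hP := integral_sq_le_poincare hφ (hQm a) (hc.inter (convex_gridCell η a)) (hQb a)
    (δ := ((n + 1) * η).toNNReal) (fun x hx y hy => by
      rw [← NNReal.coe_le_coe, coe_nnnorm, Real.coe_toNNReal _ (by positivity)]
      exact norm_sub_le_of_mem_gridCell hη hx.2 hy.2)
  rw [Real.coe_toNNReal _ (by positivity)] at hP
  refine hP.trans (add_le_add ?_ ?_)
  · refine mul_le_mul_of_nonneg_right ?_ (sq_nonneg _)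
    exact Finset.single_le_sum (f := fun a => (volume.real (Q a))⁻¹)
      (fun a _ => inv_nonneg.2 measureReal_nonneg) ha
  · exact mul_le_mul_of_nonneg_right hηε (integral_nonneg fun x => sq_nonneg _)

theorem exists_poincare {n : ℕ} {Ω : Set (Space n)} (ho : MeasurableSet Ω)
    (hc : Convex ℝ Ω) (hb : Bornology.IsBounded Ω) :
    ∃ C : ℝ, 0 ≤ C ∧ ∀ φ : Space n → ℝ, ContDiff ℝ 1 φ →
      ∫ x in Ω, φ x ^ 2 ≤ (volume.real Ω)⁻¹ * (∫ x in Ω, φ x) ^ 2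
        + C * ∫ x in Ω, ‖fderiv ℝ φ x‖ ^ 2 := by
  obtain ⟨R, hR⟩ := hb.exists_norm_le
  refine ⟨((2 * R).toNNReal : ℝ) ^ 2 * 2 ^ n, by positivity, fun φ hφ => ?_⟩
  refine integral_sq_le_poincare hφ ho hc hb fun x hx y hy => ?_
  rw [← NNReal.coe_le_coe, coe_nnnorm]
  refine le_trans ?_ (Real.le_coe_toNNReal _)
  linarith [norm_sub_le y x, hR x hx, hR y hy]

/-! ### The closed space of triples and its functional inequalities. -/

theorem norm_sq_eq_integral_of_ae_eq {X E : Type*} [MeasurableSpace X] {μ : Measure X}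
    [NormedAddCommGroup E] [InnerProductSpace ℝ E] {f : Lp E 2 μ} {φ : X → E}
    (h : f =ᵐ[μ] φ) : ‖f‖ ^ 2 = ∫ x, ‖φ x‖ ^ 2 ∂μ := by
  rw [← real_inner_self_eq_norm_sq, L2.inner_def]
  refine integral_congr_ae ?_
  filter_upwards [h] with x hx
  rw [real_inner_self_eq_norm_sq, hx]

theorem norm_gradient {n : ℕ} (φ : Space n → ℝ) (x : Space n) :
    ‖gradient φ x‖ = ‖fderiv ℝ φ x‖ := by
  simp [gradient]

section

variable {n : ℕ} {Ω : Set (Space (n + 1))}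

theorem isFiniteMeasure_bulk (hb : Bornology.IsBounded Ω) : IsFiniteMeasure (bulk Ω) :=
  ⟨by simpa using hb.measure_lt_top⟩

theorem isFiniteMeasure_surface (ho : IsOpen Ω) (hc : Convex ℝ Ω) (hne : Ω.Nonempty)
    (hb : Bornology.IsBounded Ω) : IsFiniteMeasure (surface Ω) :=
  ⟨by simpa using euclideanHausdorffMeasure_frontier_lt_top ho hc hne hb⟩

theorem norm_sq_fst_of_smooth {p : L2Bulk Ω × L2Field Ω × L2Bdry Ω} {φ : Space (n + 1) → ℝ}
    (h : p.1 =ᵐ[bulk Ω] φ) : ‖p.1‖ ^ 2 = ∫ x in Ω, φ x ^ 2 := by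
  rw [norm_sq_eq_integral_of_ae_eq h]; simp

theorem norm_sq_grad_of_smooth {p : L2Bulk Ω × L2Field Ω × L2Bdry Ω} {φ : Space (n + 1) → ℝ}
    (h : p.2.1 =ᵐ[bulk Ω] gradient φ) : ‖p.2.1‖ ^ 2 = ∫ x in Ω, ‖fderiv ℝ φ x‖ ^ 2 := by
  rw [norm_sq_eq_integral_of_ae_eq h]; simp_rw [norm_gradient]

theorem exists_smoothTriple (ho : IsOpen Ω) (hc : Convex ℝ Ω) (hne : Ω.Nonempty)
    (hb : Bornology.IsBounded Ω) {φ : Space (n + 1) → ℝ} (hφ : ContDiff ℝ ∞ φ)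
    (hφc : HasCompactSupport φ) :
    ∃ p ∈ smoothTriples Ω, p.1 =ᵐ[bulk Ω] φ ∧ p.2.1 =ᵐ[bulk Ω] gradient φ ∧
      p.2.2 =ᵐ[surface Ω] φ := by
  have := isFiniteMeasure_bulk hb
  have := isFiniteMeasure_surface ho hc hne hb
  have h1 : MemLp φ 2 (bulk Ω) := hφ.continuous.memLp_of_hasCompactSupport hφc
  have h3 : MemLp φ 2 (surface Ω) := hφ.continuous.memLp_of_hasCompactSupport hφc
  have hg : Continuous (gradient φ) :=
    (InnerProductSpace.toDual ℝ (Space (n + 1))).symm.continuous.comp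
      (hφ.continuous_fderiv (by simp))
  have hgc : HasCompactSupport (gradient φ) :=
    (hφc.fderiv ℝ).comp_left (map_zero (InnerProductSpace.toDual ℝ (Space (n + 1))).symm)
  have h2 : MemLp (gradient φ) 2 (bulk Ω) := hg.memLp_of_hasCompactSupport hgc
  refine ⟨(h1.toLp φ, h2.toLp _, h3.toLp φ), ⟨φ, hφ, hφc, ?_⟩, ?_⟩
  all_goals exact ⟨h1.coeFn_toLp, h2.coeFn_toLp, h3.coeFn_toLp⟩

theorem mem_closure_induction {C : L2Bulk Ω × L2Field Ω × L2Bdry Ω → Prop}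
    (hC : IsClosed {p | C p}) (hS : ∀ p ∈ smoothTriples Ω, C p) :
    ∀ p ∈ (smoothTriples Ω).topologicalClosure, C p := by
  intro p hp
  have hsub : (smoothTriples Ω : Set (L2Bulk Ω × L2Field Ω × L2Bdry Ω)) ⊆ {p | C p} := hS
  exact closure_minimal hsub hC hp

theorem exists_trace_bound (ho : IsOpen Ω) (hc : Convex ℝ Ω) (hne : Ω.Nonempty)
    (hb : Bornology.IsBounded Ω) :
    ∃ M : ℝ≥0, ∀ τ ∈ Set.Ioc (0 : ℝ) 1, ∀ p ∈ (smoothTriples Ω).topologicalClosure,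
      ‖p.2.2‖ ^ 2 ≤ M * (τ⁻¹ * ‖p.1‖ ^ 2 + τ * ‖p.2.1‖ ^ 2) := by
  obtain ⟨M, hM⟩ := exists_trace_inequality ho hc hne hb
  refine ⟨M, fun τ hτ => mem_closure_induction (isClosed_le (by fun_prop) (by fun_prop)) ?_⟩
  rintro p ⟨φ, hφ, hφc, h1, h2, h3⟩
  have := isFiniteMeasure_surface ho hc hne hb
  have hφ1 : ContDiff ℝ 1 φ := hφ.of_le (by simp)
  have h := hM τ hτ φ hφ1
  have hτ0 := hτ.1
  rw [lintegral_enorm_sq_eq_ofReal hφ.continuous hb,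
    lintegral_enorm_sq_eq_ofReal (hφ1.continuous_fderiv one_ne_zero) hb,
    ← ENNReal.ofReal_mul (by positivity), ← ENNReal.ofReal_mul hτ0.le,
    ← ENNReal.ofReal_add (by positivity) (by positivity), ← ENNReal.ofReal_coe_nnreal,
    ← ENNReal.ofReal_mul (by positivity)] at h
  have e3 : ∫⁻ y in frontier Ω, ‖φ y‖ₑ ^ 2 ∂(Measure.euclideanHausdorffMeasure n)
      = ENNReal.ofReal (∫ y, ‖φ y‖ ^ 2 ∂(surface Ω)) := by
    rw [ofReal_integral_eq_lintegral_ofReal]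
    · refine lintegral_congr fun t => ?_
      rw [ENNReal.ofReal_pow (norm_nonneg _), ofReal_norm]
    · have h : MemLp φ 2 (surface Ω) := hφ.continuous.memLp_of_hasCompactSupport hφc
      exact h.integrable_norm_pow two_ne_zero
    · exact Filter.Eventually.of_forall fun t => sq_nonneg _
  rw [e3, ENNReal.ofReal_le_ofReal_iff (by positivity)] at h
  rw [norm_sq_eq_integral_of_ae_eq h3, norm_sq_eq_integral_of_ae_eq h1,
    norm_sq_grad_of_smooth h2]
  exact h

theorem inner_indicator_eq_setIntegral {Q : Set (Space (n + 1))} (hQ : MeasurableSet Q)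
    (hQΩ : Q ⊆ Ω) (hfin : bulk Ω Q ≠ ⊤) {u : L2Bulk Ω} {φ : Space (n + 1) → ℝ}
    (h : u =ᵐ[bulk Ω] φ) :
    inner ℝ (indicatorConstLp 2 hQ hfin (1 : ℝ)) u = ∫ x in Q, φ x := by
  rw [L2.inner_indicatorConstLp_one, Measure.restrict_restrict hQ, Set.inter_eq_left.2 hQΩ]
  exact integral_congr_ae (ae_mono (Measure.restrict_mono hQΩ le_rfl) h)

theorem exists_finite_averages_bound (ho : IsOpen Ω) (hc : Convex ℝ Ω)
    (hb : Bornology.IsBounded Ω) {ε : ℝ} (hε : 0 < ε) :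
    ∃ W : Set (L2Bulk Ω), W.Finite ∧ ∀ p ∈ (smoothTriples Ω).topologicalClosure,
      (∀ w ∈ W, inner ℝ w p.1 = 0) → ‖p.1‖ ^ 2 ≤ ε * ‖p.2.1‖ ^ 2 := by
  obtain ⟨S, Q, C, hC, hQm, hQs, hP⟩ := exists_finite_averages ho.measurableSet hc hb hε
  have := isFiniteMeasure_bulk hb
  let w : (Fin (n + 1) → ℤ) → L2Bulk Ω := fun a =>
    indicatorConstLp 2 (hQm a) (measure_ne_top (bulk Ω) _) (1 : ℝ)
  have key : ∀ p ∈ (smoothTriples Ω).topologicalClosure,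
      ‖p.1‖ ^ 2 ≤ C * (∑ a ∈ S, (inner ℝ (w a) p.1) ^ 2) + ε * ‖p.2.1‖ ^ 2 := by
    refine mem_closure_induction (isClosed_le (by fun_prop) (by fun_prop)) ?_
    rintro p ⟨φ, hφ, hφc, h1, h2, h3⟩
    have h := hP φ (hφ.of_le (by simp))
    rw [norm_sq_fst_of_smooth h1, norm_sq_grad_of_smooth h2]
    refine h.trans_eq ?_
    congr 2
    refine Finset.sum_congr rfl fun a _ => ?_
    rw [inner_indicator_eq_setIntegral (hQm a) (hQs a) _ h1]
  refine ⟨w '' S, S.finite_toSet.image w, fun p hp h0 => (key p hp).trans_eq ?_⟩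
  rw [Finset.sum_eq_zero fun a ha => by rw [h0 _ ⟨a, ha, rfl⟩]; simp]
  simp

/-- Constants are not compactly supported, so a bump function equal to 1 near the closure of Ω
stands in; it serves to subtract means. -/
theorem exists_one_triple (ho : IsOpen Ω) (hc : Convex ℝ Ω) (hne : Ω.Nonempty)
    (hb : Bornology.IsBounded Ω) :
    ∃ p ∈ smoothTriples Ω, p.1 =ᵐ[bulk Ω] (fun _ => (1 : ℝ)) ∧ p.2.1 = 0 ∧
      p.2.2 =ᵐ[surface Ω] (fun _ => (1 : ℝ)) := by
  obtain ⟨R, hR0, hR⟩ := hb.closure.exists_pos_norm_lt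
  let f : ContDiffBump (0 : Space (n + 1)) := ⟨R, R + 1, hR0, by linarith⟩
  have hone : ∀ x ∈ closure Ω, f =ᶠ[nhds x] fun _ => (1 : ℝ) := by
    intro x hx
    filter_upwards [Metric.isOpen_ball.mem_nhds (mem_ball_zero_iff.2 (hR x hx))] with y hy
    exact f.one_of_mem_closedBall (Metric.ball_subset_closedBall hy)
  obtain ⟨p, hp, h1, h2, h3⟩ := exists_smoothTriple ho hc hne hb (φ := f) f.contDiff
    f.hasCompactSupport
  refine ⟨p, hp, ?_, ?_, ?_⟩
  · filter_upwards [h1, ae_restrict_mem ho.measurableSet] with x hx hxΩ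
    rw [hx]; exact (hone x (subset_closure hxΩ)).eq_of_nhds
  · refine Lp.ext ?_
    filter_upwards [h2, ae_restrict_mem ho.measurableSet, Lp.coeFn_zero (Space (n + 1)) 2 (bulk Ω)]
      with x hx hxΩ h0
    rw [hx, h0]
    simp [gradient, (hone x (subset_closure hxΩ)).fderiv_eq]
  · filter_upwards [h3, ae_restrict_mem isClosed_frontier.measurableSet] with x hx hxΩ
    rw [hx]; exact (hone x (frontier_subset_closure hxΩ)).eq_of_nhds

/-- Integration by parts for smooth functions is an identity between L² pairings with fixed
functions, so it persists in the closure. The weak-gradient condition in `eigenspace` is thus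
automatic for triples with a trace. -/
theorem isWeakGradient_of_mem_closure
    {p : L2Bulk Ω × L2Field Ω × L2Bdry Ω} (hp : p ∈ (smoothTriples Ω).topologicalClosure) :
    IsWeakGradient Ω p.1 p.2.1 := by
  intro ψ hψ hψc hψs i
  have hd := continuous_test_deriv hψ (EuclideanSpace.single i 1)
  have hdc : HasCompactSupport (fun x => fderiv ℝ ψ x (EuclideanSpace.single i 1)) :=
    hψc.fderiv_apply ℝ _
  have m1 : MemLp (fun x => fderiv ℝ ψ x (EuclideanSpace.single i 1)) 2 (bulk Ω) :=
    hd.memLp_of_hasCompactSupport hdc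
  have m2 : MemLp (fun x => ψ x • (EuclideanSpace.single i 1 : Space (n + 1))) 2 (bulk Ω) :=
    (hψ.continuous.smul continuous_const).memLp_of_hasCompactSupport hψc.smul_right
  have e1 : ∀ u : L2Bulk Ω, ∫ x in Ω, u x * fderiv ℝ ψ x (EuclideanSpace.single i 1)
      = inner ℝ u (m1.toLp _) := by
    intro u
    rw [L2.inner_def]
    refine integral_congr_ae ?_
    filter_upwards [m1.coeFn_toLp] with x hx
    rw [hx]; simp [mul_comm]
  have e2 : ∀ G : L2Field Ω, ∫ x in Ω, G x i * ψ x = inner ℝ G (m2.toLp _) := by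
    intro G
    rw [L2.inner_def]
    refine integral_congr_ae ?_
    filter_upwards [m2.coeFn_toLp] with x hx
    rw [hx, real_inner_smul_right, real_inner_comm, EuclideanSpace.inner_single_left]
    simp [mul_comm]
  rw [e1, e2]
  refine mem_closure_induction (C := fun p => inner ℝ p.1 (m1.toLp _) = -inner ℝ p.2.1 (m2.toLp _))
    (isClosed_eq (by fun_prop) (by fun_prop)) ?_ p hp
  rintro p ⟨φ, hφ, hφc, h1, h2, h3⟩
  rw [← e1, ← e2]
  have i1 : ∫ x in Ω, p.1 x * fderiv ℝ ψ x (EuclideanSpace.single i 1)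
      = ∫ x, φ x * fderiv ℝ ψ x (EuclideanSpace.single i 1) := by
    refine Eq.trans ?_ (setIntegral_eq_integral_of_forall_compl_eq_zero (s := Ω) ?_)
    · refine integral_congr_ae ?_
      filter_upwards [h1] with x hx
      rw [hx]
    · intro x hx
      have : x ∉ tsupport (fderiv ℝ ψ) := fun h => hx (hψs (tsupport_fderiv_subset ℝ (f := ψ) h))
      rw [image_eq_zero_of_notMem_tsupport this]; simp
  have i2 : ∫ x in Ω, p.2.1 x i * ψ x
      = ∫ x, fderiv ℝ φ x (EuclideanSpace.single i 1) * ψ x := by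
    refine Eq.trans ?_ (setIntegral_eq_integral_of_forall_compl_eq_zero (s := Ω) ?_)
    · refine integral_congr_ae ?_
      filter_upwards [h2] with x hx
      rw [hx]
      congr 1
      have : (gradient φ x) i = inner ℝ (gradient φ x) (EuclideanSpace.single i 1) := by
        rw [real_inner_comm, EuclideanSpace.inner_single_left]; simp
      rw [this, gradient, InnerProductSpace.toDual_symm_apply]
    · intro x hx
      have : x ∉ tsupport ψ := fun h => hx (hψs h)
      rw [image_eq_zero_of_notMem_tsupport this]; simp
  rw [i1, i2]
  have hdφ := continuous_test_deriv hφ (EuclideanSpace.single i 1)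
  refine integral_mul_fderiv_eq_neg_fderiv_mul_of_integrable ?_ ?_ ?_
    (fun x _ => hφ.differentiable (by simp) x) (fun x _ => hψ.differentiable (by simp) x)
  · exact (hdφ.mul hψ.continuous).integrable_of_hasCompactSupport hψc.mul_left
  · exact (hφ.continuous.mul hd).integrable_of_hasCompactSupport hdc.mul_left
  · exact (hφ.continuous.mul hψ.continuous).integrable_of_hasCompactSupport hψc.mul_left

/-- The fundamental lemma of the calculus of variations, one coordinate at a time; it makes weak
gradients unique. -/
theorem eq_zero_of_isWeakGradient_zero (ho : IsOpen Ω) {G : L2Field Ω}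
    (h : IsWeakGradient Ω 0 G) : G = 0 := by
  have key : ∀ i, ∀ᵐ x, x ∈ Ω → G x i = 0 := by
    intro i
    refine ho.ae_eq_zero_of_integral_contDiff_smul_eq_zero ?_ ?_
    · have : MemLp (fun x => G x i) 2 (bulk Ω) :=
        (EuclideanSpace.proj i : Space (n + 1) →L[ℝ] ℝ).comp_memLp' (Lp.memLp G)
      intro x hx
      obtain ⟨r, hr, hball⟩ := Metric.isOpen_iff.1 ho x hx
      refine ⟨Metric.ball x r ∩ Ω, ?_, ?_⟩
      · exact Filter.inter_mem (mem_nhdsWithin_of_mem_nhds (Metric.ball_mem_nhds x hr))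
          self_mem_nhdsWithin
      · have h2 : MemLp (fun x => G x i) 2 (volume.restrict (Metric.ball x r)) :=
          this.mono_measure (Measure.restrict_mono hball le_rfl)
        have hf : IsFiniteMeasure (volume.restrict (Metric.ball x r)) :=
          ⟨by simpa using measure_ball_lt_top⟩
        exact IntegrableOn.mono_set (h2.integrable one_le_two) Set.inter_subset_left
    · intro g hg hgc hgs
      have := h g hg hgc hgs i
      have h0 : ∫ x in Ω, (0 : L2Bulk Ω) x * fderiv ℝ g x (EuclideanSpace.single i 1) = 0 := by
        rw [← integral_zero (Space (n + 1)) ℝ (μ := bulk Ω)]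
        refine integral_congr_ae ?_
        filter_upwards [Lp.coeFn_zero ℝ 2 (bulk Ω)] with x hx
        rw [hx, Pi.zero_apply, zero_mul]
      rw [h0, eq_comm, neg_eq_zero] at this
      rw [← this, ← setIntegral_eq_integral_of_forall_compl_eq_zero (s := Ω)]
      · simp [mul_comm]
      · intro x hx
        have : x ∉ tsupport g := fun h => hx (hgs h)
        rw [image_eq_zero_of_notMem_tsupport this]; simp
  refine Lp.ext ?_
  have hall : ∀ᵐ x ∂(bulk Ω), ∀ i, G x i = 0 := by
    rw [ae_all_iff]
    exact fun i => (ae_restrict_iff' ho.measurableSet).2 (key i)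
  filter_upwards [hall, Lp.coeFn_zero (Space (n + 1)) 2 (bulk Ω)] with x hx h0
  rw [h0]; ext i; simpa using hx i

end

section

variable {n : ℕ} {Ω : Set (Space (n + 1))}

/-- The Friedrichs inequality. -/
theorem exists_friedrichs_bound (ho : IsOpen Ω) (hc : Convex ℝ Ω) (hne : Ω.Nonempty)
    (hb : Bornology.IsBounded Ω) (hpos : surface Ω ≠ 0) :
    ∃ C : ℝ, 0 ≤ C ∧ ∀ p ∈ (smoothTriples Ω).topologicalClosure,
      ‖p.1‖ ≤ C * (‖p.2.1‖ + ‖p.2.2‖) := by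
  have := isFiniteMeasure_bulk hb
  have := isFiniteMeasure_surface ho hc hne hb
  obtain ⟨C₀, hC₀, hP⟩ := exists_poincare ho.measurableSet hc hb
  obtain ⟨M, hM⟩ := exists_trace_bound ho hc hne hb
  obtain ⟨e, he, he1, he2, he3⟩ := exists_one_triple ho hc hne hb
  have hvol : 0 < volume.real Ω :=
    ENNReal.toReal_pos (ho.measure_pos volume hne).ne' hb.measure_lt_top.ne
  have hP' : ∀ p ∈ (smoothTriples Ω).topologicalClosure,
      ‖p.1‖ ^ 2 ≤ (volume.real Ω)⁻¹ * (inner ℝ e.1 p.1) ^ 2 + C₀ * ‖p.2.1‖ ^ 2 := by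
    refine mem_closure_induction (isClosed_le (by fun_prop) (by fun_prop)) ?_
    rintro p ⟨φ, hφ, hφc, h1, h2, h3⟩
    rw [norm_sq_fst_of_smooth h1, norm_sq_grad_of_smooth h2]
    refine (hP φ (hφ.of_le (by simp))).trans_eq ?_
    congr 3
    rw [L2.inner_def]
    refine integral_congr_ae ?_
    filter_upwards [h1, he1] with x hx hx1
    rw [hx, hx1]; simp
  have hee : inner ℝ e.1 e.1 = volume.real Ω := by
    rw [real_inner_self_eq_norm_sq, norm_sq_eq_integral_of_ae_eq he1]
    simp
  have he3pos : 0 < ‖e.2.2‖ := by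
    rw [norm_pos_iff]
    intro h0
    have h1 : ‖e.2.2‖ ^ 2 = (surface Ω).real Set.univ := by
      rw [norm_sq_eq_integral_of_ae_eq he3]; simp
    rw [h0, norm_zero] at h1
    have h2 : (surface Ω).real Set.univ = 0 := by rw [← h1]; simp
    rw [measureReal_eq_zero_iff, Measure.measure_univ_eq_zero] at h2
    exact hpos h2
  set A := Real.sqrt C₀
  set B := Real.sqrt (M * (C₀ + 1))
  have hA : 0 ≤ A := Real.sqrt_nonneg _
  have hB : 0 ≤ B := Real.sqrt_nonneg _
  set t := ‖e.1‖ / ‖e.2.2‖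
  have ht : 0 ≤ t := by positivity
  refine ⟨A + t * (1 + B), by positivity, fun p hp => ?_⟩
  -- m is the mean of the function. After subtracting it, Poincaré and the trace inequality control
  -- both the function and its trace by the gradient; the trace of the constant m is then the given
  -- trace minus a controlled one, which bounds m.
  set m := inner ℝ e.1 p.1 / volume.real Ω
  have hq := Submodule.sub_mem _ hp
    (Submodule.smul_mem _ m ((smoothTriples Ω).le_topologicalClosure he))
  set q := p - m • e with hqdef
  have hq1 : q.1 = p.1 - m • e.1 := rfl
  have hq2 : q.2.1 = p.2.1 := by
    show p.2.1 - m • e.2.1 = p.2.1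
    rw [he2]; simp
  have hq3 : q.2.2 = p.2.2 - m • e.2.2 := rfl
  have hmean : inner ℝ e.1 q.1 = 0 := by
    rw [hq1, inner_sub_right, real_inner_smul_right, hee]
    simp only [m]; field_simp; simp
  have h1 := hP' q hq
  rw [hmean, hq2] at h1
  have h2 := hM 1 (by simp) q hq
  rw [hq2] at h2
  have h3 : ‖q.1‖ ≤ A * ‖p.2.1‖ := by
    refine le_of_sq_le_sq ?_ (by positivity)
    rw [mul_pow, Real.sq_sqrt hC₀]; simpa using h1
  have h4 : ‖q.2.2‖ ≤ B * ‖p.2.1‖ := by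
    refine le_of_sq_le_sq ?_ (by positivity)
    rw [mul_pow, Real.sq_sqrt (by positivity)]
    refine h2.trans ?_
    rw [mul_assoc]
    gcongr
    simp only [inv_one, one_mul]
    nlinarith
  have h5 : |m| * ‖e.2.2‖ ≤ ‖p.2.2‖ + B * ‖p.2.1‖ := by
    have : m • e.2.2 = p.2.2 - q.2.2 := by rw [hq3]; abel
    calc |m| * ‖e.2.2‖ = ‖m • e.2.2‖ := by rw [norm_smul, Real.norm_eq_abs]
      _ ≤ ‖p.2.2‖ + ‖q.2.2‖ := by rw [this]; exact norm_sub_le _ _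
      _ ≤ _ := by gcongr
  have h6 : ‖p.1‖ ≤ ‖q.1‖ + |m| * ‖e.1‖ := by
    have : p.1 = q.1 + m • e.1 := by rw [hq1]; abel
    calc ‖p.1‖ = ‖q.1 + m • e.1‖ := by rw [← this]
      _ ≤ ‖q.1‖ + ‖m • e.1‖ := norm_add_le _ _
      _ = _ := by rw [norm_smul, Real.norm_eq_abs]
  have h7 : |m| * ‖e.1‖ = t * (|m| * ‖e.2.2‖) := by
    simp only [t]; field_simp
  have h8 : t * (|m| * ‖e.2.2‖) ≤ t * (‖p.2.2‖ + B * ‖p.2.1‖) := by gcongr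
  have h9 := norm_nonneg p.2.1
  have h10 := norm_nonneg p.2.2
  have : (A + t * (1 + B)) * (‖p.2.1‖ + ‖p.2.2‖)
      = A * ‖p.2.1‖ + t * (‖p.2.2‖ + B * ‖p.2.1‖) + (A * ‖p.2.2‖ + t * ‖p.2.1‖ + t * B * ‖p.2.2‖) := by
    ring
  rw [this]
  have : 0 ≤ A * ‖p.2.2‖ + t * ‖p.2.1‖ + t * B * ‖p.2.2‖ := by positivity
  linarith

/-- The gradient vanishes by uniqueness, then the trace by the trace inequality. Injectivity ensures
that dimensions of spaces of triples are not lost on passing to L²(Ω), where `eigenspaceUpTo` lives.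
-/
theorem eq_zero_of_fst_eq_zero (ho : IsOpen Ω) (hc : Convex ℝ Ω) (hne : Ω.Nonempty)
    (hb : Bornology.IsBounded Ω) {p : (smoothTriples Ω).topologicalClosure} (h : p.1.1 = 0) :
    p = 0 := by
  have hw := isWeakGradient_of_mem_closure p.2
  rw [h] at hw
  have hG := eq_zero_of_isWeakGradient_zero ho hw
  obtain ⟨M, hM⟩ := exists_trace_bound ho hc hne hb
  have hg := hM 1 (by simp) p.1 p.2
  rw [h, hG] at hg
  have hg0 : p.1.2.2 = 0 := by
    rw [← norm_eq_zero]
    have : ‖p.1.2.2‖ ^ 2 ≤ 0 := by simpa using hg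
    exact pow_eq_zero_iff two_ne_zero |>.1 (le_antisymm this (sq_nonneg _))
  exact Subtype.ext (Prod.ext h (Prod.ext hG hg0))

/-- The variational upper bound for Steklov eigenvalues: `k + 1` functions that are orthogonal for
both quadratic forms and whose Rayleigh quotients are at most `s`. -/
theorem eigenvalue_le_of_orthogonal_family (ho : IsOpen Ω) (hc : Convex ℝ Ω) (hne : Ω.Nonempty)
    (hb : Bornology.IsBounded Ω) {k : ℕ} {s : ℝ≥0}
    (p : Fin (k + 1) → L2Bulk Ω × L2Field Ω × L2Bdry Ω)
    (hp : ∀ j, p j ∈ (smoothTriples Ω).topologicalClosure)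
    (hG : ∀ i j, i ≠ j → inner ℝ (p i).2.1 (p j).2.1 = 0)
    (hg : ∀ i j, i ≠ j → inner ℝ (p i).2.2 (p j).2.2 = 0)
    (hs : ∀ j, ‖(p j).2.1‖ ^ 2 ≤ s * ‖(p j).2.2‖ ^ 2) (hne0 : ∀ j, (p j).2.2 ≠ 0) :
    eigenvalue Ω k ≤ s := by
  classical
  have hpos : surface Ω ≠ 0 := by
    intro h0
    refine hne0 0 (Lp.ext ?_)
    show {x | (p 0).2.2 x = (0 : L2Bdry Ω) x} ∈ ae (surface Ω)
    rw [ae_eq_bot.2 h0]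
    trivial
  obtain ⟨C, hC, hF⟩ := exists_friedrichs_bound ho hc hne hb hpos
  obtain ⟨M, hM⟩ := exists_trace_bound ho hc hne hb
  have hXc : CompleteSpace (smoothTriples Ω).topologicalClosure :=
    (smoothTriples Ω).isClosed_topologicalClosure.completeSpace_coe
  -- The spectral count needs a gap s < s'; since `eigenvalue` is an infimum, s' = s + δ for all δ >
  -- 0 is enough.
  refine ENNReal.le_of_forall_pos_le_add fun δ hδ _ => ?_
  rw [← ENNReal.coe_add]
  refine iInf₂_le (s + δ) ?_
  let ι := (smoothTriples Ω).topologicalClosure.subtypeL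
  let πG : L2Bulk Ω × L2Field Ω × L2Bdry Ω →L[ℝ] L2Field Ω :=
    ContinuousLinearMap.fst ℝ _ _ ∘L ContinuousLinearMap.snd ℝ _ _
  let πg : L2Bulk Ω × L2Field Ω × L2Bdry Ω →L[ℝ] L2Bdry Ω :=
    ContinuousLinearMap.snd ℝ _ _ ∘L ContinuousLinearMap.snd ℝ _ _
  refine le_rank_of_generalized_rayleigh_le (C := C + 1)
    (ContinuousLinearMap.fst ℝ (L2Bulk Ω) (L2Field Ω × L2Bdry Ω) ∘L ι) (πG ∘L ι) (πg ∘L ι)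
    ?_ (by positivity) ?_ ?_ (lt_add_of_pos_right s hδ)
    (fun j => ⟨p j, hp j⟩) hG hg hs hne0 _ ?_
  · rw [injective_iff_map_eq_zero]
    exact fun y hy => eq_zero_of_fst_eq_zero ho hc hne hb hy
  · intro x
    show ‖x.1‖ ≤ (C + 1) * (‖x.1.2.1‖ + ‖x.1.2.2‖)
    have h3 := hF x.1 x.2
    have h1 := norm_nonneg x.1.2.1
    have h2 := norm_nonneg x.1.2.2
    have h4 : 0 ≤ C * (‖x.1.2.1‖ + ‖x.1.2.2‖) := by positivity
    rw [Prod.norm_def, Prod.norm_def]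
    refine max_le ?_ (max_le ?_ ?_) <;> linarith
  · intro ε hε
    -- Chosen so that 2τM ≤ ε². Orthogonality to finitely many averages with tolerance τ² makes
    -- τ⁻¹‖u‖² at most τ‖∇u‖², so both terms of the trace bound are small.
    set τ : ℝ := min 1 (ε ^ 2 / (2 * (M + 1)))
    have hτ0 : 0 < τ := lt_min one_pos (by positivity)
    have hτ1 : τ ≤ 1 := min_le_left _ _
    have hτ2 : τ ≤ ε ^ 2 / (2 * (M + 1)) := min_le_right _ _
    obtain ⟨W, hW, hWX⟩ := exists_finite_averages_bound ho hc hb (sq_pos_of_pos hτ0)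
    refine ⟨W, hW, fun y hy => ?_⟩
    show ‖y.1.2.2‖ ≤ ε * ‖y.1.2.1‖
    have h1 : ‖y.1.1‖ ^ 2 ≤ τ ^ 2 * ‖y.1.2.1‖ ^ 2 := hWX _ y.2 hy
    have h2 := hM τ ⟨hτ0, hτ1⟩ _ y.2
    refine le_of_sq_le_sq ?_ (by positivity)
    have h4 : τ⁻¹ * ‖y.1.1‖ ^ 2 ≤ τ * ‖y.1.2.1‖ ^ 2 := by
      calc _ ≤ τ⁻¹ * (τ ^ 2 * ‖y.1.2.1‖ ^ 2) := by gcongr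
        _ = _ := by field_simp
    have h5 : (M : ℝ) * (2 * τ) ≤ ε ^ 2 := by
      calc (M : ℝ) * (2 * τ) ≤ (M + 1) * (2 * (ε ^ 2 / (2 * (M + 1)))) := by
            gcongr; linarith
        _ = ε ^ 2 := by field_simp
    calc _ ≤ M * (τ⁻¹ * ‖y.1.1‖ ^ 2 + τ * ‖y.1.2.1‖ ^ 2) := h2
      _ ≤ M * (τ * ‖y.1.2.1‖ ^ 2 + τ * ‖y.1.2.1‖ ^ 2) := by gcongr
      _ = M * (2 * τ) * ‖y.1.2.1‖ ^ 2 := by ring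
      _ ≤ ε ^ 2 * ‖y.1.2.1‖ ^ 2 := by gcongr
      _ = _ := by ring
  · intro σ hσ x hx
    refine (le_iSup₂ (f := fun (σ : ℝ≥0) (_ : σ ≤ s + δ) => eigenspace Ω σ) σ hσ) ?_
    exact ⟨x.1.2.1, x.1.2.2, isWeakGradient_of_mem_closure x.2, x.2,
      fun w H h _ ht => hx ⟨(w, H, h), ht⟩⟩

end

/-! ### Sections, projections and the Loomis–Whitney inequality. -/

/-- The section of a set at height `t` of the first coordinate. -/
def slice {n : ℕ} (K : Set (Space (n + 1))) (t : ℝ) : Set (Space n) :=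
  {z | insertCoord 0 t z ∈ K}

theorem continuous_insertCoord_right {n : ℕ} (i : Fin (n + 1)) (t : ℝ) :
    Continuous (fun z : Space n => insertCoord i t z) :=
  (continuous_insertCoord i).comp (continuous_const.prodMk continuous_id)

theorem isOpen_slice {n : ℕ} {K : Set (Space (n + 1))} (hK : IsOpen K) (t : ℝ) :
    IsOpen (slice K t) :=
  hK.preimage (continuous_insertCoord_right 0 t)

theorem isOpen_dropCoord_image {n : ℕ} (i : Fin (n + 1)) {K : Set (Space (n + 1))}
    (hK : IsOpen K) : IsOpen (dropCoord i '' K) := by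
  have : dropCoord i '' K = ⋃ t : ℝ, (fun z => insertCoord i t z) ⁻¹' K := by
    ext z
    simp only [Set.mem_image, Set.mem_iUnion, Set.mem_preimage]
    constructor
    · rintro ⟨x, hx, rfl⟩
      exact ⟨x i, by rwa [insertCoord_dropCoord]⟩
    · rintro ⟨t, ht⟩
      exact ⟨_, ht, dropCoord_insertCoord i t z⟩
  rw [this]
  exact isOpen_iUnion fun t => hK.preimage (continuous_insertCoord_right i t)

theorem dropCoord_succ_insertCoord_zero {n : ℕ} (i : Fin (n + 1)) (t : ℝ) (z : Space (n + 1)) :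
    dropCoord i.succ (insertCoord 0 t z) = insertCoord 0 t (dropCoord i z) := by
  ext j
  refine Fin.cases ?_ (fun j => ?_) j <;> simp [insertCoord]

theorem slice_dropCoord_image {n : ℕ} (i : Fin (n + 1)) (K : Set (Space (n + 2))) (t : ℝ) :
    slice (dropCoord i.succ '' K) t = dropCoord i '' slice K t := by
  ext z
  constructor
  · rintro ⟨x, hx, hxz⟩
    have h0 : x 0 = t := by
      have := congrArg (fun y : Space (n + 1) => y 0) hxz
      simpa using this
    refine ⟨dropCoord 0 x, ?_, ?_⟩
    · show insertCoord 0 t (dropCoord 0 x) ∈ K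
      rwa [← h0, insertCoord_dropCoord]
    · have := congrArg (dropCoord 0) hxz
      rw [dropCoord_insertCoord] at this
      rw [← this, ← insertCoord_dropCoord 0 x, dropCoord_succ_insertCoord_zero,
        dropCoord_insertCoord, dropCoord_insertCoord]
  · rintro ⟨y, hy, rfl⟩
    exact ⟨insertCoord 0 t y, hy, dropCoord_succ_insertCoord_zero i t y⟩

theorem measurable_volume_slice {n : ℕ} {K : Set (Space (n + 1))} (hK : MeasurableSet K) :
    Measurable fun t => volume (slice K t) := by
  have : MeasurableSet ((fun p : ℝ × Space n => insertCoord 0 p.1 p.2) ⁻¹' K) :=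
    (continuous_insertCoord 0).measurable hK
  exact measurable_measure_prodMk_left this

theorem setLIntegral_coord_zero {n : ℕ} {K : Set (Space (n + 1))} (hK : MeasurableSet K)
    {f : ℝ → ℝ≥0∞} (hf : Measurable f) :
    ∫⁻ x in K, f (x 0) = ∫⁻ t, f t * volume (slice K t) := by
  have hfm : Measurable fun x : Space (n + 1) => f (x 0) :=
    hf.comp (Continuous.measurable (by fun_prop))
  rw [← lintegral_indicator hK, lintegral_eq_lintegral_insertCoord' 0 (hfm.indicator hK)]
  refine lintegral_congr fun t => ?_
  have hs : MeasurableSet (slice K t) := (continuous_insertCoord_right 0 t).measurable hK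
  rw [← setLIntegral_const, ← lintegral_indicator hs]
  refine lintegral_congr fun z => ?_
  by_cases hz : insertCoord 0 t z ∈ K
  · rw [Set.indicator_of_mem hz, Set.indicator_of_mem (show z ∈ slice K t from hz)]
    simp
  · rw [Set.indicator_of_notMem hz, Set.indicator_of_notMem (show z ∉ slice K t from hz)]

theorem volume_eq_lintegral_slice {n : ℕ} {K : Set (Space (n + 1))} (hK : MeasurableSet K) :
    volume K = ∫⁻ t, volume (slice K t) := by
  have := setLIntegral_coord_zero hK (f := fun _ => 1) measurable_const
  simpa using this

/-- The Loomis–Whitney inequality for open sets. -/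
theorem volume_pow_le_prod_volume_dropCoord_image {n : ℕ} {K : Set (Space (n + 1))}
    (hK : IsOpen K) (hne : K.Nonempty) :
    volume K ^ n ≤ ∏ i, volume (dropCoord i '' K) := by
  induction n with
  | zero =>
    obtain ⟨x, hx⟩ := hne
    have h1 : dropCoord 0 '' K = Set.univ :=
      Set.eq_univ_of_forall fun z => ⟨x, hx, Subsingleton.elim _ _⟩
    rw [pow_zero, Fin.prod_univ_one, h1, volume_euclideanSpace_eq_dirac]
    simp
  | succ n ih =>
    have hn : (0 : ℝ) < (n : ℝ) + 1 := by positivity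
    set P := volume (dropCoord 0 '' K)
    -- A section satisfies two bounds: it lies in the projection along the first axis, and its n-th
    -- power obeys the induction hypothesis. Their product bounds the power n + 1.
    have hpt : ∀ t, volume (slice K t) ≤ P ^ (1 / ((n : ℝ) + 1)) *
        ∏ i : Fin (n + 1), volume (dropCoord i '' slice K t) ^ (1 / ((n : ℝ) + 1)) := by
      intro t
      rcases (slice K t).eq_empty_or_nonempty with h | h
      · rw [h, measure_empty]; exact zero_le
      have h1 : volume (slice K t) ≤ P := by
        refine measure_mono fun z hz => ⟨_, hz, dropCoord_insertCoord 0 t z⟩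
      have h2 := ih (isOpen_slice hK t) h
      rw [ENNReal.prod_rpow_of_nonneg (by positivity), ← ENNReal.mul_rpow_of_nonneg _ _ (by positivity)]
      have h3 : volume (slice K t) ^ ((n : ℝ) + 1) ≤
          P * ∏ i : Fin (n + 1), volume (dropCoord i '' slice K t) := by
        rw [show (n : ℝ) + 1 = ((n + 1 : ℕ) : ℝ) by push_cast; ring, ENNReal.rpow_natCast, pow_succ,
          mul_comm]
        exact mul_le_mul' h1 h2
      calc volume (slice K t) = (volume (slice K t) ^ ((n : ℝ) + 1)) ^ (1 / ((n : ℝ) + 1)) := by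
            rw [← ENNReal.rpow_mul, mul_one_div_cancel hn.ne', ENNReal.rpow_one]
        _ ≤ _ := ENNReal.rpow_le_rpow h3 (by positivity)
    have hm : ∀ i : Fin (n + 1), Measurable fun t => volume (dropCoord i '' slice K t) := by
      intro i
      simp_rw [← slice_dropCoord_image]
      exact measurable_volume_slice (isOpen_dropCoord_image _ hK).measurableSet
    have hint : volume K ≤ ∏ i : Fin (n + 2), volume (dropCoord i '' K) ^ (1 / ((n : ℝ) + 1)) := by
      calc volume K = ∫⁻ t, volume (slice K t) := volume_eq_lintegral_slice hK.measurableSet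
        _ ≤ ∫⁻ t, P ^ (1 / ((n : ℝ) + 1)) *
            ∏ i : Fin (n + 1), volume (dropCoord i '' slice K t) ^ (1 / ((n : ℝ) + 1)) :=
          lintegral_mono hpt
        _ = P ^ (1 / ((n : ℝ) + 1)) *
            ∫⁻ t, ∏ i : Fin (n + 1), volume (dropCoord i '' slice K t) ^ (1 / ((n : ℝ) + 1)) := by
          rw [lintegral_const_mul]
          exact Finset.measurable_fun_prod _ fun i _ => (hm i).pow_const _
        _ ≤ P ^ (1 / ((n : ℝ) + 1)) *
            ∏ i : Fin (n + 1), (∫⁻ t, volume (dropCoord i '' slice K t)) ^ (1 / ((n : ℝ) + 1)) := by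
          -- Hölder with n + 1 equal exponents 1/(n + 1).
          refine mul_le_mul' le_rfl ?_
          refine ENNReal.lintegral_prod_norm_pow_le Finset.univ (fun i _ => (hm i).aemeasurable) ?_
            (fun i _ => by positivity)
          simp; field_simp
        _ = _ := by
          rw [Fin.prod_univ_succ (n := n + 1)]
          congr 1
          refine Finset.prod_congr rfl fun i _ => ?_
          rw [volume_eq_lintegral_slice (isOpen_dropCoord_image i.succ hK).measurableSet]
          simp_rw [slice_dropCoord_image]
    calc volume K ^ (n + 1) ≤ (∏ i : Fin (n + 2),
          volume (dropCoord i '' K) ^ (1 / ((n : ℝ) + 1))) ^ (n + 1) := by gcongr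
      _ = _ := by
        rw [← Finset.prod_pow]
        refine Finset.prod_congr rfl fun i _ => ?_
        rw [← ENNReal.rpow_natCast, ← ENNReal.rpow_mul]
        push_cast
        rw [one_div_mul_cancel hn.ne', ENNReal.rpow_one]

theorem isBounded_dropCoord_image {n : ℕ} (i : Fin (n + 1)) {K : Set (Space (n + 1))}
    (hb : Bornology.IsBounded K) : Bornology.IsBounded (dropCoord i '' K) :=
  (lipschitzWith_dropCoord i).isBounded_image hb

theorem isBounded_slice {n : ℕ} {K : Set (Space (n + 1))} (hb : Bornology.IsBounded K) (t : ℝ) :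
    Bornology.IsBounded (slice K t) :=
  (isBounded_dropCoord_image 0 hb).subset fun z hz => ⟨_, hz, dropCoord_insertCoord 0 t z⟩

/-- The Loomis–Whitney inequality, in the form given by the inequality of arithmetic and geometric
means. For `K = ∅` both sides vanish. -/
theorem volume_div_rpow_le_sum_dropCoord_image {m : ℕ} {K : Set (Space (m + 1))} (hK : IsOpen K)
    (hb : Bornology.IsBounded K) :
    ((m : ℝ≥0∞) + 1) * ENNReal.ofReal (volume.real K / volume.real K ^ (1 / ((m : ℝ) + 1)))
      ≤ ∑ i, volume (dropCoord i '' K) := by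
  rcases K.eq_empty_or_nonempty with rfl | hne
  · simp
  have hm : (0 : ℝ) < (m : ℝ) + 1 := by positivity
  have hfin : ∀ i, volume (dropCoord i '' K) ≠ ⊤ := fun i =>
    (isBounded_dropCoord_image i hb).measure_lt_top.ne
  have hv : 0 < volume.real K :=
    ENNReal.toReal_pos (hK.measure_pos _ hne).ne' hb.measure_lt_top.ne
  have hlw : volume.real K ^ m ≤ ∏ i, volume.real (dropCoord i '' K) := by
    have := ENNReal.toReal_mono (ENNReal.prod_ne_top fun i _ => hfin i)
      (volume_pow_le_prod_volume_dropCoord_image hK hne)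
    rwa [ENNReal.toReal_pow, ENNReal.toReal_prod] at this
  have hamgm := Real.geom_mean_le_arith_mean_weighted Finset.univ
    (fun _ : Fin (m + 1) => 1 / ((m : ℝ) + 1)) (fun i => volume.real (dropCoord i '' K))
    (fun _ _ => by positivity) (by simp; field_simp) (fun _ _ => measureReal_nonneg)
  rw [Real.finsetProd_rpow _ _ (fun _ _ => measureReal_nonneg), ← Finset.mul_sum] at hamgm
  have h1 : volume.real K / volume.real K ^ (1 / ((m : ℝ) + 1))
      = (volume.real K ^ m) ^ (1 / ((m : ℝ) + 1)) := by
    rw [← Real.rpow_natCast, ← Real.rpow_mul hv.le]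
    nth_rewrite 1 [← Real.rpow_one (volume.real K)]
    rw [← Real.rpow_sub hv]
    congr 1
    field_simp
    ring
  have h2 : ((m : ℝ) + 1) * (volume.real K / volume.real K ^ (1 / ((m : ℝ) + 1)))
      ≤ ∑ i, volume.real (dropCoord i '' K) := by
    rw [h1]
    have := (Real.rpow_le_rpow (by positivity) hlw (by positivity)).trans hamgm
    calc _ ≤ ((m : ℝ) + 1) * (1 / ((m : ℝ) + 1) * ∑ i, volume.real (dropCoord i '' K)) := by
          gcongr
      _ = _ := by field_simp
  have h3 : ((m : ℝ≥0∞) + 1) = ENNReal.ofReal ((m : ℝ) + 1) := by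
    rw [ENNReal.ofReal_add (by positivity) zero_le_one]; simp
  rw [h3, ← ENNReal.ofReal_mul hm.le]
  refine (ENNReal.ofReal_le_ofReal h2).trans_eq ?_
  rw [ENNReal.ofReal_sum_of_nonneg fun _ _ => measureReal_nonneg]
  exact Finset.sum_congr rfl fun i _ => ENNReal.ofReal_toReal (hfin i)

/-! ### Boundary integrals from below by projections. -/

/-- The first exit time of the ray from x serves as t. -/
theorem exists_pos_add_smul_mem_frontier {n : ℕ} {Ω : Set (Space n)} (ho : IsOpen Ω)
    (hb : Bornology.IsBounded Ω) {x v : Space n} (hx : x ∈ Ω) (hv : v ≠ 0) :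
    ∃ t : ℝ, 0 < t ∧ x + t • v ∈ frontier Ω := by
  have hc : Continuous fun t : ℝ => x + t • v := by fun_prop
  set S : Set ℝ := {t | 0 ≤ t ∧ x + t • v ∉ Ω}
  have hS : IsClosed S := isClosed_Ici.inter (ho.isClosed_compl.preimage hc)
  have hSne : S.Nonempty := by
    obtain ⟨R, hR⟩ := hb.exists_norm_le
    have hvpos : 0 < ‖v‖ := norm_pos_iff.2 hv
    have hR0 : 0 ≤ R := (norm_nonneg x).trans (hR x hx)
    refine ⟨(2 * R + 1) / ‖v‖, by positivity, fun h => ?_⟩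
    have h1 := hR _ h
    have h2 : ‖((2 * R + 1) / ‖v‖) • v‖ = 2 * R + 1 := by
      rw [norm_smul, Real.norm_of_nonneg (by positivity)]; field_simp
    have h3 : ‖((2 * R + 1) / ‖v‖) • v‖ ≤ ‖x + ((2 * R + 1) / ‖v‖) • v‖ + ‖x‖ := by
      have := norm_sub_le (x + ((2 * R + 1) / ‖v‖) • v) x
      rwa [add_sub_cancel_left] at this
    linarith [hR x hx]
  have hbdd : BddBelow S := ⟨0, fun t ht => ht.1⟩
  have hmem := hS.csInf_mem hSne hbdd
  set t := sInf S
  have ht0 : 0 < t := by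
    refine lt_of_le_of_ne hmem.1 fun h => hmem.2 ?_
    rw [← h]; simpa using hx
  refine ⟨t, ht0, ?_⟩
  rw [ho.frontier_eq]
  refine ⟨?_, hmem.2⟩
  have h1 : t ∈ closure (Set.Ico 0 t) := by
    rw [closure_Ico ht0.ne]; exact ⟨ht0.le, le_rfl⟩
  refine map_mem_closure (f := fun t : ℝ => x + t • v) hc h1 fun s hs => ?_
  by_contra h
  exact absurd (csInf_le hbdd (⟨hs.1, h⟩ : s ∈ S)) (not_le.2 hs.2)

/-- A line parallel to the i-th axis that meets Ω has a boundary point at each end of its chord, one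
with Ω ahead and one with Ω behind. By convexity these two parts of ∂Ω are disjoint; each projects
onto the shadow of Ω, and projection does not increase surface measure. -/
theorem two_mul_lintegral_dropCoord_image_le {n : ℕ} (i : Fin (n + 1)) {Ω : Set (Space (n + 1))}
    (ho : IsOpen Ω) (hc : Convex ℝ Ω) (hb : Bornology.IsBounded Ω) {g : Space n → ℝ≥0∞}
    (hg : Measurable g) :
    2 * ∫⁻ z in dropCoord i '' Ω, g z
      ≤ ∫⁻ y in frontier Ω, g (dropCoord i y) ∂(Measure.euclideanHausdorffMeasure n) := by
  set v : Space (n + 1) := EuclideanSpace.single i 1 with hv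
  have hv0 : v ≠ 0 := by simp [hv]
  have hdv : ∀ (x : Space (n + 1)) (t : ℝ), dropCoord i (x + t • v) = dropCoord i x := by
    intro x t; ext j; simp [hv]
  -- S c consists of the boundary points from which Ω can be reached in the direction c • v; only
  -- the signs c = ±1 are used in the end.
  let S : ℝ → Set (Space (n + 1)) := fun c => frontier Ω ∩ ⋃ s ∈ Set.Ioi (0 : ℝ),
    (fun y : Space (n + 1) => y + s • (c • v)) ⁻¹' Ω
  have hSm : ∀ c, MeasurableSet (S c) := fun c =>
    isClosed_frontier.measurableSet.inter (isOpen_biUnion fun s _ =>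
      ho.preimage (by fun_prop)).measurableSet
  have hdisj : Disjoint (S 1) (S (-1)) := by
    rw [Set.disjoint_left]
    rintro y ⟨hy, h1⟩ ⟨_, h2⟩
    simp only [Set.mem_iUnion, Set.mem_Ioi, Set.mem_preimage, exists_prop] at h1 h2
    obtain ⟨s, hs, h1⟩ := h1
    obtain ⟨t, ht, h2⟩ := h2
    rw [ho.frontier_eq] at hy
    refine hy.2 ?_
    have := hc h1 h2 (a := t / (s + t)) (b := s / (s + t)) (by positivity) (by positivity)
      (by field_simp; ring)
    convert this using 1
    have e1 : t / (s + t) + s / (s + t) = 1 := by field_simp; ring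
    have e2 : t / (s + t) * s - s / (s + t) * t = 0 := by field_simp; ring
    calc y = (t / (s + t) + s / (s + t)) • y + (t / (s + t) * s - s / (s + t) * t) • v := by
          rw [e1, e2]; simp
      _ = _ := by module
  have hproj : ∀ c : ℝ, c ≠ 0 → dropCoord i '' Ω ⊆ dropCoord i '' S c := by
    rintro c hc0 _ ⟨x, hx, rfl⟩
    obtain ⟨t, ht, hf⟩ := exists_pos_add_smul_mem_frontier ho hb hx
      (v := -(c • v)) (neg_ne_zero.2 (smul_ne_zero hc0 hv0))
    refine ⟨_, ⟨hf, ?_⟩, ?_⟩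
    · simp only [Set.mem_iUnion, Set.mem_Ioi, Set.mem_preimage, exists_prop]
      refine ⟨t, ht, ?_⟩
      convert hx using 1
      module
    · rw [smul_neg, smul_smul, ← neg_smul, hdv]
  have hmeas : ∀ c : ℝ, c ≠ 0 → (volume : Measure (Space n)).restrict (dropCoord i '' Ω)
      ≤ ((Measure.euclideanHausdorffMeasure n).restrict (S c)).map (dropCoord i) := by
    intro c hc0
    refine Measure.le_iff.2 fun T hT => ?_
    have hPm : Measurable (dropCoord (n := n) i) := (continuous_dropCoord i).measurable
    rw [Measure.restrict_apply hT, Measure.map_apply hPm hT, Measure.restrict_apply (hPm hT)]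
    refine le_trans (measure_mono ?_)
      (volume_image_le_euclideanHausdorffMeasure (lipschitzWith_dropCoord i) _)
    rintro z ⟨hzT, hz⟩
    obtain ⟨y, hy, rfl⟩ := hproj c hc0 hz
    exact ⟨y, ⟨hzT, hy⟩, rfl⟩
  have hle : ∀ c : ℝ, c ≠ 0 → ∫⁻ z in dropCoord i '' Ω, g z
      ≤ ∫⁻ y in S c, g (dropCoord i y) ∂(Measure.euclideanHausdorffMeasure n) := by
    intro c hc0
    rw [← lintegral_map hg (continuous_dropCoord i).measurable]
    exact lintegral_mono' (hmeas c hc0) le_rfl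
  calc 2 * ∫⁻ z in dropCoord i '' Ω, g z
      ≤ (∫⁻ y in S 1, g (dropCoord i y) ∂(Measure.euclideanHausdorffMeasure n))
        + ∫⁻ y in S (-1), g (dropCoord i y) ∂(Measure.euclideanHausdorffMeasure n) := by
        rw [two_mul]; exact add_le_add (hle 1 one_ne_zero) (hle (-1) (by simp))
    _ = ∫⁻ y in S 1 ∪ S (-1), g (dropCoord i y) ∂(Measure.euclideanHausdorffMeasure n) :=
        (lintegral_union (hSm _) hdisj).symm
    _ ≤ _ := lintegral_mono_set (Set.union_subset Set.inter_subset_left Set.inter_subset_left)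

/-- Lower bound for boundary integrals of functions of the first coordinate. -/
theorem two_mul_lintegral_slice_le_frontier {m : ℕ} {Ω : Set (Space (m + 2))}
    (ho : IsOpen Ω) (hc : Convex ℝ Ω) (hb : Bornology.IsBounded Ω) {f : ℝ → ℝ≥0∞}
    (hf : Measurable f) :
    2 * ∫⁻ t, f t * ENNReal.ofReal
        (volume.real (slice Ω t) / volume.real (slice Ω t) ^ (1 / ((m : ℝ) + 1)))
      ≤ ∫⁻ y in frontier Ω, f (y 0) ∂(Measure.euclideanHausdorffMeasure (m + 1)) := by
  have hfm : Measurable fun x : Space (m + 1) => f (x 0) :=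
    hf.comp (Continuous.measurable (by fun_prop))
  have hm : Measurable fun t => volume (slice Ω t) := measurable_volume_slice ho.measurableSet
  have hmi : ∀ i : Fin (m + 1), Measurable fun t => volume (dropCoord i '' slice Ω t) := by
    intro i
    simp_rw [← slice_dropCoord_image]
    exact measurable_volume_slice (isOpen_dropCoord_image _ ho).measurableSet
  have h0 : ((m : ℝ≥0∞) + 1) ≠ 0 := by simp
  have h1 : ((m : ℝ≥0∞) + 1) ≠ ⊤ := by simp
  -- The factor m + 1 matches the m + 1 projection directions: each contributes one copy of J.
  rw [← ENNReal.mul_le_mul_iff_right h0 h1]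
  set J := ∫⁻ y in frontier Ω, f (y 0) ∂(Measure.euclideanHausdorffMeasure (m + 1))
  calc ((m : ℝ≥0∞) + 1) * (2 * ∫⁻ t, f t * ENNReal.ofReal
        (volume.real (slice Ω t) / volume.real (slice Ω t) ^ (1 / ((m : ℝ) + 1))))
      = 2 * ∫⁻ t, f t * (((m : ℝ≥0∞) + 1) * ENNReal.ofReal
        (volume.real (slice Ω t) / volume.real (slice Ω t) ^ (1 / ((m : ℝ) + 1)))) := by
        rw [mul_left_comm, ← lintegral_const_mul' _ _ h1]
        simp_rw [mul_left_comm]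
    _ ≤ 2 * ∫⁻ t, ∑ i, f t * volume (dropCoord i '' slice Ω t) := by
        gcongr with t
        rw [← Finset.mul_sum]
        gcongr
        exact volume_div_rpow_le_sum_dropCoord_image (isOpen_slice ho t) (isBounded_slice hb t)
    _ = ∑ i : Fin (m + 1), 2 * ∫⁻ z in dropCoord i.succ '' Ω, f (z 0) := by
        have hfi : ∀ i : Fin (m + 1), Measurable fun t => f t * volume (dropCoord i '' slice Ω t) :=
          fun i => hf.mul (hmi i)
        rw [lintegral_finsetSum _ fun i _ => hfi i, Finset.mul_sum]
        refine Finset.sum_congr rfl fun i _ => ?_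
        rw [setLIntegral_coord_zero (isOpen_dropCoord_image _ ho).measurableSet hf]
        simp_rw [slice_dropCoord_image]
    _ ≤ ∑ _i : Fin (m + 1), J := by
        refine Finset.sum_le_sum fun i _ => ?_
        refine (two_mul_lintegral_dropCoord_image_le i.succ ho hc hb hfm).trans_eq ?_
        simp [J]
    _ = ((m : ℝ≥0∞) + 1) * J := by simp

/-! ### Section volumes of a convex set. -/

theorem insertCoord_add_smul {n : ℕ} (x : Space (n + 1)) (t a b : ℝ) (z : Space n) :
    a • insertCoord 0 t z + b • x
      = insertCoord 0 (a * t + b * x 0) (a • z + b • dropCoord 0 x) := by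
  ext j
  refine Fin.cases ?_ (fun j => ?_) j <;> simp [insertCoord]

/-- The volume of the section at height `t`. -/
def sliceVolume {n : ℕ} (K : Set (Space (n + 1))) (t : ℝ) : ℝ := volume.real (slice K t)

theorem sliceVolume_nonneg {n : ℕ} (K : Set (Space (n + 1))) (t : ℝ) : 0 ≤ sliceVolume K t :=
  measureReal_nonneg

theorem measurable_sliceVolume {n : ℕ} {K : Set (Space (n + 1))} (hK : MeasurableSet K) :
    Measurable (sliceVolume K) :=
  (measurable_volume_slice hK).ennreal_toReal

theorem ofReal_sliceVolume {n : ℕ} {K : Set (Space (n + 1))} (hb : Bornology.IsBounded K) (t : ℝ) :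
    ENNReal.ofReal (sliceVolume K t) = volume (slice K t) :=
  ENNReal.ofReal_toReal (isBounded_slice hb t).measure_lt_top.ne

open scoped Pointwise in
theorem pow_mul_volume_le_of_homothety {n : ℕ} {A B : Set (Space n)} {θ : ℝ} (hθ : 0 < θ)
    {w : Space n} (h : ∀ z ∈ A, θ • z + w ∈ B) :
    ENNReal.ofReal (θ ^ n) * volume A ≤ volume B := by
  have h1 : (fun z => z + w) '' (θ • A) ⊆ B := by
    rintro _ ⟨_, ⟨z, hz, rfl⟩, rfl⟩
    exact h z hz
  have h2 := measure_mono (μ := volume) h1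
  rw [Set.image_add_right, measure_preimage_add_right, Measure.addHaar_smul,
    finrank_euclideanSpace_fin, abs_of_nonneg (by positivity)] at h2
  exact h2

/-- Sections of a convex set which spans the heights from `0` to `D` shrink at most conically
towards any intermediate height. -/
theorem pow_mul_sliceVolume_le {n : ℕ} {Ω : Set (Space (n + 1))} (ho : IsOpen Ω)
    (hc : Convex ℝ Ω) (hb : Bornology.IsBounded Ω) {D : ℝ} (hD : 0 < D) {P Q : Space (n + 1)}
    (hP : P ∈ closure Ω) (hQ : Q ∈ closure Ω) (hP0 : P 0 = 0) (hQ0 : Q 0 = D) {c : ℝ}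
    (hc0 : 0 ≤ c) (hcD : c ≤ D) {θ : ℝ} (hθ : 0 < θ) (hθ1 : θ ≤ 1) (τ : ℝ) :
    θ ^ n * sliceVolume Ω (c + τ) ≤ sliceVolume Ω (c + θ * τ) := by
  -- z is the point at height c on the segment PQ. It need only lie in the closure: a homothety
  -- towards it with ratio θ > 0 keeps the open convex set inside itself.
  set z : Space (n + 1) := (1 - c / D) • P + (c / D) • Q with hz
  have hcD' : c / D ≤ 1 := (div_le_one hD).2 hcD
  have hzc : z ∈ closure Ω := hc.closure hP hQ (by linarith) (by positivity) (by ring)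
  have hz0 : z 0 = c := by
    simp [hz, hP0, hQ0]; field_simp
  have key : ∀ y ∈ slice Ω (c + τ), θ • y + (1 - θ) • dropCoord 0 z ∈ slice Ω (c + θ * τ) := by
    intro y hy
    have h1 : θ • insertCoord 0 (c + τ) y + (1 - θ) • z ∈ interior Ω :=
      hc.combo_interior_closure_mem_interior (by rw [ho.interior_eq]; exact hy) hzc hθ
        (by linarith) (by ring)
    rw [ho.interior_eq, insertCoord_add_smul, hz0] at h1
    show insertCoord 0 _ _ ∈ Ω
    convert h1 using 2
    ring
  have := ENNReal.toReal_mono (isBounded_slice hb _).measure_lt_top.ne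
    (pow_mul_volume_le_of_homothety hθ key)
  rwa [ENNReal.toReal_mul, ENNReal.toReal_ofReal (by positivity)] at this

theorem sliceVolume_eq_zero_of_notMem {n : ℕ} {Ω : Set (Space (n + 1))} {D : ℝ}
    (hΩ : ∀ x ∈ Ω, x 0 ∈ Set.Icc 0 D) {t : ℝ} (ht : t ∉ Set.Icc 0 D) : sliceVolume Ω t = 0 := by
  have : slice Ω t = ∅ := by
    refine Set.eq_empty_of_forall_notMem fun z hz => ht ?_
    have := hΩ _ hz
    rwa [insertCoord_apply_same] at this
  simp [sliceVolume, this]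

theorem lintegral_sliceVolume {n : ℕ} {Ω : Set (Space (n + 1))} (ho : IsOpen Ω)
    (hb : Bornology.IsBounded Ω) : ∫⁻ t, ENNReal.ofReal (sliceVolume Ω t) = volume Ω := by
  rw [volume_eq_lintegral_slice ho.measurableSet]
  exact lintegral_congr fun t => ofReal_sliceVolume hb t

theorem integrable_sliceVolume {n : ℕ} {Ω : Set (Space (n + 1))} (ho : IsOpen Ω)
    (hb : Bornology.IsBounded Ω) : Integrable (sliceVolume Ω) := by
  refine ⟨(measurable_sliceVolume ho.measurableSet).aestronglyMeasurable, ?_⟩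
  rw [hasFiniteIntegral_iff_ofReal (.of_forall fun t => sliceVolume_nonneg Ω t),
    lintegral_sliceVolume ho hb]
  exact hb.measure_lt_top

theorem integral_sliceVolume {n : ℕ} {Ω : Set (Space (n + 1))} (ho : IsOpen Ω)
    (hb : Bornology.IsBounded Ω) : ∫ t, sliceVolume Ω t = volume.real Ω := by
  rw [integral_eq_lintegral_of_nonneg_ae (.of_forall fun t => sliceVolume_nonneg Ω t)
    (measurable_sliceVolume ho.measurableSet).aestronglyMeasurable, lintegral_sliceVolume ho hb]
  rfl

/-- A section has at most `n + 1` times the mean volume. -/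
theorem sliceVolume_mul_le {n : ℕ} {Ω : Set (Space (n + 1))} (ho : IsOpen Ω)
    (hc : Convex ℝ Ω) (hb : Bornology.IsBounded Ω) {D : ℝ} (hD : 0 < D) {P Q : Space (n + 1)}
    (hP : P ∈ closure Ω) (hQ : Q ∈ closure Ω) (hP0 : P 0 = 0) (hQ0 : Q 0 = D)
    (hΩ : ∀ x ∈ Ω, x 0 ∈ Set.Icc 0 D) (t : ℝ) :
    sliceVolume Ω t * D ≤ (n + 1) * volume.real Ω := by
  by_cases ht : t ∈ Set.Icc 0 D
  swap
  · rw [sliceVolume_eq_zero_of_notMem hΩ ht, zero_mul]; positivity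
  obtain ⟨h0, h1⟩ := ht
  have hV := integrable_sliceVolume ho hb
  have hn : (0 : ℝ) < (n : ℝ) + 1 := by positivity
  -- Below t, compare with the cone over the section at t with apex at height 0.
  have left : sliceVolume Ω t * t / (n + 1) ≤ ∫ s in 0..t, sliceVolume Ω s := by
    rcases h0.eq_or_lt with rfl | h0
    · simp
    have e : ∫ s in 0..t, (sliceVolume Ω t / t ^ n) * s ^ n = sliceVolume Ω t * t / (n + 1) := by
      rw [intervalIntegral.integral_const_mul, integral_pow]
      field_simp
      simp
      ring
    rw [← e]
    refine intervalIntegral.integral_mono_on_of_le_Ioo h0.le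
      (Continuous.intervalIntegrable (by fun_prop) _ _) hV.intervalIntegrable fun s hs => ?_
    have := pow_mul_sliceVolume_le ho hc hb hD hP hQ hP0 hQ0 le_rfl hD.le
      (θ := s / t) (div_pos hs.1 h0) ((div_le_one h0).2 hs.2.le) t
    rw [zero_add, zero_add, div_mul_cancel₀ _ h0.ne', div_pow] at this
    convert this using 1
    ring
  -- Above t, the comparison cone has its apex at height D.
  have right : sliceVolume Ω t * (D - t) / (n + 1) ≤ ∫ s in t..D, sliceVolume Ω s := by
    rcases h1.eq_or_lt with rfl | h1
    · simp
    have h1' : 0 < D - t := sub_pos.2 h1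
    have e : ∫ s in t..D, (sliceVolume Ω t / (D - t) ^ n) * (D - s) ^ n
        = sliceVolume Ω t * (D - t) / (n + 1) := by
      rw [intervalIntegral.integral_const_mul,
        intervalIntegral.integral_comp_sub_left (fun s => s ^ n) D, sub_self, integral_pow]
      field_simp
      simp
      ring
    rw [← e]
    refine intervalIntegral.integral_mono_on_of_le_Ioo h1.le
      (Continuous.intervalIntegrable (by fun_prop) _ _) hV.intervalIntegrable fun s hs => ?_
    have := pow_mul_sliceVolume_le ho hc hb hD hP hQ hP0 hQ0 hD.le le_rfl
      (θ := (D - s) / (D - t)) (div_pos (sub_pos.2 hs.2) h1')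
      ((div_le_one h1').2 (by linarith [hs.1])) (t - D)
    have e2 : D + (D - s) / (D - t) * (t - D) = s := by field_simp; ring
    rw [e2, add_sub_cancel, div_pow] at this
    convert this using 1
    ring
  have tot : (∫ s in 0..t, sliceVolume Ω s) + ∫ s in t..D, sliceVolume Ω s ≤ volume.real Ω := by
    rw [intervalIntegral.integral_add_adjacent_intervals hV.intervalIntegrable
      hV.intervalIntegrable, intervalIntegral.integral_of_le hD.le, ← integral_sliceVolume ho hb]
    exact setIntegral_le_integral hV (.of_forall fun t => sliceVolume_nonneg Ω t)
  have : sliceVolume Ω t * D / (n + 1) ≤ volume.real Ω := by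
    calc _ = sliceVolume Ω t * t / (n + 1) + sliceVolume Ω t * (D - t) / (n + 1) := by ring
      _ ≤ _ := (add_le_add left right).trans tot
  rwa [div_le_iff₀ hn, mul_comm (volume.real Ω)] at this

/-! ### A one-dimensional weighted inequality. -/

/-- The subtracted constant is the mean of (ℓ - s)² for the weight s^m; it is the sharp constant in
`integral_le_of_pow_mul_le`. -/
theorem integral_sq_sub_mul_pow (m : ℕ) (ℓ : ℝ) :
    ∫ s in 0..ℓ, ((ℓ - s) ^ 2 - 2 * ℓ ^ 2 / ((m + 2) * (m + 3))) * s ^ m = 0 := by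
  have e : ∀ s : ℝ, ((ℓ - s) ^ 2 - 2 * ℓ ^ 2 / ((m + 2) * (m + 3))) * s ^ m
      = (ℓ ^ 2 - 2 * ℓ ^ 2 / ((m + 2) * (m + 3))) * s ^ m - 2 * ℓ * s ^ (m + 1) + s ^ (m + 2) := by
    intro s; ring
  simp_rw [e]
  rw [intervalIntegral.integral_add (Continuous.intervalIntegrable (by fun_prop) _ _)
    (Continuous.intervalIntegrable (by fun_prop) _ _),
    intervalIntegral.integral_sub (Continuous.intervalIntegrable (by fun_prop) _ _)
    (Continuous.intervalIntegrable (by fun_prop) _ _), intervalIntegral.integral_const_mul,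
    intervalIntegral.integral_const_mul, integral_pow, integral_pow, integral_pow]
  push_cast
  simp only [ne_eq, Nat.add_eq_zero_iff, one_ne_zero, OfNat.ofNat_ne_zero, and_false,
    not_false_eq_true, zero_pow, sub_zero]
  field_simp
  ring

/-- A one-dimensional weighted inequality, for weights which decrease no faster than the
`m`-th power towards `0`; there is equality for the weight `s ^ m`. -/
theorem integral_le_of_pow_mul_le {m : ℕ} {ℓ : ℝ} (hℓ : 0 < ℓ) {w : ℝ → ℝ}
    (hwi : IntervalIntegrable w volume 0 ℓ)
    (hw : ∀ s, 0 < s → s ≤ ℓ → ∀ θ, 0 < θ → θ ≤ 1 → θ ^ m * w s ≤ w (θ * s)) :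
    ∫ s in 0..ℓ, w s
      ≤ ((m + 2) * (m + 3) / (2 * ℓ ^ 2)) * ∫ s in 0..ℓ, (ℓ - s) ^ 2 * w s := by
  set κ : ℝ := 2 * ℓ ^ 2 / ((m + 2) * (m + 3)) with hκ
  have hκ0 : 0 < κ := by positivity
  have hκℓ : κ < ℓ ^ 2 := by
    rw [hκ, div_lt_iff₀ (by positivity)]
    have : (0 : ℝ) ≤ m := Nat.cast_nonneg m
    nlinarith [sq_pos_of_pos hℓ, mul_nonneg this this, mul_pos hℓ hℓ,
      mul_nonneg (sq_nonneg ℓ) this, mul_nonneg (sq_nonneg ℓ) (mul_nonneg this this)]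
  set r := Real.sqrt κ
  have hr0 : 0 < r := Real.sqrt_pos.2 hκ0
  have hr2 : r ^ 2 = κ := Real.sq_sqrt hκ0.le
  have hrℓ : r < ℓ := by nlinarith
  -- The factor (ℓ - s)² - κ changes sign from + to - at s₀. The hypothesis says that w(s)/s^m is
  -- non-increasing, so w - h₀ s^m changes sign the same way there, and the product is nonnegative.
  -- The contribution of s^m integrates to zero.
  set s₀ := ℓ - r with hs₀
  have hs₀0 : 0 < s₀ := sub_pos.2 hrℓ
  set h₀ := w s₀ / s₀ ^ m with hh₀
  have hwi2 : IntervalIntegrable (fun s => ((ℓ - s) ^ 2 - κ) * w s) volume 0 ℓ :=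
    hwi.continuousOn_mul (Continuous.continuousOn (by fun_prop))
  have hwi3 : IntervalIntegrable (fun s => (ℓ - s) ^ 2 * w s) volume 0 ℓ :=
    hwi.continuousOn_mul (Continuous.continuousOn (by fun_prop))
  have hnn : 0 ≤ ∫ s in 0..ℓ, (((ℓ - s) ^ 2 - κ) * w s - h₀ * (((ℓ - s) ^ 2 - κ) * s ^ m)) := by
    have := intervalIntegral.integral_mono_on_of_le_Ioo hℓ.le (f := fun _ => (0 : ℝ))
      (g := fun s => ((ℓ - s) ^ 2 - κ) * w s - h₀ * (((ℓ - s) ^ 2 - κ) * s ^ m))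
      (by simp) (hwi2.sub (Continuous.intervalIntegrable (by fun_prop) _ _)) ?_
    · simpa using this
    intro s hs
    have e : ((ℓ - s) ^ 2 - κ) * w s - h₀ * (((ℓ - s) ^ 2 - κ) * s ^ m)
        = ((ℓ - s) ^ 2 - κ) * (w s - h₀ * s ^ m) := by ring
    rw [e]
    rcases le_total s s₀ with h | h
    · refine mul_nonneg ?_ ?_
      · rw [← hr2]; nlinarith
      · have := hw s₀ hs₀0 (by linarith) (s / s₀) (div_pos hs.1 hs₀0) ((div_le_one hs₀0).2 h)
        rw [div_mul_cancel₀ _ hs₀0.ne', div_pow] at this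
        rw [hh₀, sub_nonneg]
        refine le_of_eq_of_le ?_ this
        ring
    · refine mul_nonneg_of_nonpos_of_nonpos ?_ ?_
      · rw [← hr2]; nlinarith [hs.2]
      · have := hw s hs.1 hs.2.le (s₀ / s) (div_pos hs₀0 hs.1) ((div_le_one hs.1).2 h)
        rw [div_mul_cancel₀ _ hs.1.ne', div_pow, div_mul_eq_mul_div,
          div_le_iff₀ (pow_pos hs.1 m)] at this
        rw [hh₀, sub_nonpos, div_mul_eq_mul_div, le_div_iff₀ (pow_pos hs₀0 m)]
        linarith
  rw [intervalIntegral.integral_sub hwi2 (Continuous.intervalIntegrable (by fun_prop) _ _),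
    intervalIntegral.integral_const_mul, integral_sq_sub_mul_pow, mul_zero, sub_zero] at hnn
  simp_rw [sub_mul] at hnn
  rw [intervalIntegral.integral_sub hwi3 (hwi.const_mul κ),
    intervalIntegral.integral_const_mul] at hnn
  have e : ((m : ℝ) + 2) * (m + 3) / (2 * ℓ ^ 2) = κ⁻¹ := by rw [hκ, inv_div]
  rw [e, inv_mul_eq_div, le_div_iff₀ hκ0]
  linarith

/-! ### Strip volumes against boundary integrals. -/

/-- The power `m / (m + 1)` of the volume of the section at height `t`, understood to be `0` where
the section is empty. -/
def sliceWeight {m : ℕ} (K : Set (Space (m + 2))) (t : ℝ) : ℝ :=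
  sliceVolume K t / sliceVolume K t ^ (1 / ((m : ℝ) + 1))

theorem sliceWeight_nonneg {m : ℕ} (K : Set (Space (m + 2))) (t : ℝ) : 0 ≤ sliceWeight K t :=
  div_nonneg (sliceVolume_nonneg K t) (Real.rpow_nonneg (sliceVolume_nonneg K t) _)

theorem measurable_sliceWeight {m : ℕ} {K : Set (Space (m + 2))} (hK : MeasurableSet K) :
    Measurable (sliceWeight K) :=
  (measurable_sliceVolume hK).div ((measurable_sliceVolume hK).pow_const _)

theorem sliceWeight_eq_rpow {m : ℕ} {K : Set (Space (m + 2))} {t : ℝ} (h : 0 < sliceVolume K t) :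
    sliceWeight K t = sliceVolume K t ^ ((m : ℝ) / ((m : ℝ) + 1)) := by
  rw [sliceWeight]
  nth_rewrite 1 [← Real.rpow_one (sliceVolume K t)]
  rw [← Real.rpow_sub h]
  congr 1
  field_simp
  ring

/-- A crude bound whose role is to make the weight integrable. -/
theorem sliceWeight_le {m : ℕ} (K : Set (Space (m + 2))) (t : ℝ) :
    sliceWeight K t ≤ 1 + sliceVolume K t := by
  have h0 := sliceVolume_nonneg K t
  rcases h0.eq_or_lt with h | h
  · simp [sliceWeight, ← h]
  rw [sliceWeight_eq_rpow h]
  calc sliceVolume K t ^ ((m : ℝ) / ((m : ℝ) + 1))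
      ≤ (1 + sliceVolume K t) ^ ((m : ℝ) / ((m : ℝ) + 1)) :=
        Real.rpow_le_rpow h0 (by linarith) (by positivity)
    _ ≤ (1 + sliceVolume K t) ^ (1 : ℝ) :=
        Real.rpow_le_rpow_of_exponent_le (by linarith)
          ((div_le_one (by positivity)).2 (by linarith))
    _ = _ := Real.rpow_one _

theorem intervalIntegrable_sliceWeight {m : ℕ} {Ω : Set (Space (m + 2))} (ho : IsOpen Ω)
    (hb : Bornology.IsBounded Ω) (a b : ℝ) : IntervalIntegrable (sliceWeight Ω) volume a b := by
  have : IntervalIntegrable (fun t => 1 + sliceVolume Ω t) volume a b :=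
    intervalIntegrable_const.add (integrable_sliceVolume ho hb).intervalIntegrable
  refine this.mono_fun (measurable_sliceWeight ho.measurableSet).aestronglyMeasurable
    (.of_forall fun t => ?_)
  show ‖sliceWeight Ω t‖ ≤ ‖1 + sliceVolume Ω t‖
  rw [Real.norm_of_nonneg (sliceWeight_nonneg Ω t),
    Real.norm_of_nonneg (by linarith [sliceVolume_nonneg Ω t])]
  exact sliceWeight_le Ω t

section Strip

variable {m : ℕ} {Ω : Set (Space (m + 2))} (ho : IsOpen Ω) (hc : Convex ℝ Ω)
  (hb : Bornology.IsBounded Ω) {D : ℝ} (hD : 0 < D) {P Q : Space (m + 2)}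
  (hP : P ∈ closure Ω) (hQ : Q ∈ closure Ω) (hP0 : P 0 = 0) (hQ0 : Q 0 = D)
  (hΩ : ∀ x ∈ Ω, x 0 ∈ Set.Icc 0 D) {c ℓ : ℝ} (hc0 : 0 ≤ c) (hcD : c ≤ D) (hℓ : 0 < ℓ)

include ho hc hb hD hP hQ hP0 hQ0

include hc0 hcD in
-- The power m/(m+1) turns the conical exponent m + 1 of section volumes into m.
theorem pow_mul_sliceWeight_le {θ : ℝ} (hθ : 0 < θ) (hθ1 : θ ≤ 1) (τ : ℝ) :
    θ ^ m * sliceWeight Ω (c + τ) ≤ sliceWeight Ω (c + θ * τ) := by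
  have h := pow_mul_sliceVolume_le ho hc hb hD hP hQ hP0 hQ0 hc0 hcD hθ hθ1 τ
  rcases (sliceVolume_nonneg Ω (c + τ)).eq_or_lt with h0 | h0
  · have : sliceWeight Ω (c + τ) = 0 := by simp [sliceWeight, ← h0]
    rw [this, mul_zero]
    exact sliceWeight_nonneg _ _
  have h1 : 0 < θ ^ (m + 1) * sliceVolume Ω (c + τ) := by positivity
  rw [sliceWeight_eq_rpow h0, sliceWeight_eq_rpow (h1.trans_le h)]
  refine le_of_eq_of_le ?_ (Real.rpow_le_rpow h1.le h (by positivity))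
  rw [Real.mul_rpow (by positivity) h0.le, ← Real.rpow_natCast, ← Real.rpow_natCast,
    ← Real.rpow_mul hθ.le]
  congr 2
  push_cast
  field_simp

include hΩ in
-- A positive V factors as V^{1/(m+1)} times the weight, and V ≤ (m+2)|Ω|/D. Enlarging m + 2 to
-- 2^{m+1} makes the root of the dimensional factor exactly 2.
theorem sliceVolume_le_mul_sliceWeight (t : ℝ) :
    sliceVolume Ω t ≤ 2 * (volume.real Ω / D) ^ (1 / ((m : ℝ) + 1)) * sliceWeight Ω t := by
  have h0 := sliceVolume_nonneg Ω t
  rcases h0.eq_or_lt with h | h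
  · rw [← h]
    exact mul_nonneg (by positivity) (sliceWeight_nonneg _ _)
  have h1 := sliceVolume_mul_le ho hc hb hD hP hQ hP0 hQ0 hΩ t
  have h2 : sliceVolume Ω t ≤ 2 ^ (m + 1) * (volume.real Ω / D) := by
    have : ((m + 1 : ℕ) : ℝ) + 1 ≤ 2 ^ (m + 1) := by
      exact_mod_cast Nat.succ_le_of_lt (Nat.lt_two_pow_self (n := m + 1))
    rw [mul_div_assoc', le_div_iff₀ hD]
    exact h1.trans (mul_le_mul_of_nonneg_right this measureReal_nonneg)
  have h3 := Real.rpow_le_rpow h0 h2 (z := 1 / ((m : ℝ) + 1)) (by positivity)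
  rw [Real.mul_rpow (by positivity) (by positivity), ← Real.rpow_natCast,
    ← Real.rpow_mul zero_le_two] at h3
  push_cast at h3
  rw [mul_one_div_cancel (by positivity), Real.rpow_one] at h3
  have h4 : 0 < sliceVolume Ω t ^ (1 / ((m : ℝ) + 1)) := by positivity
  calc sliceVolume Ω t = sliceVolume Ω t ^ (1 / ((m : ℝ) + 1)) * sliceWeight Ω t := by
        rw [sliceWeight]; field_simp
    _ ≤ _ := mul_le_mul_of_nonneg_right h3 (sliceWeight_nonneg _ _)

include hc0 hcD hℓ in
-- The one-dimensional inequality on each side of c. The conical bound towards c holds for all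
-- displacements, so the interval may protrude beyond [0, D].
theorem integral_sliceWeight_le :
    ∫ t in (c - ℓ)..(c + ℓ), sliceWeight Ω t ≤ ((m + 2) * (m + 3) / (2 * ℓ ^ 2)) *
      ∫ t in (c - ℓ)..(c + ℓ), (ℓ - |t - c|) ^ 2 * sliceWeight Ω t := by
  have hi := intervalIntegrable_sliceWeight ho hb
  have hi2 : ∀ a b, IntervalIntegrable (fun t => (ℓ - |t - c|) ^ 2 * sliceWeight Ω t) volume a b :=
    fun a b => (hi a b).continuousOn_mul (Continuous.continuousOn (by fun_prop))
  have hr := integral_le_of_pow_mul_le (m := m) hℓ (w := fun s => sliceWeight Ω (c + s))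
    (by simpa using (hi c (c + ℓ)).comp_add_left c)
    (fun s _ _ θ hθ hθ1 =>
      pow_mul_sliceWeight_le ho hc hb hD hP hQ hP0 hQ0 hc0 hcD hθ hθ1 s)
  have hl := integral_le_of_pow_mul_le (m := m) hℓ (w := fun s => sliceWeight Ω (c - s))
    (by simpa using (hi c (c - ℓ)).comp_sub_left c)
    (fun s _ _ θ hθ hθ1 => by
      have := pow_mul_sliceWeight_le ho hc hb hD hP hQ hP0 hQ0 hc0 hcD hθ hθ1 (-s)
      rwa [mul_neg, ← sub_eq_add_neg, ← sub_eq_add_neg] at this)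
  have er : ∫ s in 0..ℓ, (ℓ - s) ^ 2 * sliceWeight Ω (c + s)
      = ∫ t in c..(c + ℓ), (ℓ - |t - c|) ^ 2 * sliceWeight Ω t := by
    have := intervalIntegral.integral_comp_add_left (a := 0) (b := ℓ)
      (fun t => (ℓ - |t - c|) ^ 2 * sliceWeight Ω t) c
    rw [add_zero] at this
    rw [← this]
    refine intervalIntegral.integral_congr fun s hs => ?_
    rw [Set.uIcc_of_le hℓ.le] at hs
    simp [abs_of_nonneg hs.1]
  have el : ∫ s in 0..ℓ, (ℓ - s) ^ 2 * sliceWeight Ω (c - s)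
      = ∫ t in (c - ℓ)..c, (ℓ - |t - c|) ^ 2 * sliceWeight Ω t := by
    have := intervalIntegral.integral_comp_sub_left (a := 0) (b := ℓ)
      (fun t => (ℓ - |t - c|) ^ 2 * sliceWeight Ω t) c
    rw [sub_zero] at this
    rw [← this]
    refine intervalIntegral.integral_congr fun s hs => ?_
    rw [Set.uIcc_of_le hℓ.le] at hs
    simp [abs_of_nonneg hs.1]
  rw [er, intervalIntegral.integral_comp_add_left (fun t => sliceWeight Ω t), add_zero] at hr
  rw [el, intervalIntegral.integral_comp_sub_left (fun t => sliceWeight Ω t), sub_zero] at hl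
  rw [← intervalIntegral.integral_add_adjacent_intervals (hi (c - ℓ) c) (hi c (c + ℓ)),
    ← intervalIntegral.integral_add_adjacent_intervals (hi2 (c - ℓ) c) (hi2 c (c + ℓ)), mul_add]
  exact add_le_add hl hr

include hΩ hc0 hcD hℓ in
/-- The volume of a strip is controlled by the boundary integral of a squared tent function. -/
theorem volume_strip_le :
    volume {x ∈ Ω | |x 0 - c| < ℓ} ≤
      ENNReal.ofReal ((volume.real Ω / D) ^ (1 / ((m : ℝ) + 1)) *
        ((m + 2) * (m + 3) / (2 * ℓ ^ 2))) *
      ∫⁻ y in frontier Ω, ENNReal.ofReal (max 0 (ℓ - |y 0 - c|) ^ 2)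
        ∂(Measure.euclideanHausdorffMeasure (m + 1)) := by
  set B := (volume.real Ω / D) ^ (1 / ((m : ℝ) + 1)) with hB
  have hB0 : 0 ≤ B := by positivity
  set κ : ℝ := (m + 2) * (m + 3) / (2 * ℓ ^ 2) with hκ
  have hκ0 : 0 ≤ κ := by positivity
  have hle : c - ℓ ≤ c + ℓ := by linarith
  have hV := integrable_sliceVolume ho hb
  have hWi := intervalIntegrable_sliceWeight ho hb
  have hmem : ∀ t, t ∈ Set.Ioo (c - ℓ) (c + ℓ) ↔ |t - c| < ℓ := by
    intro t; rw [abs_lt, Set.mem_Ioo]; constructor <;> rintro ⟨h1, h2⟩ <;> constructor <;> linarith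
  set f : ℝ → ℝ≥0∞ := fun t => ENNReal.ofReal (max 0 (ℓ - |t - c|) ^ 2) with hf
  have hfm : Measurable f := (Continuous.measurable (by fun_prop)).ennreal_ofReal
  have hreal : ∫ t in (c - ℓ)..(c + ℓ), sliceVolume Ω t
      ≤ 2 * B * κ * ∫ t in (c - ℓ)..(c + ℓ), (ℓ - |t - c|) ^ 2 * sliceWeight Ω t := by
    calc _ ≤ ∫ t in (c - ℓ)..(c + ℓ), 2 * B * sliceWeight Ω t :=
          intervalIntegral.integral_mono_on hle hV.intervalIntegrable
            ((hWi _ _).const_mul _) fun t _ =>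
            sliceVolume_le_mul_sliceWeight ho hc hb hD hP hQ hP0 hQ0 hΩ t
      _ = 2 * B * ∫ t in (c - ℓ)..(c + ℓ), sliceWeight Ω t :=
          intervalIntegral.integral_const_mul _ _
      _ ≤ 2 * B * (κ * ∫ t in (c - ℓ)..(c + ℓ), (ℓ - |t - c|) ^ 2 * sliceWeight Ω t) := by
          gcongr
          exact integral_sliceWeight_le ho hc hb hD hP hQ hP0 hQ0 hc0 hcD hℓ
      _ = _ := by ring
  have hleft : volume {x ∈ Ω | |x 0 - c| < ℓ}
      = ENNReal.ofReal (∫ t in (c - ℓ)..(c + ℓ), sliceVolume Ω t) := by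
    have hIm : Measurable ((Set.Ioo (c - ℓ) (c + ℓ)).indicator (fun _ => (1 : ℝ≥0∞))) :=
      measurable_const.indicator measurableSet_Ioo
    have h1 := setLIntegral_coord_zero ho.measurableSet hIm
    have h2 : ∫⁻ x in Ω, (Set.Ioo (c - ℓ) (c + ℓ)).indicator (fun _ => (1 : ℝ≥0∞)) (x 0)
        = volume {x ∈ Ω | |x 0 - c| < ℓ} := by
      have hs : MeasurableSet {x : Space (m + 2) | |x 0 - c| < ℓ} :=
        (isOpen_lt (by fun_prop) continuous_const).measurableSet
      have e : ∀ x : Space (m + 2), (Set.Ioo (c - ℓ) (c + ℓ)).indicator (fun _ => (1 : ℝ≥0∞)) (x 0)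
          = {x : Space (m + 2) | |x 0 - c| < ℓ}.indicator (fun _ => 1) x := by
        intro x
        simp only [Set.indicator_apply, hmem, Set.mem_ofPred_eq]
      simp_rw [e]
      rw [lintegral_indicator hs, setLIntegral_const, one_mul, Measure.restrict_apply hs,
        Set.inter_comm]
      rfl
    rw [← h2, h1, intervalIntegral.integral_of_le hle, integral_Ioc_eq_integral_Ioo,
      ofReal_integral_eq_lintegral_ofReal hV.integrableOn
        (.of_forall fun t => sliceVolume_nonneg Ω t), ← lintegral_indicator measurableSet_Ioo]
    refine lintegral_congr fun t => ?_
    by_cases ht : t ∈ Set.Ioo (c - ℓ) (c + ℓ)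
    · simp [ht, ofReal_sliceVolume hb]
    · simp [ht]
  have hright : ENNReal.ofReal (∫ t in (c - ℓ)..(c + ℓ), (ℓ - |t - c|) ^ 2 * sliceWeight Ω t)
      ≤ ∫⁻ t, f t * ENNReal.ofReal (sliceWeight Ω t) := by
    have hi2 : IntervalIntegrable (fun t => (ℓ - |t - c|) ^ 2 * sliceWeight Ω t) volume
        (c - ℓ) (c + ℓ) := (hWi _ _).continuousOn_mul (Continuous.continuousOn (by fun_prop))
    rw [intervalIntegral.integral_of_le hle, integral_Ioc_eq_integral_Ioo,
      ofReal_integral_eq_lintegral_ofReal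
        (((intervalIntegrable_iff_integrableOn_Ioc_of_le hle).1 hi2).mono_set
          Set.Ioo_subset_Ioc_self)
        (.of_forall fun t => mul_nonneg (sq_nonneg _) (sliceWeight_nonneg _ _))]
    refine le_trans (setLIntegral_mono' measurableSet_Ioo fun t ht => ?_)
      (setLIntegral_le_lintegral _ _)
    rw [ENNReal.ofReal_mul (sq_nonneg _), hf]
    simp only
    rw [max_eq_right (by linarith [(hmem t).1 ht])]
  calc volume {x ∈ Ω | |x 0 - c| < ℓ}
      ≤ ENNReal.ofReal (2 * B * κ *
          ∫ t in (c - ℓ)..(c + ℓ), (ℓ - |t - c|) ^ 2 * sliceWeight Ω t) := by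
        rw [hleft]; exact ENNReal.ofReal_le_ofReal hreal
    _ ≤ ENNReal.ofReal (2 * B * κ) * ∫⁻ t, f t * ENNReal.ofReal (sliceWeight Ω t) := by
        rw [ENNReal.ofReal_mul (by positivity)]
        gcongr
    -- The 2 from comparing volume with weight is absorbed by the two sheets of the boundary.
    _ = ENNReal.ofReal (B * κ) * (2 * ∫⁻ t, f t * ENNReal.ofReal (sliceWeight Ω t)) := by
        rw [show 2 * B * κ = B * κ * 2 by ring, ENNReal.ofReal_mul (by positivity), mul_assoc]
        simp
    _ ≤ _ := by
        gcongr
        exact two_mul_lintegral_slice_le_frontier ho hc hb hfm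

end Strip

/-! ### Coordinates adapted to a diameter. -/

theorem exists_mem_closure_dist_eq_diam {E : Type*} [PseudoMetricSpace E] [ProperSpace E] {s : Set E}
    (hb : Bornology.IsBounded s) (hne : s.Nonempty) :
    ∃ p ∈ closure s, ∃ q ∈ closure s, dist p q = Metric.diam s := by
  have hcpt : IsCompact (closure s) := hb.isCompact_closure
  obtain ⟨⟨p, q⟩, ⟨hp, hq⟩, hmax⟩ := (hcpt.prod hcpt).exists_isMaxOn
    (hne.closure.prod hne.closure) (f := fun z => dist z.1 z.2) (by fun_prop)
  refine ⟨p, hp, q, hq, le_antisymm ?_ ?_⟩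
  · rw [← Metric.diam_closure]
    exact Metric.dist_le_diam_of_mem hcpt.isBounded hp hq
  · exact Metric.diam_le_of_forall_dist_le dist_nonneg fun x hx y hy =>
      hmax (show (x, y) ∈ closure s ×ˢ closure s from ⟨subset_closure hx, subset_closure hy⟩)

theorem diam_pos_of_isOpen {n : ℕ} {Ω : Set (Space (n + 1))} (ho : IsOpen Ω) (hne : Ω.Nonempty)
    (hb : Bornology.IsBounded Ω) : 0 < Metric.diam Ω := by
  obtain ⟨x, hx⟩ := hne
  refine Metric.diam_pos ?_ hb
  exact (infinite_of_mem_nhds x (ho.mem_nhds hx)).nontrivial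

theorem exists_affineIsometryEquiv_apply_zero {n : ℕ} {p q : Space (n + 1)} (hpq : p ≠ q) :
    ∃ T : Space (n + 1) ≃ᵃⁱ[ℝ] Space (n + 1), MeasurePreserving T ∧
      ∀ x, T x 0 = inner ℝ (‖q - p‖⁻¹ • (q - p)) (x - p) := by
  have hD : ‖q - p‖ ≠ 0 := norm_ne_zero_iff.2 (sub_ne_zero.2 hpq.symm)
  obtain ⟨R, hR⟩ := exists_linearIsometryEquiv_map_eq_single (sub_ne_zero.2 hpq.symm)
  refine ⟨(AffineIsometryEquiv.vaddConst ℝ p).symm.trans R.toAffineIsometryEquiv,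
    R.measurePreserving.comp (measurePreserving_sub_right volume p), fun x => ?_⟩
  have hRe : R (‖q - p‖⁻¹ • (q - p)) = EuclideanSpace.single 0 1 := by
    rw [map_smul, hR]
    ext j
    refine Fin.cases ?_ (fun j => ?_) j <;> simp [hD]
  rw [← R.inner_map_map, hRe, EuclideanSpace.inner_single_left]
  simp

/-- A bounded convex domain, with a diameter `e` based at `p`: the strips orthogonal to `e` satisfy
the estimate `volume_strip_le`. -/
theorem exists_diameter_strips {m : ℕ} {Ω : Set (Space (m + 2))} (ho : IsOpen Ω)
    (hc : Convex ℝ Ω) (hne : Ω.Nonempty) (hb : Bornology.IsBounded Ω) :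
    0 < Metric.diam Ω ∧ ∃ p e : Space (m + 2), ‖e‖ = 1 ∧
      ∀ c ∈ Set.Icc 0 (Metric.diam Ω), ∀ ℓ, 0 < ℓ →
        0 < volume {x ∈ Ω | |inner ℝ e (x - p) - c| < ℓ} ∧
        volume {x ∈ Ω | |inner ℝ e (x - p) - c| < ℓ} ≤
          ENNReal.ofReal ((volume.real Ω / Metric.diam Ω) ^ (1 / ((m : ℝ) + 1)) *
            ((m + 2) * (m + 3) / (2 * ℓ ^ 2))) *
          ∫⁻ y in frontier Ω, ENNReal.ofReal (max 0 (ℓ - |inner ℝ e (y - p) - c|) ^ 2)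
            ∂(Measure.euclideanHausdorffMeasure (m + 1)) := by
  have hD := diam_pos_of_isOpen ho hne hb
  set D := Metric.diam Ω with hDdef
  have hcpt : IsCompact (closure Ω) := hb.isCompact_closure
  obtain ⟨p, hp, q, hq, hpq⟩ := exists_mem_closure_dist_eq_diam hb hne
  rw [← hDdef] at hpq
  have hqp : ‖q - p‖ = D := by rw [← hpq, dist_comm, dist_eq_norm]
  obtain ⟨T, hTv, hT0⟩ := exists_affineIsometryEquiv_apply_zero (p := p) (q := q)
    (dist_pos.1 (by rw [hpq]; exact hD))
  rw [hqp] at hT0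
  set e := D⁻¹ • (q - p) with he
  have hen : ‖e‖ = 1 := by
    rw [he, norm_smul, hqp, Real.norm_of_nonneg (by positivity), inv_mul_cancel₀ hD.ne']
  have hep : inner ℝ e (q - p) = D := by
    rw [he, real_inner_smul_left, real_inner_self_eq_norm_sq, hqp]; field_simp
  have hTe : MeasurableEmbedding T := T.toHomeomorph.measurableEmbedding
  have hTh : MeasurePreserving T (Measure.euclideanHausdorffMeasure (m + 1))
      (Measure.euclideanHausdorffMeasure (m + 1)) :=
    T.toIsometryEquiv.measurePreserving_euclideanHausdorffMeasure (m + 1)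
  have ho' : IsOpen (T '' Ω) := T.toHomeomorph.isOpenMap _ ho
  have hc' : Convex ℝ (T '' Ω) := hc.affine_image T.toAffineEquiv.toAffineMap
  have hb' : Bornology.IsBounded (T '' Ω) := T.isometry.lipschitz.isBounded_image hb
  have hcl : ∀ x ∈ closure Ω, T x ∈ closure (T '' Ω) := fun x hx =>
    map_mem_closure T.continuous hx fun y hy => ⟨y, hy, rfl⟩
  have hfr : frontier (T '' Ω) = T '' frontier Ω := (T.toHomeomorph.image_frontier Ω).symm
  have hvol : volume (T '' Ω) = volume Ω := by
    rw [← hTv.measure_preimage_emb hTe, T.injective.preimage_image]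
  -- Heights are in [0, D] because p and q realize the diameter: the distance to q gives the lower
  -- bound, the distance to p the upper one.
  have hrange : ∀ x ∈ T '' Ω, x 0 ∈ Set.Icc 0 D := by
    rintro _ ⟨x, hx, rfl⟩
    have h1 : ‖x - p‖ ≤ D := by
      rw [← dist_eq_norm, hDdef, ← Metric.diam_closure]
      exact Metric.dist_le_diam_of_mem hcpt.isBounded (subset_closure hx) hp
    have h2 : ‖x - q‖ ≤ D := by
      rw [← dist_eq_norm, hDdef, ← Metric.diam_closure]
      exact Metric.dist_le_diam_of_mem hcpt.isBounded (subset_closure hx) hq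
    rw [hT0]
    constructor
    · have h3 : ‖x - q‖ ^ 2 = ‖x - p‖ ^ 2 - 2 * inner ℝ (x - p) (q - p) + ‖q - p‖ ^ 2 := by
        rw [← norm_sub_sq_real, sub_sub_sub_cancel_right]
      rw [hqp] at h3
      rw [he, real_inner_smul_left, real_inner_comm]
      have : 0 ≤ inner ℝ (x - p) (q - p) := by nlinarith [norm_nonneg (x - q), norm_nonneg (x - p)]
      positivity
    · refine (real_inner_le_norm _ _).trans ?_
      rw [hen, one_mul]; exact h1
  refine ⟨hD, p, e, hen, fun c hc01 ℓ hℓ => ⟨?_, ?_⟩⟩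
  · have hopen : IsOpen {x | |inner ℝ e (x - p) - c| < ℓ} := isOpen_lt (by fun_prop) continuous_const
    refine (ho.inter hopen).measure_pos _ ?_
    have hz : (1 - c / D) • p + (c / D) • q ∈ closure Ω :=
      hc.closure hp hq (by linarith [(div_le_one hD).2 hc01.2]) (div_nonneg hc01.1 hD.le) (by ring)
    rw [Set.inter_comm]
    refine mem_closure_iff.1 hz _ hopen ?_
    have : (1 - c / D) • p + (c / D) • q - p = (c / D) • (q - p) := by module
    simp [this, real_inner_smul_right, hep, hD.ne', hℓ]
  · have key := volume_strip_le ho' hc' hb' hD (hcl p hp) (hcl q hq) (by rw [hT0]; simp)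
      (by rw [hT0, hep]) hrange hc01.1 hc01.2 hℓ
    have e1 : volume {x ∈ T '' Ω | |x 0 - c| < ℓ}
        = volume {x ∈ Ω | |inner ℝ e (x - p) - c| < ℓ} := by
      rw [← hTv.measure_preimage_emb hTe]
      congr 1
      ext x
      simp only [Set.mem_preimage, Set.mem_ofPred_eq, T.injective.mem_set_image, hT0]
    rw [e1, hfr, measureReal_def, hvol, ← hTh.setLIntegral_comp_emb hTe] at key
    simp_rw [hT0] at key
    exact key

/-! ### Smooth tent functions and their Rayleigh quotients. -/

open scoped Convolution in
theorem abs_normed_convolution_sub_le (φ : ContDiffBump (0 : ℝ)) {g : ℝ → ℝ} (hg : LipschitzWith 1 g)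
    (x y : ℝ) :
    |(φ.normed volume ⋆[ContinuousLinearMap.lsmul ℝ ℝ, volume] g) x -
      (φ.normed volume ⋆[ContinuousLinearMap.lsmul ℝ ℝ, volume] g) y| ≤ |x - y| := by
  have hi : ∀ z, Integrable (fun t => φ.normed volume t * g (z - t)) := fun z =>
    ((φ.continuous_normed).mul (hg.continuous.comp (by fun_prop))).integrable_of_hasCompactSupport
      φ.hasCompactSupport_normed.mul_right
  simp only [convolution_def, ContinuousLinearMap.lsmul_apply, smul_eq_mul]
  rw [← integral_sub (hi x) (hi y)]
  calc |∫ t, (φ.normed volume t * g (x - t) - φ.normed volume t * g (y - t))|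
      ≤ ∫ t, |φ.normed volume t * g (x - t) - φ.normed volume t * g (y - t)| :=
        abs_integral_le_integral_abs
    _ ≤ ∫ t, φ.normed volume t * |x - y| := by
        refine integral_mono ((hi x).sub (hi y)).abs (φ.integrable_normed.mul_const _) fun t => ?_
        show |φ.normed volume t * g (x - t) - φ.normed volume t * g (y - t)| ≤ _
        rw [← mul_sub, abs_mul, abs_of_nonneg (φ.nonneg_normed t)]
        refine mul_le_mul_of_nonneg_left ?_ (φ.nonneg_normed t)
        have := hg.dist_le_mul (x - t) (y - t)
        simpa [Real.dist_eq] using this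
    _ = |x - y| := by rw [integral_mul_const, φ.integral_normed, one_mul]

open scoped Convolution in
/-- Smooth approximation of a tent function from within its support. -/
theorem exists_smooth_tent (c : ℝ) {ℓ δ : ℝ} (hℓ : 0 < ℓ) (hδ : 0 < δ) :
    ∃ f : ℝ → ℝ, ContDiff ℝ ∞ f ∧ tsupport f ⊆ Metric.ball c ℓ ∧ (∀ t, |deriv f t| ≤ 1) ∧
      ∀ t, max 0 (ℓ - |t - c|) - δ ≤ f t := by
  -- The tent is narrowed by 2η and then mollified at scale η: its support stays within ℓ - η of c,
  -- and at most 3η ≤ δ of its height is lost.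
  set η := min δ ℓ / 4
  have hη : 0 < η := by positivity
  have hηδ : 4 * η ≤ δ := by have := min_le_left δ ℓ; simp only [η]; linarith
  have hηℓ : 4 * η ≤ ℓ := by have := min_le_right δ ℓ; simp only [η]; linarith
  let φ : ContDiffBump (0 : ℝ) := ⟨η / 2, η, by positivity, by linarith⟩
  set g : ℝ → ℝ := fun t => max 0 (ℓ - 2 * η - |t - c|) with hg
  have hlip : LipschitzWith 1 g := by
    refine LipschitzWith.of_dist_le_mul fun x y => ?_
    rw [NNReal.coe_one, one_mul, Real.dist_eq, Real.dist_eq]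
    refine (abs_max_sub_max_le_max _ _ _ _).trans ?_
    rw [sub_self, abs_zero, sub_sub_sub_cancel_left, max_eq_right (abs_nonneg _)]
    refine (abs_abs_sub_abs_le _ _).trans_eq ?_
    rw [abs_sub_comm]
    congr 1
    ring
  set f : ℝ → ℝ := φ.normed volume ⋆[ContinuousLinearMap.lsmul ℝ ℝ, volume] g with hf
  have hsupp : Function.support f ⊆ Metric.closedBall c (ℓ - η) := by
    intro x hx
    obtain ⟨u, hu, v, hv, rfl⟩ := support_convolution_subset _ hx
    rw [φ.support_normed_eq, Metric.mem_ball, dist_zero_right, Real.norm_eq_abs] at hu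
    have hv' : |v - c| < ℓ - 2 * η := by
      by_contra h
      exact hv (max_eq_left (by linarith [not_lt.1 h]))
    rw [Metric.mem_closedBall, Real.dist_eq]
    have : |u + v - c| ≤ |u| + |v - c| := by
      rw [add_sub_assoc]; exact abs_add_le _ _
    change |u| < η at hu
    linarith
  refine ⟨f, φ.hasCompactSupport_normed.contDiff_convolution_left _ φ.contDiff_normed
    hlip.continuous.locallyIntegrable, ?_, fun t => ?_, fun t => ?_⟩
  · refine (closure_minimal hsupp Metric.isClosed_closedBall).trans
      (Metric.closedBall_subset_ball (by linarith))
  · have : LipschitzWith 1 f := by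
      refine LipschitzWith.of_dist_le_mul fun x y => ?_
      rw [NNReal.coe_one, one_mul, Real.dist_eq, Real.dist_eq]
      exact abs_normed_convolution_sub_le φ hlip x y
    have h := norm_deriv_le_of_lipschitz (x₀ := t) this
    simpa using h
  · have h := φ.dist_normed_convolution_le (μ := volume) (g := g) (x₀ := t) (ε := η)
      hlip.continuous.aestronglyMeasurable fun x hx => by
        have := hlip.dist_le_mul x t
        rw [NNReal.coe_one, one_mul] at this
        exact this.trans (Metric.mem_ball.1 hx).le
    rw [Real.dist_eq] at h
    have h1 : g t - η ≤ f t := by linarith [neg_le_of_abs_le h]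
    have h2 : max 0 (ℓ - |t - c|) ≤ g t + 2 * η := by
      refine max_le ?_ ?_
      · have : 0 ≤ g t := le_max_left _ _
        linarith
      · have : ℓ - 2 * η - |t - c| ≤ g t := le_max_right _ _
        linarith
    linarith

/-- A test function which depends, on `Ω`, only on one linear coordinate. -/
theorem exists_triple_of_linear (n : ℕ) {Ω : Set (Space (n + 1))} (ho : IsOpen Ω)
    (hc : Convex ℝ Ω) (hne : Ω.Nonempty) (hb : Bornology.IsBounded Ω) (p e : Space (n + 1))
    {f : ℝ → ℝ} (hf : ContDiff ℝ ∞ f) :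
    ∃ q ∈ smoothTriples Ω,
      q.2.1 =ᵐ[bulk Ω] (fun x => deriv f (inner ℝ e (x - p)) • e) ∧
      q.2.2 =ᵐ[surface Ω] (fun x => f (inner ℝ e (x - p))) := by
  obtain ⟨R, hR0, hR⟩ := hb.closure.exists_pos_norm_lt
  let χ : ContDiffBump (0 : Space (n + 1)) := ⟨R, R + 1, hR0, by linarith⟩
  set φ : Space (n + 1) → ℝ := fun x => f (inner ℝ e (x - p)) * χ x with hφ
  have hφs : ContDiff ℝ ∞ φ :=
    (hf.comp (contDiff_const.inner ℝ (contDiff_id.sub contDiff_const))).mul χ.contDiff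
  have hφc : HasCompactSupport φ := χ.hasCompactSupport.mul_left
  have hone : ∀ x ∈ closure Ω, φ =ᶠ[nhds x] fun x => f (inner ℝ e (x - p)) := by
    intro x hx
    filter_upwards [Metric.isOpen_ball.mem_nhds (mem_ball_zero_iff.2 (hR x hx))] with y hy
    rw [hφ]
    simp only
    rw [χ.one_of_mem_closedBall (Metric.ball_subset_closedBall hy), mul_one]
  obtain ⟨q, hq, -, h2, h3⟩ := exists_smoothTriple ho hc hne hb hφs hφc
  refine ⟨q, hq, ?_, ?_⟩
  · filter_upwards [h2, ae_restrict_mem ho.measurableSet] with x hx hxΩ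
    rw [hx]
    refine HasGradientAt.gradient ?_
    have h1 : HasFDerivAt (fun x : Space (n + 1) => inner ℝ e (x - p)) (innerSL ℝ e) x := by
      have := ((innerSL ℝ e).hasFDerivAt (x := x - p)).comp x ((hasFDerivAt_id x).sub_const p)
      rwa [ContinuousLinearMap.comp_id] at this
    have h4 := ((hf.differentiable (by simp)) (inner ℝ e (x - p))).hasDerivAt.comp_hasFDerivAt x h1
    rw [hasGradientAt_iff_hasFDerivAt]
    refine (h4.congr_of_eventuallyEq (hone x (subset_closure hxΩ))).congr_fderiv ?_
    ext y
    simp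
  · filter_upwards [h3, ae_restrict_mem isClosed_frontier.measurableSet] with x hx hxΩ
    rw [hx]
    exact (hone x (frontier_subset_closure hxΩ)).self_of_nhds

theorem integrableOn_frontier {n : ℕ} {Ω : Set (Space (n + 1))} (ho : IsOpen Ω)
    (hc : Convex ℝ Ω) (hne : Ω.Nonempty) (hb : Bornology.IsBounded Ω) {g : Space (n + 1) → ℝ}
    (hg : Continuous g) : Integrable g (surface Ω) := by
  have := isFiniteMeasure_surface ho hc hne hb
  have hcpt : IsCompact (frontier Ω) :=
    Metric.isCompact_of_isClosed_isBounded isClosed_frontier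
      (hb.closure.subset frontier_subset_closure)
  obtain ⟨C, hC⟩ := hcpt.exists_bound_of_continuousOn hg.continuousOn
  exact Integrable.of_bound hg.aestronglyMeasurable C
    ((ae_restrict_mem isClosed_frontier.measurableSet).mono hC)

theorem sq_sub_le_sq_of_sub_le {a b δ ℓ : ℝ} (ha : 0 ≤ a) (haℓ : a ≤ ℓ) (hδ : 0 ≤ δ)
    (h : a - δ ≤ b) : a ^ 2 - 2 * δ * ℓ ≤ b ^ 2 := by
  have h1 : 2 * δ * a ≤ 2 * δ * ℓ := by gcongr
  rcases le_total δ a with h2 | h2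
  · nlinarith [pow_le_pow_left₀ (sub_nonneg.2 h2) h 2]
  · nlinarith [sq_nonneg b]

/-- The gradient of a smoothed tent has norm at most 1 and lives in the strip, so its energy is at
most the strip volume. Smoothing lowers the boundary integral by an arbitrarily small amount, which
is why s exceeds s₀. -/
theorem exists_triple_of_volume_strip_le {n : ℕ} {Ω : Set (Space (n + 1))} (ho : IsOpen Ω)
    (hc : Convex ℝ Ω) (hne : Ω.Nonempty) (hb : Bornology.IsBounded Ω) {p e : Space (n + 1)}
    (he : ‖e‖ = 1) {c ℓ s₀ s : ℝ} (hℓ : 0 < ℓ) (hs₀ : 0 ≤ s₀) (hs : s₀ < s)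
    (hpos : 0 < volume {x ∈ Ω | |inner ℝ e (x - p) - c| < ℓ})
    (hle : volume {x ∈ Ω | |inner ℝ e (x - p) - c| < ℓ} ≤ ENNReal.ofReal s₀ *
      ∫⁻ y in frontier Ω, ENNReal.ofReal (max 0 (ℓ - |inner ℝ e (y - p) - c|) ^ 2)
        ∂(Measure.euclideanHausdorffMeasure n)) :
    ∃ q ∈ smoothTriples Ω, ∃ f : ℝ → ℝ, tsupport f ⊆ Metric.ball c ℓ ∧
      q.2.1 =ᵐ[bulk Ω] (fun x => deriv f (inner ℝ e (x - p)) • e) ∧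
      q.2.2 =ᵐ[surface Ω] (fun x => f (inner ℝ e (x - p))) ∧
      ‖q.2.1‖ ^ 2 ≤ s * ‖q.2.2‖ ^ 2 ∧ q.2.2 ≠ 0 := by
  have := isFiniteMeasure_surface ho hc hne hb
  set tent : Space (n + 1) → ℝ := fun y => max 0 (ℓ - |inner ℝ e (y - p) - c|) with htent
  have htc : Continuous tent := by fun_prop
  have hti : Integrable (fun y => tent y ^ 2) (surface Ω) :=
    integrableOn_frontier ho hc hne hb (htc.pow 2)
  set J := ∫ y, tent y ^ 2 ∂(surface Ω) with hJ
  set M := (surface Ω).real Set.univ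
  have hM : 0 ≤ M := measureReal_nonneg
  set S := {x ∈ Ω | |inner ℝ e (x - p) - c| < ℓ} with hS
  have hSfin : volume S ≠ ⊤ := (hb.subset (fun x hx => hx.1)).measure_lt_top.ne
  have hSJ : volume.real S ≤ s₀ * J := by
    have h1 : ENNReal.ofReal J = ∫⁻ y in frontier Ω, ENNReal.ofReal (tent y ^ 2)
        ∂(Measure.euclideanHausdorffMeasure n) :=
      ofReal_integral_eq_lintegral_ofReal hti
        (.of_forall fun y => sq_nonneg _)
    rw [← h1, ← ENNReal.ofReal_mul hs₀] at hle
    exact ENNReal.toReal_le_of_le_ofReal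
      (mul_nonneg hs₀ (integral_nonneg fun y => sq_nonneg _)) hle
  have hSpos : 0 < volume.real S := ENNReal.toReal_pos hpos.ne' hSfin
  have hJ0 : 0 < J := by
    by_contra h
    nlinarith [not_lt.1 h]
  have hs0 : 0 < s := hs₀.trans_lt hs
  -- The smoothing loss 2δℓM in the boundary integral then costs at most (s - s₀)J; M + 1 keeps the
  -- denominator nonzero.
  set δ := (s - s₀) * J / (2 * s * ℓ * (M + 1)) with hδ
  have hδ0 : 0 < δ := by have := sub_pos.2 hs; positivity
  have hδ1 : s * (2 * δ * ℓ * M) ≤ (s - s₀) * J := by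
    calc s * (2 * δ * ℓ * M) ≤ s * (2 * δ * ℓ * (M + 1)) := by gcongr; linarith
      _ = (s - s₀) * J := by rw [hδ]; field_simp
  obtain ⟨f, hf, hfs, hf1, hft⟩ := exists_smooth_tent c hℓ hδ0
  obtain ⟨q, hq, h2, h3⟩ := exists_triple_of_linear n ho hc hne hb p e hf
  have hfc : Continuous fun y : Space (n + 1) => f (inner ℝ e (y - p)) :=
    hf.continuous.comp (by fun_prop)
  have hfJ : J - 2 * δ * ℓ * M ≤ ‖q.2.2‖ ^ 2 := by
    rw [norm_sq_eq_integral_of_ae_eq h3]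
    have h4 : ∫ y, (tent y ^ 2 - 2 * δ * ℓ) ∂(surface Ω) = J - 2 * δ * ℓ * M := by
      rw [integral_sub hti (integrable_const _),
        integral_const, smul_eq_mul]
      ring
    have hfi : Integrable (fun y => f (inner ℝ e (y - p)) ^ 2) (surface Ω) :=
      integrableOn_frontier ho hc hne hb (hfc.pow 2)
    simp only [Real.norm_eq_abs, sq_abs]
    rw [← h4]
    refine integral_mono (hti.sub (integrable_const _)) hfi fun y => ?_
    exact sq_sub_le_sq_of_sub_le (le_max_left _ _)
      (max_le hℓ.le (by linarith [abs_nonneg (inner ℝ e (y - p) - c)])) hδ0.le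
      (hft (inner ℝ e (y - p)))
  have hgrad : ‖q.2.1‖ ^ 2 ≤ volume.real S := by
    rw [norm_sq_eq_integral_of_ae_eq h2]
    have hstrip : IsOpen {x : Space (n + 1) | |inner ℝ e (x - p) - c| < ℓ} :=
      isOpen_lt (by fun_prop) continuous_const
    have hSo : IsOpen S := ho.inter hstrip
    have hSm : MeasurableSet S := hSo.measurableSet
    have hSi : Integrable (S.indicator fun _ => (1 : ℝ)) (bulk Ω) := by
      have := isFiniteMeasure_bulk hb
      exact (integrable_const 1).indicator hSm
    calc ∫ x, ‖deriv f (inner ℝ e (x - p)) • e‖ ^ 2 ∂(bulk Ω)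
        ≤ ∫ x, S.indicator (fun _ => (1 : ℝ)) x ∂(bulk Ω) := by
          refine integral_mono_of_nonneg (.of_forall fun x => by positivity) hSi ?_
          filter_upwards [ae_restrict_mem ho.measurableSet] with x hx
          rw [norm_smul, he, mul_one, Real.norm_eq_abs]
          by_cases hxs : x ∈ S
          · rw [Set.indicator_of_mem hxs]
            exact pow_le_one₀ (abs_nonneg _) (hf1 _)
          · rw [Set.indicator_of_notMem hxs]
            have : deriv f (inner ℝ e (x - p)) = 0 := by
              by_contra h
              have h9 := hfs (support_deriv_subset (Function.mem_support.2 h))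
              rw [Metric.mem_ball, Real.dist_eq] at h9
              exact hxs ⟨hx, h9⟩
            simp [this]
      _ = volume.real S := by
          rw [integral_indicator hSm, setIntegral_const, smul_eq_mul, mul_one,
            measureReal_restrict_apply hSm, Set.inter_eq_left.2 fun x hx => hx.1]
  have hfin : ‖q.2.1‖ ^ 2 ≤ s * ‖q.2.2‖ ^ 2 := by
    have := mul_le_mul_of_nonneg_left hfJ hs0.le
    linarith
  refine ⟨q, hq, f, hfs, h2, h3, hfin, fun h0 => ?_⟩
  rw [h0, norm_zero] at hfJ
  have h1 := mul_le_mul_of_nonneg_left hfJ hs0.le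
  have h4 := hSpos.trans_le hSJ
  linarith

theorem inner_eq_zero_of_ae_eq {X E : Type*} [MeasurableSpace X] {μ : Measure X}
    [NormedAddCommGroup E] [InnerProductSpace ℝ E] {f g : Lp E 2 μ} {φ ψ : X → E}
    (hf : f =ᵐ[μ] φ) (hg : g =ᵐ[μ] ψ) (h : ∀ x, φ x = 0 ∨ ψ x = 0) : inner ℝ f g = 0 := by
  rw [L2.inner_def]
  refine integral_eq_zero_of_ae ?_
  filter_upwards [hf, hg] with x hx hy
  rw [hx, hy]
  rcases h x with h | h <;> simp [h]

/-! ### The eigenvalue bound with a free width. -/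

/-- The eigenvalue bound obtained from `k + 1` disjoint strips of width `2 * ℓ`. -/
theorem eigenvalue_le_of_two_mul_le_diam {m : ℕ} {Ω : Set (Space (m + 2))} (ho : IsOpen Ω)
    (hc : Convex ℝ Ω) (hne : Ω.Nonempty) (hb : Bornology.IsBounded Ω) {k : ℕ} {ℓ : ℝ}
    (hℓ : 0 < ℓ) (hk : 2 * ℓ * k ≤ Metric.diam Ω) :
    eigenvalue Ω k ≤ ENNReal.ofReal ((volume.real Ω / Metric.diam Ω) ^ (1 / ((m : ℝ) + 1)) *
      ((m + 2) * (m + 3) / (2 * ℓ ^ 2))) := by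
  obtain ⟨hD, p, e, he, hstrip⟩ := exists_diameter_strips ho hc hne hb
  set s₀ := (volume.real Ω / Metric.diam Ω) ^ (1 / ((m : ℝ) + 1)) *
    ((m + 2) * (m + 3) / (2 * ℓ ^ 2))
  have hs₀ : 0 ≤ s₀ := by positivity
  refine ENNReal.le_of_forall_pos_le_add fun ε hε _ => ?_
  -- Only the centres have to lie on the diameter; the end strips may stick out, hence 2ℓk ≤ D
  -- rather than 2ℓ(k + 1) ≤ D.
  have hmem : ∀ j : Fin (k + 1), 2 * ℓ * (j : ℕ) ∈ Set.Icc 0 (Metric.diam Ω) := by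
    intro j
    refine ⟨by positivity, le_trans ?_ hk⟩
    gcongr
    exact Nat.le_of_lt_succ j.2
  choose q hq f hfs h2 h3 hle hq0 using fun j : Fin (k + 1) =>
    exists_triple_of_volume_strip_le ho hc hne hb he hℓ hs₀
      (lt_add_of_pos_right s₀ (NNReal.coe_pos.2 hε)) (hstrip _ (hmem j) ℓ hℓ).1
      (hstrip _ (hmem j) ℓ hℓ).2
  have hdisj : ∀ i j : Fin (k + 1), i ≠ j → ∀ t, t ∉ tsupport (f i) ∨ t ∉ tsupport (f j) := by
    intro i j hij t
    by_contra! h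
    have hi := hfs i h.1
    have hj := hfs j h.2
    rw [Metric.mem_ball, Real.dist_eq, abs_lt] at hi hj
    rcases lt_or_gt_of_ne (fun h => hij (Fin.ext h) : (i : ℕ) ≠ j) with h' | h'
    · have : ((i : ℕ) : ℝ) + 1 ≤ (j : ℕ) := by exact_mod_cast h'
      have := mul_le_mul_of_nonneg_left this (by positivity : 0 ≤ 2 * ℓ)
      linarith
    · have : ((j : ℕ) : ℝ) + 1 ≤ (i : ℕ) := by exact_mod_cast h'
      have := mul_le_mul_of_nonneg_left this (by positivity : 0 ≤ 2 * ℓ)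
      linarith
  have h0 : ∀ i t, t ∉ tsupport (f i) → f i t = 0 ∧ deriv (f i) t = 0 := by
    intro i t ht
    exact ⟨image_eq_zero_of_notMem_tsupport ht,
      by_contra fun h => ht (support_deriv_subset (Function.mem_support.2 h))⟩
  have key := eigenvalue_le_of_orthogonal_family ho hc hne hb (s := s₀.toNNReal + ε) q
    (fun j => Submodule.le_topologicalClosure _ (hq j))
    (fun i j hij => inner_eq_zero_of_ae_eq (h2 i) (h2 j) fun x =>
      (hdisj i j hij (inner ℝ e (x - p))).imp (fun h => by rw [(h0 i _ h).2, zero_smul])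
        fun h => by rw [(h0 j _ h).2, zero_smul])
    (fun i j hij => inner_eq_zero_of_ae_eq (h3 i) (h3 j) fun x =>
      (hdisj i j hij (inner ℝ e (x - p))).imp (fun h => (h0 i _ h).1) fun h => (h0 j _ h).1)
    (fun j => by
      rw [NNReal.coe_add, Real.coe_toNNReal _ hs₀]
      exact hle j) hq0
  rwa [ENNReal.coe_add] at key

/-! ### Ball volumes and comparison of constants. -/

theorem ballVolume_eq (n : ℕ) :
    ballVolume (n + 1) = √Real.pi ^ (n + 1) / Real.Gamma (((n + 1 : ℕ) : ℝ) / 2 + 1) := by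
  rw [ballVolume, measureReal_def, EuclideanSpace.volume_ball]
  simp
  positivity

theorem ballVolume_zero : ballVolume 0 = 1 := by
  rw [ballVolume, measureReal_def, volume_euclideanSpace_eq_dirac]
  simp

theorem ballVolume_one : ballVolume 1 = 2 := by
  rw [ballVolume_eq]
  have : Real.Gamma (((0 + 1 : ℕ) : ℝ) / 2 + 1) = √Real.pi / 2 := by
    rw [Real.Gamma_add_one (by norm_num)]
    push_cast
    rw [Real.Gamma_one_half_eq]
    ring
  rw [this, zero_add, pow_one]
  have : √Real.pi ≠ 0 := by positivity
  field_simp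

theorem ballVolume_pos (n : ℕ) : 0 < ballVolume n :=
  ENNReal.toReal_pos (Metric.measure_ball_pos _ _ one_pos).ne' Metric.isBounded_ball.measure_lt_top.ne

theorem ballVolume_add_two (n : ℕ) :
    ballVolume (n + 2) = ballVolume n * (2 * Real.pi / (n + 2)) := by
  have hpi : √Real.pi ^ 2 = Real.pi := Real.sq_sqrt Real.pi_pos.le
  rcases n with _ | n
  · rw [ballVolume_eq 1, ballVolume_zero]
    push_cast
    norm_num [hpi]
  · rw [ballVolume_eq (n + 2), ballVolume_eq n]
    have : (((n + 2 + 1 : ℕ) : ℝ) / 2 + 1) = ((n + 1 : ℕ) : ℝ) / 2 + 1 + 1 := by push_cast; ring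
    rw [this, Real.Gamma_add_one (by positivity)]
    have hG : Real.Gamma (((n + 1 : ℕ) : ℝ) / 2 + 1) ≠ 0 :=
      (Real.Gamma_pos_of_pos (by positivity)).ne'
    rw [show n + 2 + 1 = (n + 1) + 2 by ring, pow_add _ (n + 1) 2, hpi]
    push_cast
    field_simp

/-- Two-step induction, since 2π/(n+2) ≤ π ≤ 4. -/
theorem ballVolume_le_two_pow : ∀ n : ℕ, ballVolume n ≤ 2 ^ n
  | 0 => by rw [ballVolume_zero, pow_zero]
  | 1 => by rw [ballVolume_one, pow_one]
  | n + 2 => by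
    rw [ballVolume_add_two, pow_add]
    refine mul_le_mul (ballVolume_le_two_pow n) ?_ (by positivity) (by positivity)
    rw [div_le_iff₀ (by positivity)]
    have : (0 : ℝ) ≤ n := Nat.cast_nonneg n
    linarith [Real.pi_le_four]

theorem ballVolume_le_half_mul : ∀ n : ℕ,
    ballVolume n ≤ ((n : ℝ) + 1) / 2 * ballVolume (n + 1)
  | 0 => by rw [ballVolume_zero, ballVolume_one]; norm_num
  | 1 => by
    rw [ballVolume_one, ballVolume_add_two, ballVolume_zero]
    push_cast
    linarith [Real.pi_gt_three]
  | n + 2 => by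
    rw [ballVolume_add_two n, show n + 2 + 1 = (n + 1) + 2 by ring, ballVolume_add_two (n + 1)]
    have ih := ballVolume_le_half_mul n
    calc ballVolume n * (2 * Real.pi / (n + 2))
        ≤ ((n : ℝ) + 1) / 2 * ballVolume (n + 1) * (2 * Real.pi / (n + 2)) := by gcongr
      _ = ballVolume (n + 1) * Real.pi * (((n : ℝ) + 1) / (n + 2)) := by ring
      _ ≤ ballVolume (n + 1) * Real.pi * 1 := by
          have := (ballVolume_pos (n + 1)).le
          gcongr
          exact (div_le_one (by positivity)).2 (by linarith)
      _ = _ := by push_cast; field_simp; ring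

theorem dimConst_pos (m : ℕ) : 0 < dimConst (m + 2) := by
  have h0 := ballVolume_pos m
  have h1 := ballVolume_pos (m + 1)
  have e : ((m + 2 : ℕ) : ℝ) - 1 = m + 1 := by push_cast; ring
  rw [dimConst, e]
  simp only [Nat.add_sub_cancel, Nat.add_succ_sub_one]
  positivity

/-- Split ω_{m+1} as ω_{m+1}^{m/(m+1)} ω_{m+1}^{1/(m+1)}. The second factor is at most 2, which
cancels the 1/2 in ω_m ≤ ((m+1)/2) ω_{m+1}. -/
theorem dimConst_le_one (m : ℕ) : dimConst (m + 2) ≤ 1 := by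
  have h1 := ballVolume_pos (m + 1)
  have e : ((m + 2 : ℕ) : ℝ) - 1 = m + 1 := by push_cast; ring
  have e2 : ((m + 2 : ℕ) : ℝ) - 2 = m := by push_cast; ring
  rw [dimConst, e, e2]
  simp only [Nat.add_sub_cancel, Nat.add_succ_sub_one]
  rw [div_le_one (by positivity)]
  have h2 : ballVolume (m + 1) ^ (1 / ((m : ℝ) + 1)) ≤ 2 := by
    refine (Real.rpow_le_rpow h1.le (ballVolume_le_two_pow (m + 1)) (by positivity)).trans_eq ?_
    rw [← Real.rpow_natCast, ← Real.rpow_mul zero_le_two]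
    push_cast
    rw [mul_one_div_cancel (by positivity), Real.rpow_one]
  have h3 : ballVolume (m + 1)
      = ballVolume (m + 1) ^ ((m : ℝ) / (m + 1)) * ballVolume (m + 1) ^ (1 / ((m : ℝ) + 1)) := by
    rw [← Real.rpow_add h1, ← add_div, div_self (by positivity), Real.rpow_one]
  calc ballVolume m ≤ ((m : ℝ) + 1) / 2 * ballVolume (m + 1) := ballVolume_le_half_mul m
    _ = ((m : ℝ) + 1) / 2 * (ballVolume (m + 1) ^ ((m : ℝ) / (m + 1)) *
        ballVolume (m + 1) ^ (1 / ((m : ℝ) + 1))) := by rw [← h3]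
    _ ≤ ((m : ℝ) + 1) / 2 * (ballVolume (m + 1) ^ ((m : ℝ) / (m + 1)) * 2) := by gcongr
    _ = _ := by ring

/-- Raising m by one multiplies the left side by (m+4)/(m+2) ≤ 2 and the right side by 2(k+1) ≥ 2.
The base case is fairly tight at k = 2 (about 202 against 216), so the shift 1/10 has to be small.
-/
theorem mul_sq_le_two_mul_succ_pow (m k : ℕ) :
    2 * ((m : ℝ) + 2) * (m + 3) * (2 * k + 1 / 10) ^ 2 ≤ (2 * ((k : ℝ) + 1)) ^ (m + 3) := by
  have hk0 : (0 : ℝ) ≤ k := Nat.cast_nonneg k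
  induction m with
  | zero =>
    rcases Nat.eq_zero_or_pos k with rfl | hk
    · norm_num
    have hk1 : (1 : ℝ) ≤ k := by exact_mod_cast hk
    norm_num
    nlinarith [mul_nonneg (sub_nonneg.2 hk1) (sq_nonneg ((k : ℝ) - 1 - 1 / 2))]
  | succ m ih =>
    have hm : (0 : ℝ) ≤ m := Nat.cast_nonneg m
    rw [show m + 1 + 3 = (m + 3) + 1 by ring, pow_succ]
    push_cast
    calc 2 * ((m : ℝ) + 1 + 2) * (m + 1 + 3) * (2 * k + 1 / 10) ^ 2
        = ((m : ℝ) + 3) * (2 * (k : ℝ) + 1 / 10) ^ 2 * (2 * ((m : ℝ) + 4)) := by ring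
      _ ≤ ((m : ℝ) + 3) * (2 * (k : ℝ) + 1 / 10) ^ 2 *
          (2 * ((m : ℝ) + 2) * (2 * ((k : ℝ) + 1))) := by
          refine mul_le_mul_of_nonneg_left ?_ (by positivity)
          nlinarith [mul_nonneg hm hk0]
      _ = 2 * ((m : ℝ) + 2) * (m + 3) * (2 * (k : ℝ) + 1 / 10) ^ 2 *
          (2 * ((k : ℝ) + 1)) := by ring
      _ ≤ _ := mul_le_mul_of_nonneg_right ih (by positivity)

end Steklov

end

theorem proposition2p2 (d : ℕ) (hd : 2 ≤ d) (k : ℕ) (Ω : Set (EuclideanSpace ℝ (Fin d)))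
    (hΩ_open : IsOpen Ω) (hΩ_convex : Convex ℝ Ω) (hΩ_nonempty : Ω.Nonempty)
    (hΩ_bounded : Bornology.IsBounded Ω) (D : ℝ) (hD : Metric.diam Ω = D) :
    Steklov.eigenvalue Ω k ≤
      ENNReal.ofReal (Steklov.estimateConst d k *
        (volume.real Ω ^ (1 / ((d : ℝ) - 1)) / D ^ ((2 * (d : ℝ) - 1) / ((d : ℝ) - 1)))) := by
  obtain ⟨m, rfl⟩ := Nat.exists_eq_add_of_le' hd
  have hD0 : 0 < D := hD ▸ Steklov.diam_pos_of_isOpen hΩ_open hΩ_nonempty hΩ_bounded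
  have hr : (0 : ℝ) < 2 * k + 1 / 10 := by positivity
  -- The half-width is ℓ = D/(2k + 1/10), slightly below D/(2k); the shift keeps it meaningful for k
  -- = 0.
  have hk : 2 * (D / (2 * k + 1 / 10)) * k ≤ Metric.diam Ω := by
    rw [hD, mul_div_assoc', div_mul_eq_mul_div, div_le_iff₀ hr]
    nlinarith
  refine (Steklov.eigenvalue_le_of_two_mul_le_diam hΩ_open hΩ_convex hΩ_nonempty hΩ_bounded
    (div_pos hD0 hr) hk).trans (ENNReal.ofReal_le_ofReal ?_)
  have hm : ((m : ℝ) + 1) ≠ 0 := by positivity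
  have e1 : ((m + 2 : ℕ) : ℝ) - 1 = m + 1 := by push_cast; ring
  -- The exponent of D splits into 1/(d-1), from (|Ω|/D)^{1/(d-1)}, and 2, from ℓ².
  have e2 : (2 * ((m + 2 : ℕ) : ℝ) - 1) / ((m : ℝ) + 1) = 1 / ((m : ℝ) + 1) + (2 : ℕ) := by
    push_cast; field_simp; ring
  have hV : (0 : ℝ) ≤ volume.real Ω := measureReal_nonneg
  rw [hD, e1, e2, Real.rpow_add hD0, Real.rpow_natCast, Real.div_rpow hV hD0.le]
  set X := volume.real Ω ^ (1 / ((m : ℝ) + 1)) / D ^ (1 / ((m : ℝ) + 1)) with hX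
  have hX0 : 0 ≤ X := by positivity
  have hcst : ((m : ℝ) + 2) * (m + 3) * (2 * k + 1 / 10) ^ 2 / 2
      ≤ Steklov.estimateConst (m + 2) k := by
    have h1 := Steklov.mul_sq_le_two_mul_succ_pow m k
    have h2 := Steklov.dimConst_pos m
    have h3 := Steklov.dimConst_le_one m
    rw [Steklov.estimateConst, le_div_iff₀ (by positivity)]
    calc ((m : ℝ) + 2) * (m + 3) * (2 * k + 1 / 10) ^ 2 / 2 * (4 * Steklov.dimConst (m + 2))
        ≤ ((m : ℝ) + 2) * (m + 3) * (2 * k + 1 / 10) ^ 2 / 2 * (4 * 1) := by gcongr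
      _ = 2 * ((m : ℝ) + 2) * (m + 3) * (2 * k + 1 / 10) ^ 2 := by ring
      _ ≤ _ := h1
  calc X * (((m : ℝ) + 2) * (m + 3) / (2 * (D / (2 * k + 1 / 10)) ^ 2))
      = ((m : ℝ) + 2) * (m + 3) * (2 * k + 1 / 10) ^ 2 / 2 * (X / D ^ 2) := by
        field_simp
    _ ≤ Steklov.estimateConst (m + 2) k * (X / D ^ 2) := by gcongr
    _ = _ := by rw [hX, div_div]
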